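/- **Theorem 3.2 (Clifford action of exotic Courant algebroids on exotic differential forms).** Let $\pi:Z\to M$ and $\hat\pi:\hat Z\to M$ be smooth principal circle bundles over a smooth manifold $M$ (for instance T-dual ones), with generators $v,\hat v$ of period one and invariant connection forms $A,\hat A$ normalized by $A(v)=1$, $\hat A(\hat v)=1$. Let $L=Z\times_{S^1}\mathbb C$ be the line bundle associated to $Z$ and the standard representation. Direct sums over $n\in\mathbb Z$ are Fréchet completed: their elements are the families $(u_n)$ of smooth sections which, in charts and in the frames of $L^{\otimes n}$ given by local sections of $Z$, decrease faster than every power of $|n|$, uniformly on compact sets with all derivatives. All sections and forms are complex valued. Put $$\Gamma(\mathcal L)=\bigoplus_n\Gamma(M,L^{\otimes n}),\qquad \Gamma(\hat{\mathcal E})=\bigoplus_n\Gamma\big(\hat Z,(T\hat Z\oplus T^*\hat Z)\otimes\hat\pi^*L^{\otimes n}\big)^{\hat S^1},\qquad \mathcal A^{\bar k}(\hat Z)^{\hat S^1}=\bigoplus_n\Omega^{\bar k}(\hat Z,\hat\pi^*L^{\otimes n})^{\hat S^1},$$ where $\bar k=k\bmod 2$, let $\mathcal A=\mathcal A^{\bar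 0}\oplus\mathcal A^{\bar 1}$, and let $$\langle (X+\alpha)\otimes s_1,(Y+\beta)\otimes s_2\rangle=\tfrac12(\alpha(Y)+\beta(X))\,s_1\otimes s_2 .$$ (i) The products on $\Gamma(\mathcal L)$, of $\Gamma(\mathcal L)$ with $\Gamma(\hat{\mathcal E})$, and the pairing $\langle\cdot,\cdot\rangle:\Gamma(\hat{\mathcal E})\times\Gamma(\hat{\mathcal E})\to\Gamma(\mathcal L)$ are well defined (by convergent sums over the weights). Let $\mathrm{Cl}$ be the algebra generated by the ring $\Gamma(\mathcal L)$ as central scalars and the $\Gamma(\mathcal L)$-module $\Gamma(\hat{\mathcal E})$, with the relations $a^2=\langle a,a\rangle$ for $a\in\Gamma(\hat{\mathcal E})$. Then $$\big((X+\alpha)\otimes s_1\big)\cdot(\omega\otimes s_2)=(\iota_X\omega+\alpha\wedge\omega)\otimes s_1\otimes s_2$$ defines, together with multiplication by scalars, an action of the algebra $\mathrm{Cl}$ on $\mathcal A$, for which $\Gamma(\hat{\mathcal E})$ maps $\mathcal A^{\bar k}(\hat Z)^{\hat S^1}$ to $\mathcal A^{\overline{k+1}}(\hat Z)^{\hat S^1}$.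 (ii) For $\omega\in\Omega(Z)$ let $\tau(\omega)=(\tau_n(\omega))_n$ be given by the exotic Hori formula $\tau_n(\omega)=\int^{S^1,n}\omega\wedge e^{\hat A\wedge A}$: one contracts with the generator of the fibres of $Z\times_M\hat Z\to\hat Z$ (on the left), integrates over the fibres the component of weight $-n$ (the one on which $e^{2\pi i\theta}$ acts by $e^{-2\pi in\theta}$), and regards the result as a form on $\hat Z$ with values in $\hat\pi^*L^{\otimes n}$. For $a\in\Gamma(Z,TZ\oplus T^*Z)$ let $\mu(a)=(\mu_n(a))_n$ where, if the component of weight $-n$ of $a$ is $e^{-2\pi in\theta}(X+fv+\xi+gA)$ locally, with $X$ a vector field on $M$ (lifted horizontally), $\xi$ a 1-form and $f,g$ functions on $M$, and $s$ is the local unit section of $L$ defined by $\theta=0$, $$\mu_n(a)=-(X+g\hat v+\xi+f\hat A)\otimes s^{\otimes n}.$$ Then $\mu:\Gamma(Z,TZ\oplus T^*Z)\to\Gamma(\hat{\mathcal E})$ and $\tau:\Omega(Z)\to\mathcal A$ are well-defined $\mathbb C$-linear bijections, $\tau$ restricts to bijections $\Omega^{\bar k}(Z)\to\mathcal A^{\overline{k+1}}(\hat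 Z)^{\hat S^1}$, and, with the action $(x+\alpha)\cdot\omega=\iota_x\omega+\alpha\wedge\omega$ of $\Gamma(Z,TZ\oplus T^*Z)$ on $\Omega(Z)$, the map $\tau$ is a module isomorphism along $\mu$: $$\tau(a\cdot\omega)=\mu(a)\cdot\tau(\omega)\qquad\text{for all } a\in\Gamma(Z,TZ\oplus T^*Z),\ \omega\in\Omega(Z).$$ -/

import Mathlib

open scoped Manifold ContDiff

noncomputable section

namespace ExoticCourant

/-! ### Complexified linear algebra of a real vector space -/

section Linear

variable (V : Type*) [AddCommGroup V] [Module ℝ V]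

/-- The complexified dual `V* ⊗ ℂ`. -/
abbrev CCovec := V →ₗ[ℝ] ℂ

/-- The complexification `V ⊗ ℂ` of a finite dimensional `V`, as the complex dual of `V* ⊗ ℂ`. -/
abbrev CVec := Module.Dual ℂ (CCovec V)

/-- The complexified generalized tangent space `(V ⊕ V*) ⊗ ℂ`; a pair `(X, α)` is `X + α`. -/
abbrev GenTan := CVec V × CCovec V

/-- The complex exterior algebra `Λ(V* ⊗ ℂ)` of forms (of mixed degree) on `V`. -/
abbrev Ext := ExteriorAlgebra ℂ (CCovec V)

variable {V} {W : Type*} [AddCommGroup W] [Module ℝ W]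

/-- A real vector as a complexified vector. -/
def CVec.ofReal (v : V) : CVec V where
  toFun α := α v
  map_add' _ _ := rfl
  map_smul' _ _ := rfl

/-- A real covector as a complex covector. -/
def CCovec.ofReal (a : V →ₗ[ℝ] ℝ) : CCovec V := Complex.ofRealCLM.toLinearMap ∘ₗ a

/-- Pull-back of complex covectors along a real linear map. -/
def pull (L : V →ₗ[ℝ] W) : CCovec W →ₗ[ℂ] CCovec V where
  toFun α := α ∘ₗ L
  map_add' _ _ := rfl
  map_smul' _ _ := rfl

/-- Push-forward of complexified vectors along a real linear map. -/
def push (L : V →ₗ[ℝ] W) : CVec V →ₗ[ℂ] CVec W := (pull L).dualMap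

/-- Pull-back of forms along a real linear map. -/
def pullExt (L : V →ₗ[ℝ] W) : Ext W →ₐ[ℂ] Ext V := ExteriorAlgebra.map (pull L)

/-- The interior product `ι_X`. -/
def interior (X : CVec V) : Ext V →ₗ[ℂ] Ext V := CliffordAlgebra.contractLeft X

/-- A covector as a form of degree one. -/
def oneForm (α : CCovec V) : Ext V := ExteriorAlgebra.ι ℂ α

/-- The Clifford action `(X + α) · η = ι_X η + α ∧ η`. -/
def cliff (a : GenTan V) (η : Ext V) : Ext V := interior a.1 η + oneForm a.2 * η

/-- The pairing `⟨X + α, Y + β⟩ = (α(Y) + β(X)) / 2`. -/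
def pairing (a b : GenTan V) : ℂ := (b.1 a.2 + a.1 b.2) / 2

variable (V) in
/-- Forms all of whose homogeneous components have degree `≡ k mod 2`. -/
def parity (k : ZMod 2) : Submodule ℂ (Ext V) :=
  CliffordAlgebra.evenOdd (0 : QuadraticForm ℂ (CCovec V)) k

/-- `e^{α ∧ β} = 1 + α ∧ β` for covectors `α`, `β`; by `wedge_sq` the higher terms vanish. -/
def expWedge (α β : CCovec V) : Ext V := 1 + oneForm α * oneForm β

theorem wedge_sq (α β : CCovec V) :
    (oneForm α * oneForm β) * (oneForm α * oneForm β) = 0 := by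
  have h : oneForm β * oneForm α = -(oneForm α * oneForm β) :=
    eq_neg_of_add_eq_zero_left (ExteriorAlgebra.ι_add_mul_swap β α)
  have h2 : oneForm α * oneForm α = 0 := ExteriorAlgebra.ι_sq_zero α
  calc (oneForm α * oneForm β) * (oneForm α * oneForm β)
      = oneForm α * (oneForm β * oneForm α) * oneForm β := by simp only [mul_assoc]
    _ = -((oneForm α * oneForm α) * oneForm β * oneForm β) := by
        rw [h]; simp only [mul_neg, neg_mul, mul_assoc]
    _ = 0 := by rw [h2]; simp

end Linear

/-! ### Sums and integrals in finite dimensional complex vector spaces -/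

section Weak

variable {W : Type*} [AddCommGroup W] [Module ℂ W]

/-- `w = ∑ₘ f m`, tested against linear functionals (used for finite dimensional `W`). -/
def HasWeakSum (f : ℤ → W) (w : W) : Prop :=
  ∀ l : Module.Dual ℂ W, HasSum (fun m => l (f m)) (l w)

/-- `w = ∫₀¹ f(t) dt`, tested against linear functionals (used for finite dimensional `W`). -/
def HasWeakIntegral (f : ℝ → W) (w : W) : Prop :=
  ∀ l : Module.Dual ℂ W, IntervalIntegrable (fun t => l (f t)) MeasureTheory.volume 0 1 ∧
    l w = ∫ t in (0 : ℝ)..1, l (f t)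

end Weak

/-! ### Smooth fields on a manifold -/

section Fields

variable (E : Type*) [NormedAddCommGroup E] [NormedSpace ℝ E]
variable {N : Type*} [TopologicalSpace N] [ChartedSpace E N]

/-- The tangent space at `y` of a manifold modelled on `E`. -/
abbrev T (y : N) := TangentSpace 𝓘(ℝ, E) y

/-- Derivative of the chart at `y₀`, at the point with coordinates `t`. -/
def dChart (y₀ : N) (t : E) : T E ((chartAt E y₀).symm t) →ₗ[ℝ] E :=
  (mfderiv 𝓘(ℝ, E) 𝓘(ℝ, E) (chartAt E y₀) ((chartAt E y₀).symm t)).toLinearMap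

/-- Derivative of the inverse of the chart at `y₀`, at coordinates `t`. -/
def dChartSymm (y₀ : N) (t : E) : E →ₗ[ℝ] T E ((chartAt E y₀).symm t) :=
  (mfderiv 𝓘(ℝ, E) 𝓘(ℝ, E) (chartAt E y₀).symm t).toLinearMap

/-- A field of forms, written in the chart at `y₀`. -/
def extRep (y₀ : N) : (∀ y : N, Ext (T E y)) →ₗ[ℂ] (E → Ext E) where
  toFun η t := pullExt (dChartSymm E y₀ t) (η ((chartAt E y₀).symm t))
  map_add' _ _ := by funext t; simp
  map_smul' _ _ := by funext t; simp

/-- A section of `(TN ⊕ T*N) ⊗ ℂ`, written in the chart at `y₀`. -/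
def genRep (y₀ : N) : (∀ y : N, GenTan (T E y)) →ₗ[ℂ] (E → GenTan E) where
  toFun a t := (push (dChart E y₀ t) (a ((chartAt E y₀).symm t)).1,
    pull (dChartSymm E y₀ t) (a ((chartAt E y₀).symm t)).2)
  map_add' _ _ := by funext t; simp
  map_smul' _ _ := by funext t; simp

/-- A complex function, written in the chart at `y₀`. -/
def funRep (y₀ : N) : (N → ℂ) →ₗ[ℂ] (E → ℂ) where
  toFun f t := f ((chartAt E y₀).symm t)
  map_add' _ _ := rfl
  map_smul' _ _ := rfl

variable {E} {F : N → Type*} [∀ y, AddCommGroup (F y)] [∀ y, Module ℂ (F y)]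
  {W : Type*} [AddCommGroup W] [Module ℂ W]

/-- A field is smooth if its coefficients in every chart are smooth; `R` is the operation of
writing the field in charts. -/
def IsSmoothField (R : N → (∀ y, F y) →ₗ[ℂ] (E → W)) (u : ∀ y, F y) : Prop :=
  ∀ (y₀ : N) (l : Module.Dual ℂ W),
    ContDiffOn ℝ ∞ (fun t => l (R y₀ u t)) (chartAt E y₀).target

/-- The space of smooth fields. -/
def smoothFields (R : N → (∀ y, F y) →ₗ[ℂ] (E → W)) : Submodule ℂ (∀ y, F y) where
  carrier := {u | IsSmoothField R u}
  add_mem' {u v} hu hv y₀ l := by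
    simpa using (hu y₀ l).add (hv y₀ l)
  zero_mem' y₀ l := by
    simpa using contDiffOn_const
  smul_mem' c u hu y₀ l := by
    simpa using (hu y₀ l).const_smul c

variable (E N)

/-- Complex differential forms `Ω(N)` (of mixed degree). -/
abbrev Forms : Submodule ℂ (∀ y : N, Ext (T E y)) := smoothFields (extRep E)

/-- Smooth sections `Γ(N, (TN ⊕ T*N) ⊗ ℂ)`. -/
abbrev Sections : Submodule ℂ (∀ y : N, GenTan (T E y)) := smoothFields (genRep E)

end Fields

/-! ### Principal circle bundles -/

section Bundle

variable (EM EZ : Type*) [NormedAddCommGroup EM] [NormedSpace ℝ EM]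
  [NormedAddCommGroup EZ] [NormedSpace ℝ EZ]
  {M Z : Type*} [TopologicalSpace M] [ChartedSpace EM M] [TopologicalSpace Z] [ChartedSpace EZ Z]
  [MulAction Circle Z]

/-- `p : Z → M` is a smooth principal circle bundle. -/
structure IsPrincipalCircleBundle (p : Z → M) : Prop where
  contMDiff_proj : ContMDiff 𝓘(ℝ, EZ) 𝓘(ℝ, EM) ∞ p
  contMDiff_smul : ContMDiff ((𝓡 1).prod 𝓘(ℝ, EZ)) 𝓘(ℝ, EZ) ∞ (fun a : Circle × Z => a.1 • a.2)
  exists_triv : ∀ x : M, ∃ U : Set M, IsOpen U ∧ x ∈ U ∧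
    ∃ Φ : OpenPartialHomeomorph (M × Circle) Z,
      Φ.source = U ×ˢ Set.univ ∧ Φ.target = p ⁻¹' U ∧
      ContMDiffOn (𝓘(ℝ, EM).prod (𝓡 1)) 𝓘(ℝ, EZ) ∞ Φ Φ.source ∧
      ContMDiffOn 𝓘(ℝ, EZ) (𝓘(ℝ, EM).prod (𝓡 1)) ∞ Φ.symm Φ.target ∧
      ∀ y ∈ U, ∀ c : Circle, p (Φ (y, c)) = y ∧ Φ (y, c) = c • Φ (y, 1)

/-- The element `e^{2πit}` of the circle. -/
def rot (t : ℝ) : Circle := Circle.exp (2 * Real.pi * t)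

/-- The generator `v` of period one of the circle action. -/
def gen (z : Z) : T EZ z :=
  mfderiv 𝓘(ℝ, ℝ) 𝓘(ℝ, EZ) (fun t : ℝ => rot t • z) 0 (1 : ℝ)

/-- Derivative at `z` of the action of `c`. -/
def dAct (c : Circle) (z : Z) : T EZ z →ₗ[ℝ] T EZ (c • z) :=
  (mfderiv 𝓘(ℝ, EZ) 𝓘(ℝ, EZ) (fun y : Z => c • y) z).toLinearMap

/-- Derivative at `z` of the projection. Tangent spaces of `M` are copies of `EM`, so the values
at two points with the same image can be compared. -/
def dProj (p : Z → M) (z : Z) : T EZ z →ₗ[ℝ] EM :=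
  (mfderiv 𝓘(ℝ, EZ) 𝓘(ℝ, EM) p z).toLinearMap

/-- `A` is a connection form, normalized by `A(v) = 1`. -/
structure IsConnectionForm (A : ∀ z : Z, T EZ z →ₗ[ℝ] ℝ) : Prop where
  smooth : IsSmoothField (extRep EZ) (fun z => oneForm (CCovec.ofReal (A z)))
  gen_eq_one : ∀ z, A z (gen EZ z) = 1
  invariant : ∀ (c : Circle) (z : Z), A (c • z) ∘ₗ dAct EZ c z = A z

/-- A smooth section of `p` over `U`. -/
structure IsLocalSection (p : Z → M) (U : Set M) (σ : M → Z) : Prop where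
  smooth : ContMDiffOn 𝓘(ℝ, EM) 𝓘(ℝ, EZ) ∞ σ U
  right_inv : ∀ x ∈ U, p (σ x) = x

/-- The fibre of `p` over `x`. -/
abbrev Fib (p : Z → M) (x : M) := {z : Z // p z = x}

/-- `W ⊗ Lₓ^{⊗n}`, where `L = Z ×_{S¹} ℂ` is the line bundle associated to `Z` and the standard
representation. Since `L^{⊗n}` is associated to the `n`-th power of that representation, an
element is the same as a map `s` from the fibre of `Z` over `x` to `W` with
`s(c z) = c⁻ⁿ s(z)`. Under this identification tensor products of elements of powers of `L`
are pointwise products, and a local section `σ` of `Z`, seen as a unit section of `L`, has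
`n`-th power given by `s(σ(x)) = 1`. -/
def lineTensor (p : Z → M) (W : Type*) [AddCommGroup W] [Module ℂ W] (n : ℤ) (x : M) :
    Submodule ℂ (Fib p x → W) where
  carrier := {s | ∀ (z z' : Fib p x) (c : Circle), z'.1 = c • z.1 →
    s z' = ((c : ℂ) ^ (-n)) • s z}
  add_mem' {s s'} h h' z z' c hz := by simp [h z z' c hz, h' z z' c hz]
  zero_mem' z z' c hz := by simp
  smul_mem' a s h z z' c hz := by simp [h z z' c hz, smul_comm a]

end Bundle

/-! ### Completed direct sums -/

section Rapid

variable {E : Type*} [NormedAddCommGroup E] [NormedSpace ℝ E]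

/-- The functions `u n` are smooth on the open set `V`, and for each compact subset the suprema
of the derivatives of each order decrease faster than every power of `|n|`. -/
def RapidOn (V : Set E) (u : ℤ → E → ℂ) : Prop :=
  (∀ n, ContDiffOn ℝ ∞ (u n) V) ∧
  ∀ K ⊆ V, IsCompact K → ∀ j k : ℕ, ∃ C : ℝ, ∀ n : ℤ, ∀ t ∈ K,
    (1 + |(n : ℝ)|) ^ k * ‖iteratedFDeriv ℝ j (u n) t‖ ≤ C

variable {V : Set E} {u w : ℤ → E → ℂ}

theorem RapidOn.zero : RapidOn V (fun _ _ => 0) := by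
  refine ⟨fun n => contDiffOn_const, fun K _ _ j k => ⟨0, fun n t _ => ?_⟩⟩
  simp

theorem RapidOn.add (hV : IsOpen V) (hu : RapidOn V u) (hw : RapidOn V w) :
    RapidOn V (fun n t => u n t + w n t) := by
  refine ⟨fun n => (hu.1 n).add (hw.1 n), fun K hK hc j k => ?_⟩
  obtain ⟨C, hC⟩ := hu.2 K hK hc j k
  obtain ⟨D, hD⟩ := hw.2 K hK hc j k
  refine ⟨C + D, fun n t ht => ?_⟩
  have h1 : ContDiffAt ℝ j (u n) t :=
    ((hu.1 n).contDiffAt (hV.mem_nhds (hK ht))).of_le (by exact_mod_cast le_top)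
  have h2 : ContDiffAt ℝ j (w n) t :=
    ((hw.1 n).contDiffAt (hV.mem_nhds (hK ht))).of_le (by exact_mod_cast le_top)
  have h3 : iteratedFDeriv ℝ j (fun t => u n t + w n t) t =
      iteratedFDeriv ℝ j (u n) t + iteratedFDeriv ℝ j (w n) t :=
    iteratedFDeriv_add_apply h1 h2
  have hp : 0 ≤ (1 + |(n : ℝ)|) ^ k := by positivity
  calc _ ≤ (1 + |(n : ℝ)|) ^ k *
        (‖iteratedFDeriv ℝ j (u n) t‖ + ‖iteratedFDeriv ℝ j (w n) t‖) := by
        rw [h3]; exact mul_le_mul_of_nonneg_left (norm_add_le _ _) hp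
    _ ≤ C + D := by rw [mul_add]; exact add_le_add (hC n t ht) (hD n t ht)

theorem RapidOn.smul (hV : IsOpen V) (c : ℂ) (hu : RapidOn V u) :
    RapidOn V (fun n t => c * u n t) := by
  refine ⟨fun n => contDiffOn_const.mul (hu.1 n), fun K hK hc j k => ?_⟩
  obtain ⟨C, hC⟩ := hu.2 K hK hc j k
  refine ⟨‖c‖ * C, fun n t ht => ?_⟩
  have h1 : ContDiffAt ℝ j (u n) t :=
    ((hu.1 n).contDiffAt (hV.mem_nhds (hK ht))).of_le (by exact_mod_cast le_top)
  have h3 : iteratedFDeriv ℝ j (fun t => c * u n t) t = c • iteratedFDeriv ℝ j (u n) t :=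
    iteratedFDeriv_const_smul_apply' (a := c) h1
  calc _ = ‖c‖ * ((1 + |(n : ℝ)|) ^ k * ‖iteratedFDeriv ℝ j (u n) t‖) := by
        rw [h3, norm_smul]; ring
    _ ≤ ‖c‖ * C := mul_le_mul_of_nonneg_left (hC n t ht) (norm_nonneg c)

end Rapid

section Completed

variable {EM EZ E : Type*} [NormedAddCommGroup EM] [NormedSpace ℝ EM]
  [NormedAddCommGroup EZ] [NormedSpace ℝ EZ] [NormedAddCommGroup E] [NormedSpace ℝ E]
  {M Z N : Type*} [TopologicalSpace M] [ChartedSpace EM M] [TopologicalSpace Z] [ChartedSpace EZ Z]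
  [MulAction Circle Z] [TopologicalSpace N] [ChartedSpace E N]
  (p : Z → M) {q : N → M}
  {F : N → Type*} [∀ y, AddCommGroup (F y)] [∀ y, Module ℂ (F y)]
  {W : Type*} [AddCommGroup W] [Module ℂ W]

open Classical in
/-- The coefficient of an `F ⊗ q*L^{⊗n}`-valued field `u` in the frame of `L^{⊗n}` given by a
local section `σ` of `Z` (and `0` where `σ` is not a section). -/
def along (σ : M → Z) :
    (∀ y : N, Fib p (q y) → F y) →ₗ[ℂ] (∀ y : N, F y) where
  toFun u y := if h : p (σ (q y)) = q y then u y ⟨σ (q y), h⟩ else 0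
  map_add' u w := by funext y; by_cases h : p (σ (q y)) = q y <;> simp [h]
  map_smul' c u := by funext y; by_cases h : p (σ (q y)) = q y <;> simp [h]

variable (EM EZ) in
/-- The completed direct sum over `n ∈ ℤ` of the spaces of smooth sections of `F ⊗ q*L^{⊗n}`
over `N`: families `(uₙ)` of smooth sections that are rapidly decreasing in `n`, locally uniformly
with all derivatives, with respect to charts of `N` and local frames `σⁿ` of `L^{⊗n}`. -/
def completedSum (R : N → (∀ y, F y) →ₗ[ℂ] (E → W)) :
    Submodule ℂ (ℤ → ∀ y : N, Fib p (q y) → F y) where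
  carrier := {u | (∀ n y, u n y ∈ lineTensor p (F y) n (q y)) ∧
    ∀ (U : Set M) (σ : M → Z), IsOpen U → IsLocalSection EM EZ p U σ →
      ∀ (y₀ : N) (l : Module.Dual ℂ W),
      ∀ V ⊆ (chartAt E y₀).target ∩ (chartAt E y₀).symm ⁻¹' (q ⁻¹' U), IsOpen V →
        RapidOn V (fun n t => l (R y₀ (along p σ (u n)) t))}
  add_mem' {u w} hu hw := by
    refine ⟨fun n y => add_mem (hu.1 n y) (hw.1 n y), fun U σ hU hσ y₀ l V hVU hV => ?_⟩
    simpa using (hu.2 U σ hU hσ y₀ l V hVU hV).add hV (hw.2 U σ hU hσ y₀ l V hVU hV)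
  zero_mem' := by
    refine ⟨fun n y => zero_mem _, fun U σ hU hσ y₀ l V hVU hV => ?_⟩
    simpa using RapidOn.zero
  smul_mem' c u hu := by
    refine ⟨fun n y => Submodule.smul_mem _ c (hu.1 n y), fun U σ hU hσ y₀ l V hVU hV => ?_⟩
    simpa using (hu.2 U σ hU hσ y₀ l V hVU hV).smul hV c

end Completed

/-! ### Exotic sections and exotic differential forms

Here `p : Z → M` is the given circle bundle, with associated line bundle `L`, and `q : Y → M` is
the dual circle bundle. -/

section Exotic

variable (EM EZ EY : Type*) [NormedAddCommGroup EM] [NormedSpace ℝ EM]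
  [NormedAddCommGroup EZ] [NormedSpace ℝ EZ] [NormedAddCommGroup EY] [NormedSpace ℝ EY]
  {M Z Y : Type*} [TopologicalSpace M] [ChartedSpace EM M] [TopologicalSpace Z] [ChartedSpace EZ Z]
  [MulAction Circle Z] [TopologicalSpace Y] [ChartedSpace EY Y] [MulAction Circle Y]
  (p : Z → M) (q : Y → M)

/-- `Γ(M, ⨁ₙ L^{⊗n})` (completed). -/
abbrev ExoticScalars : Submodule ℂ (ℤ → ∀ x : M, Fib p x → ℂ) :=
  completedSum EM EZ p (q := fun x : M => x) (F := fun _ => ℂ) (funRep EM)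

/-- `⨁ₙ Γ(Y, (TY ⊕ T*Y) ⊗ q*L^{⊗n})^{S¹}` (completed), the invariant sections. -/
def ExoticSections : Submodule ℂ (ℤ → ∀ y : Y, Fib p (q y) → GenTan (T EY y)) where
  carrier := {a | a ∈ completedSum EM EZ p (q := q) (genRep EY) ∧
    ∀ (n : ℤ) (c : Circle) (y : Y) (z : Fib p (q y)) (z' : Fib p (q (c • y))), z'.1 = z.1 →
      push (dAct EY c y) (a n y z).1 = (a n (c • y) z').1 ∧
      (a n y z).2 = pull (dAct EY c y) (a n (c • y) z').2}
  add_mem' {a b} ha hb := ⟨add_mem ha.1 hb.1, fun n c y z z' h => by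
    simp [(ha.2 n c y z z' h).1, (hb.2 n c y z z' h).1, (ha.2 n c y z z' h).2,
      (hb.2 n c y z z' h).2]⟩
  zero_mem' := ⟨zero_mem _, fun n c y z z' h => by simp⟩
  smul_mem' r a ha := ⟨Submodule.smul_mem _ r ha.1, fun n c y z z' h => by
    simp [(ha.2 n c y z z' h).1, (ha.2 n c y z z' h).2]⟩

/-- The exotic differential forms `⨁ₙ Ω(Y, q*L^{⊗n})^{S¹}` (completed), of mixed degree. -/
def ExoticForms : Submodule ℂ (ℤ → ∀ y : Y, Fib p (q y) → Ext (T EY y)) where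
  carrier := {η | η ∈ completedSum EM EZ p (q := q) (extRep EY) ∧
    ∀ (n : ℤ) (c : Circle) (y : Y) (z : Fib p (q y)) (z' : Fib p (q (c • y))), z'.1 = z.1 →
      pullExt (dAct EY c y) (η n (c • y) z') = η n y z}
  add_mem' {a b} ha hb := ⟨add_mem ha.1 hb.1, fun n c y z z' h => by
    simp [ha.2 n c y z z' h, hb.2 n c y z z' h]⟩
  zero_mem' := ⟨zero_mem _, fun n c y z z' h => by simp⟩
  smul_mem' r a ha := ⟨Submodule.smul_mem _ r ha.1, fun n c y z z' h => by
    simp [ha.2 n c y z z' h]⟩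

variable {EM EZ EY p q}

/-- `η` is of parity `k`, for a form `η` on a manifold. -/
def Forms.HasParity (k : ZMod 2) (η : Forms EZ Z) : Prop :=
  ∀ z, η.1 z ∈ parity (T EZ z) k

/-- `η` is of parity `k`, for an exotic form `η`. -/
def ExoticForms.HasParity (k : ZMod 2) (η : ExoticForms EM EZ EY p q) : Prop :=
  ∀ n y z, η.1 n y z ∈ parity (T EY y) k

/-- `h = f g` in `Γ(M, ⨁ₙ L^{⊗n})`. -/
def IsScalarMul (f g h : ExoticScalars EM EZ p) : Prop :=
  ∀ n x z, HasWeakSum (fun m => f.1 m x z * g.1 (n - m) x z) (h.1 n x z)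

/-- `f` is the unit section, of weight `0`. -/
def IsScalarOne (f : ExoticScalars EM EZ p) : Prop :=
  ∀ n x z, f.1 n x z = if n = 0 then 1 else 0

/-- `b = f a`, for an exotic scalar `f` and an exotic section `a`. -/
def IsScalarSMul (f : ExoticScalars EM EZ p) (a b : ExoticSections EM EZ EY p q) : Prop :=
  ∀ n y z, HasWeakSum (fun m => f.1 m (q y) z • a.1 (n - m) y z) (b.1 n y z)

/-- `θ = f η`, for an exotic scalar `f` and an exotic form `η`. -/
def IsScalarAction (f : ExoticScalars EM EZ p) (η θ : ExoticForms EM EZ EY p q) : Prop :=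
  ∀ n y z, HasWeakSum (fun m => f.1 m (q y) z • η.1 (n - m) y z) (θ.1 n y z)

/-- `f = ⟨a, b⟩`, the pairing `⟨a ⊗ s₁, b ⊗ s₂⟩ = ⟨a, b⟩ s₁ ⊗ s₂` of exotic sections. -/
def IsExoticPairing (a b : ExoticSections EM EZ EY p q) (f : ExoticScalars EM EZ p) : Prop :=
  ∀ n y z, HasWeakSum (fun m => pairing (a.1 m y z) (b.1 (n - m) y z)) (f.1 n (q y) z)

/-- `θ = a · η`, where `((X + α) ⊗ s₁) · (η ⊗ s₂) = (ι_X η + α ∧ η) ⊗ s₁ ⊗ s₂`. -/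
def IsExoticAction (a : ExoticSections EM EZ EY p q) (η θ : ExoticForms EM EZ EY p q) : Prop :=
  ∀ n y z, HasWeakSum (fun m => cliff (a.1 m y z) (η.1 (n - m) y z)) (θ.1 n y z)

variable (EM EZ EY p q)

/-- Words in exotic scalars and exotic sections. -/
abbrev CliffordWords :=
  FreeAlgebra ℂ (ExoticScalars EM EZ p ⊕ ExoticSections EM EZ EY p q)

variable {EM EZ EY p q} in
/-- An exotic scalar as a word. -/
def scalarWord (f : ExoticScalars EM EZ p) : CliffordWords EM EZ EY p q :=
  FreeAlgebra.ι ℂ (Sum.inl f)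

variable {EM EZ EY p q} in
/-- An exotic section as a word. -/
def sectionWord (a : ExoticSections EM EZ EY p q) : CliffordWords EM EZ EY p q :=
  FreeAlgebra.ι ℂ (Sum.inr a)

/-- The relations of the Clifford algebra: the linear and multiplicative structure of the ring of
exotic scalars and of the module of exotic sections over it, the centrality of the scalars, and
`a² = ⟨a, a⟩`. -/
inductive CliffordRel : CliffordWords EM EZ EY p q → CliffordWords EM EZ EY p q → Prop
  | scalar_add (f g) : CliffordRel (scalarWord (f + g)) (scalarWord f + scalarWord g)
  | scalar_smul (r : ℂ) (f) : CliffordRel (scalarWord (r • f)) (r • scalarWord f)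
  | scalar_one (f) (h : IsScalarOne f) : CliffordRel (scalarWord f) 1
  | scalar_mul (f g h) (hh : IsScalarMul f g h) :
      CliffordRel (scalarWord f * scalarWord g) (scalarWord h)
  | section_add (a b) : CliffordRel (sectionWord (a + b)) (sectionWord a + sectionWord b)
  | section_smul (r : ℂ) (a) : CliffordRel (sectionWord (r • a)) (r • sectionWord a)
  | scalar_section (f a b) (h : IsScalarSMul f a b) :
      CliffordRel (scalarWord f * sectionWord a) (sectionWord b)
  | central (f a) : CliffordRel (sectionWord a * scalarWord f) (scalarWord f * sectionWord a)
  | square (a f) (h : IsExoticPairing a a f) :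
      CliffordRel (sectionWord a * sectionWord a) (scalarWord f)

/-- The Clifford algebra generated by the exotic sections, with `a² = ⟨a, a⟩`. -/
abbrev ExoticClifford := RingQuot (CliffordRel EM EZ EY p q)

variable {EM EZ EY p q}

/-- The generator of the Clifford algebra given by an exotic scalar. -/
def cliffScalar (f : ExoticScalars EM EZ p) : ExoticClifford EM EZ EY p q :=
  RingQuot.mkAlgHom ℂ (CliffordRel EM EZ EY p q) (scalarWord f)

/-- The generator of the Clifford algebra given by an exotic section. -/
def cliffSection (a : ExoticSections EM EZ EY p q) : ExoticClifford EM EZ EY p q :=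
  RingQuot.mkAlgHom ℂ (CliffordRel EM EZ EY p q) (sectionWord a)

/-! ### The exotic Hori formula and the T-duality map on sections -/

variable (EM p q) in
/-- The tangent space of the correspondence space `Z ×_M Y` at `(z, y)`. -/
def corrTangent (z : Z) (y : Y) : Submodule ℝ (T EZ z × T EY y) :=
  LinearMap.ker (dProj EM EZ p z ∘ₗ LinearMap.fst ℝ (T EZ z) (T EY y) -
    dProj EM EY q y ∘ₗ LinearMap.snd ℝ (T EZ z) (T EY y))

variable (EM p q) in
/-- Derivative at `(z, y)` of the projection of `Z ×_M Y` to `Z`. -/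
def dFst (z : Z) (y : Y) : corrTangent EM (EZ := EZ) (EY := EY) p q z y →ₗ[ℝ] T EZ z :=
  LinearMap.fst ℝ (T EZ z) (T EY y) ∘ₗ (corrTangent EM p q z y).subtype

variable (EM p q) in
/-- Derivative at `(z, y)` of the projection of `Z ×_M Y` to `Y`. -/
def dSnd (z : Z) (y : Y) : corrTangent EM (EZ := EZ) (EY := EY) p q z y →ₗ[ℝ] T EY y :=
  LinearMap.snd ℝ (T EZ z) (T EY y) ∘ₗ (corrTangent EM p q z y).subtype

variable (EM p q) in
/-- The integrand of the Hori formula at `(z, y) ∈ Z ×_M Y`: contraction of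
`η ∧ e^{B ∧ A}` with the generator `(v, 0)` of the fibres of `Z ×_M Y → Y` is the pull-back
of `β`. -/
def IsHoriIntegrand (A : ∀ z : Z, T EZ z →ₗ[ℝ] ℝ) (B : ∀ y : Y, T EY y →ₗ[ℝ] ℝ) (z : Z) (y : Y)
    (η : Ext (T EZ z)) (β : Ext (T EY y)) : Prop :=
  ∃ v : corrTangent EM (EZ := EZ) (EY := EY) p q z y, v.1 = (gen EZ z, 0) ∧
    interior (CVec.ofReal v)
      (pullExt (dFst EM p q z y) η *
        expWedge (pull (dSnd EM p q z y) (CCovec.ofReal (B y)))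
          (pull (dFst EM p q z y) (CCovec.ofReal (A z)))) =
      pullExt (dSnd EM p q z y) β

/-- `θ = τ(η)`, the exotic Hori formula `τₙ(η) = ∫^{S¹, n} η ∧ e^{B ∧ A}`: the integral along the
fibres of `Z ×_M Y → Y` of the component of weight `-n`, as a form on `Y` with values in
`q*L^{⊗n}`. -/
def IsExoticHori (A : ∀ z : Z, T EZ z →ₗ[ℝ] ℝ) (B : ∀ y : Y, T EY y →ₗ[ℝ] ℝ)
    (η : Forms EZ Z) (θ : ExoticForms EM EZ EY p q) : Prop :=
  ∀ (n : ℤ) (y : Y) (z : Fib p (q y)), ∃ β : ℝ → Ext (T EY y),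
    (∀ t, IsHoriIntegrand EM p q A B (rot t • z.1) y (η.1 (rot t • z.1)) (β t)) ∧
    HasWeakIntegral (fun t => ((rot t : ℂ) ^ n) • β t) (θ.1 n y z)

variable (EM p q) in
/-- If `a = X + f v + ξ + g A` at `z`, with `X` horizontal for `A` and `ξ` basic, then
`b = -(X + g v' + ξ + f B)` at `y`, with `X` horizontal for `B` and `v'` the generator of the
action on `Y`. -/
def IsDualVector (A : ∀ z : Z, T EZ z →ₗ[ℝ] ℝ) (B : ∀ y : Y, T EY y →ₗ[ℝ] ℝ) (z : Z) (y : Y)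
    (a : GenTan (T EZ z)) (b : GenTan (T EY y)) : Prop :=
  ∃ (X : CVec EM) (f g : ℂ) (ξ : CCovec EM),
    (push (dProj EM EZ p z) a.1 = X ∧ a.1 (CCovec.ofReal (A z)) = f ∧
      a.2 = pull (dProj EM EZ p z) ξ + g • CCovec.ofReal (A z)) ∧
    (push (dProj EM EY q y) b.1 = -X ∧ b.1 (CCovec.ofReal (B y)) = -g ∧
      b.2 = -(pull (dProj EM EY q y) ξ + f • CCovec.ofReal (B y)))

/-- `b = μ(a)`: the component of weight `-n` of `a` is sent to a section with values in
`q*L^{⊗n}`, the vertical vector and covector components being interchanged, with a sign. -/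
def IsDualSection (A : ∀ z : Z, T EZ z →ₗ[ℝ] ℝ) (B : ∀ y : Y, T EY y →ₗ[ℝ] ℝ)
    (a : Sections EZ Z) (b : ExoticSections EM EZ EY p q) : Prop :=
  ∀ (n : ℤ) (y : Y) (z : Fib p (q y)), ∃ β : ℝ → GenTan (T EY y),
    (∀ t, IsDualVector EM p q A B (rot t • z.1) y (a.1 (rot t • z.1)) (β t)) ∧
    HasWeakIntegral (fun t => ((rot t : ℂ) ^ n) • β t) (b.1 n y z)

end Exotic

end ExoticCourant

end

open scoped Manifold ContDiff

noncomputable section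

namespace ExoticCourant

/-! ### Functoriality of complexified linear algebra -/

section LinearFunctoriality

variable {V : Type*} [AddCommGroup V] [Module ℝ V] {W : Type*} [AddCommGroup W] [Module ℝ W]
  {W' : Type*} [AddCommGroup W'] [Module ℝ W']

/-! Fibrewise, the theorem is an identity in a Clifford algebra. At points z of Z and y of the dual
bundle over the same x in M, the connection forms A and B (the latter is the form written with a
hat) split both tangent spaces as `EM × ℝ`. In these frames, multiplying by e^{B ∧ A} and
contracting with the fibre generator becomes Clifford multiplication by the single vector n = ∂ᵣ -
dr: this is `turn`, and the reason is `pullExt_mul_expWedge`. As ⟨n, n⟩ = -1, this operator is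
invertible, and it is odd. The Clifford relation moves n past any a at the cost of replacing a by -a
- 2⟨n, a⟩ n (`turn_cliff`). This isometry, `reflect`, is the rule X + f v + ξ + g A ↦ -(X + g v' + ξ
+ f B), so τ(a · ω) = μ(a) · τ(ω) holds pointwise, before any integration.

Globally, one expands in Fourier series along the circle orbits of Z. Read in the frames twisted by
`turn` or `reflect`, a field on Z takes values in a space attached to x alone. Its coefficients are
equivariant along the fibres of Z, hence have values in powers of L, and they are the same at all y
over x, hence define invariant fields on the dual bundle. Smoothness on Z matches rapid decrease in
the weight: integration by parts gives one direction (`rapidOn_integral`), termwise differentiation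
the other (`RapidOn.contDiffOn_tsum`), and Fourier inversion shows that the two constructions are
inverse to each other. This is `IsFraming.exists_transport`, used for functions, generalized vectors
and forms; the last two cases are μ and τ.

Fourier coefficients of a pointwise product are convolutions (`hasWeakSum_convolution`). So all sums
over weights converge, and every exotic product is the transform of a pointwise product on Z. The
Clifford relations then reduce to pointwise ones on Z, and the action on exotic forms is the
pointwise action on Z conjugated by the transforms. -/

instance finite_ext [FiniteDimensional ℝ V] : Module.Finite ℂ (Ext V) :=
  Module.Finite.of_basis (Module.finBasis ℂ (CCovec V)).ExteriorAlgebra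

@[simp] theorem pull_apply (L : V →ₗ[ℝ] W) (α : CCovec W) (v : V) : pull L α v = α (L v) := rfl

@[simp] theorem push_apply (L : V →ₗ[ℝ] W) (X : CVec V) (α : CCovec W) :
    push L X α = X (pull L α) := rfl

@[simp] theorem CVec.ofReal_apply (v : V) (α : CCovec V) : CVec.ofReal v α = α v := rfl

@[simp] theorem CCovec.ofReal_apply (a : V →ₗ[ℝ] ℝ) (v : V) : CCovec.ofReal a v = (a v : ℂ) := rfl

theorem pull_comp (L : V →ₗ[ℝ] W) (L' : W →ₗ[ℝ] W') (α : CCovec W') :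
    pull (L' ∘ₗ L) α = pull L (pull L' α) := rfl

theorem push_comp (L : V →ₗ[ℝ] W) (L' : W →ₗ[ℝ] W') (X : CVec V) :
    push (L' ∘ₗ L) X = push L' (push L X) := rfl

theorem pull_id (α : CCovec V) : pull LinearMap.id α = α := rfl

theorem push_id (X : CVec V) : push LinearMap.id X = X := rfl

theorem pull_ofReal (L : V →ₗ[ℝ] W) (a : W →ₗ[ℝ] ℝ) :
    pull L (CCovec.ofReal a) = CCovec.ofReal (a ∘ₗ L) := rfl

theorem push_ofReal (L : V →ₗ[ℝ] W) (v : V) :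
    push L (CVec.ofReal v) = CVec.ofReal (L v) := rfl

@[simp] theorem pullExt_oneForm (L : V →ₗ[ℝ] W) (α : CCovec W) :
    pullExt L (oneForm α) = oneForm (pull L α) :=
  ExteriorAlgebra.map_apply_ι _ _

theorem pullExt_comp (L : V →ₗ[ℝ] W) (L' : W →ₗ[ℝ] W') (η : Ext W') :
    pullExt (L' ∘ₗ L) η = pullExt L (pullExt L' η) := by
  have : pullExt (L' ∘ₗ L) = (pullExt L).comp (pullExt L') := by
    apply ExteriorAlgebra.hom_ext
    ext α
    change pullExt (L' ∘ₗ L) (oneForm α) = pullExt L (pullExt L' (oneForm α))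
    simp [pull_comp]
  rw [this]; rfl

theorem pullExt_id (η : Ext V) : pullExt LinearMap.id η = η := by
  have : pullExt (LinearMap.id : V →ₗ[ℝ] V) = AlgHom.id ℂ _ := by
    apply ExteriorAlgebra.hom_ext
    ext α
    change pullExt LinearMap.id (oneForm α) = oneForm α
    simp [pull_id]
  rw [this]; rfl

theorem oneForm_add (α β : CCovec V) : oneForm (α + β) = oneForm α + oneForm β := map_add _ _ _

theorem oneForm_neg (α : CCovec V) : oneForm (-α) = -oneForm α := map_neg _ _

theorem oneForm_smul (r : ℂ) (α : CCovec V) : oneForm (r • α) = r • oneForm α := map_smul _ _ _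

theorem oneForm_mul_self (α : CCovec V) : oneForm α * oneForm α = 0 :=
  ExteriorAlgebra.ι_sq_zero α

theorem oneForm_mul_swap (α β : CCovec V) : oneForm α * oneForm β = -(oneForm β * oneForm α) :=
  eq_neg_of_add_eq_zero_left (ExteriorAlgebra.ι_add_mul_swap α β)

theorem oneForm_mul_oneForm_mul (α β : CCovec V) (η : Ext V) :
    oneForm α * (oneForm β * η) = -(oneForm β * (oneForm α * η)) := by
  rw [← mul_assoc, oneForm_mul_swap, neg_mul, mul_assoc]

theorem interior_oneForm_mul (X : CVec V) (α : CCovec V) (η : Ext V) :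
    interior X (oneForm α * η) = X α • η - oneForm α * interior X η :=
  CliffordAlgebra.contractLeft_ι_mul X α η

theorem interior_one (X : CVec V) : interior X (1 : Ext V) = 0 :=
  CliffordAlgebra.contractLeft_one (0 : QuadraticForm ℂ (CCovec V)) X

theorem interior_comm (X Y : CVec V) (η : Ext V) :
    interior X (interior Y η) = -interior Y (interior X η) :=
  CliffordAlgebra.contractLeft_comm X Y η

theorem interior_add (X Y : CVec V) (η : Ext V) :
    interior (X + Y) η = interior X η + interior Y η := by
  simp [interior]

theorem interior_smul (r : ℂ) (X : CVec V) (η : Ext V) :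
    interior (r • X) η = r • interior X η := by
  simp [interior]

/-- Induction on forms, by wedge products with covectors from the left. -/
theorem ext_induction {P : Ext V → Prop} (one : P 1) (smul : ∀ (r : ℂ) x, P x → P (r • x))
    (add : ∀ x y, P x → P y → P (x + y)) (mul : ∀ α x, P x → P (oneForm α * x)) (η : Ext V) :
    P η := by
  induction η using CliffordAlgebra.left_induction with
  | algebraMap r => rw [Algebra.algebraMap_eq_smul_one]; exact smul r 1 one
  | add x y hx hy => exact add x y hx hy
  | ι_mul x m hx => exact mul m x hx

/-- Naturality of contraction: both sides obey the same Leibniz rule and agree on 1, so wedge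
induction suffices. -/
theorem pullExt_interior (L : V →ₗ[ℝ] W) (X : CVec V) (η : Ext W) :
    pullExt L (interior (push L X) η) = interior X (pullExt L η) := by
  induction η using ext_induction with
  | one => simp [interior_one]
  | smul r x hx => simp [hx]
  | add x y hx hy => simp [hx, hy]
  | mul α x hx => simp [interior_oneForm_mul, hx]

/-- The Clifford action as a bilinear map. -/
def cliffHom : GenTan V →ₗ[ℂ] Ext V →ₗ[ℂ] Ext V :=
  LinearMap.mk₂ ℂ cliff
    (fun a b η => by
      simp only [cliff, Prod.fst_add, Prod.snd_add, interior_add, oneForm_add, add_mul]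
      abel)
    (fun r a η => by simp [cliff, interior_smul, oneForm_smul])
    (fun a η θ => by
      simp only [cliff, map_add, mul_add]
      abel)
    (fun r a η => by simp [cliff])

@[simp] theorem cliffHom_apply (a : GenTan V) (η : Ext V) : cliffHom a η = cliff a η := rfl

/-- The pairing as a bilinear map. -/
def pairingHom : GenTan V →ₗ[ℂ] GenTan V →ₗ[ℂ] ℂ :=
  LinearMap.mk₂ ℂ pairing
    (fun a b c => by simp [pairing]; ring)
    (fun r a b => by simp [pairing]; ring)
    (fun a b c => by simp [pairing]; ring)
    (fun r a b => by simp [pairing]; ring)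

@[simp] theorem pairingHom_apply (a b : GenTan V) : pairingHom a b = pairing a b := rfl

theorem pairing_comm (a b : GenTan V) : pairing a b = pairing b a := by
  simp [pairing]; ring

/-- Contractions anticommute among themselves, and so do wedge products. Only the mixed terms
survive; by the Leibniz rule they contribute b.1(a.2) and a.1(b.2). -/
theorem cliff_cliff_add (a b : GenTan V) (η : Ext V) :
    cliff a (cliff b η) + cliff b (cliff a η) = (2 * pairing a b) • η := by
  have h : (2 * pairing a b) • η = (b.1 a.2) • η + (a.1 b.2) • η := by
    rw [← add_smul]; congr 1; simp [pairing]; ring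
  rw [h]
  simp only [cliff, map_add, interior_oneForm_mul, mul_add]
  rw [interior_comm a.1 b.1, oneForm_mul_oneForm_mul a.2 b.2]
  abel

theorem cliff_cliff (a : GenTan V) (η : Ext V) : cliff a (cliff a η) = pairing a a • η := by
  have h := cliff_cliff_add a a η
  rw [← two_smul ℂ, mul_smul] at h
  exact smul_right_injective _ (two_ne_zero) h

/-- Forms are carried along linear isomorphisms. -/
def extIso (e : V ≃ₗ[ℝ] W) : Ext V ≃ₗ[ℂ] Ext W where
  toFun := pullExt e.symm.toLinearMap
  map_add' := map_add _
  map_smul' := map_smul _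
  invFun := pullExt e.toLinearMap
  left_inv η := by
    rw [← pullExt_comp]; simp [pullExt_id]
  right_inv η := by
    rw [← pullExt_comp]; simp [pullExt_id]

/-- Generalized tangent vectors are carried along linear isomorphisms. -/
def genIso (e : V ≃ₗ[ℝ] W) : GenTan V ≃ₗ[ℂ] GenTan W where
  toFun a := (push e.toLinearMap a.1, pull e.symm.toLinearMap a.2)
  map_add' a b := by simp
  map_smul' r a := by simp
  invFun a := (push e.symm.toLinearMap a.1, pull e.toLinearMap a.2)
  left_inv a := by
    ext x <;> simp [← pull_comp, pull_id]
  right_inv a := by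
    ext x <;> simp [← pull_comp, pull_id]

theorem extIso_apply (e : V ≃ₗ[ℝ] W) (η : Ext V) : extIso e η = pullExt e.symm.toLinearMap η := rfl

theorem extIso_symm_apply (e : V ≃ₗ[ℝ] W) (η : Ext W) :
    (extIso e).symm η = pullExt e.toLinearMap η := rfl

theorem genIso_apply (e : V ≃ₗ[ℝ] W) (a : GenTan V) :
    genIso e a = (push e.toLinearMap a.1, pull e.symm.toLinearMap a.2) := rfl

theorem genIso_symm_apply (e : V ≃ₗ[ℝ] W) (a : GenTan W) :
    (genIso e).symm a = (push e.symm.toLinearMap a.1, pull e.toLinearMap a.2) := rfl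

theorem extIso_cliff (e : V ≃ₗ[ℝ] W) (a : GenTan V) (η : Ext V) :
    extIso e (cliff a η) = cliff (genIso e a) (extIso e η) := by
  have h : a.1 = push e.symm.toLinearMap (push e.toLinearMap a.1) := by
    rw [← push_comp]; simp [push_id]
  simp only [cliff, map_add, genIso_apply, extIso_apply, map_mul, pullExt_oneForm]
  congr 1
  conv_lhs => rw [h]
  rw [pullExt_interior]

theorem pairing_genIso (e : V ≃ₗ[ℝ] W) (a b : GenTan V) :
    pairing (genIso e a) (genIso e b) = pairing a b := by
  simp [pairing, genIso_apply, ← pull_comp, pull_id]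

theorem oneForm_mem_parity (α : CCovec V) : oneForm α ∈ parity V 1 :=
  CliffordAlgebra.ι_mem_evenOdd_one _ α

theorem mul_mem_parity {k l : ZMod 2} {η θ : Ext V} (hη : η ∈ parity V k) (hθ : θ ∈ parity V l) :
    η * θ ∈ parity V (k + l) :=
  CliffordAlgebra.evenOdd_mul_le _ k l (Submodule.mul_mem_mul hη hθ)

theorem algebraMap_mem_parity (r : ℂ) : algebraMap ℂ (Ext V) r ∈ parity V 0 :=
  SetLike.algebraMap_mem_graded (CliffordAlgebra.evenOdd (0 : QuadraticForm ℂ (CCovec V))) r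

/-- Induction on forms of given parity, by wedge products with covectors from the left. -/
theorem parity_induction {P : ZMod 2 → Ext V → Prop} (scalar : ∀ r, P 0 (algebraMap ℂ (Ext V) r))
    (add : ∀ k x y, P k x → P k y → P k (x + y))
    (mul : ∀ α k x, x ∈ parity V k → P k x → P (k + 1) (oneForm α * x))
    {k : ZMod 2} {η : Ext V} (hη : η ∈ parity V k) : P k η := by
  have hk : k = 0 ∨ k = 1 := (by decide : ∀ k : ZMod 2, k = 0 ∨ k = 1) k
  have two : (1 : ZMod 2) + 1 = 0 := by decide
  rcases hk with rfl | rfl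
  · refine CliffordAlgebra.even_induction (0 : QuadraticForm ℂ (CCovec V))
      (motive := fun x _ => P 0 x) scalar (fun x y _ _ => add 0 x y) (fun α β x hx h => ?_) η hη
    have h1 := mul β 0 x hx h
    have h2 := mul α _ _ (by simpa using mul_mem_parity (oneForm_mem_parity β) hx) (zero_add
      (1 : ZMod 2) ▸ h1)
    rw [two, ← mul_assoc] at h2
    exact h2
  · refine CliffordAlgebra.odd_induction (0 : QuadraticForm ℂ (CCovec V))
      (P := fun x _ => P 1 x) (fun α => ?_) (fun x y _ _ => add 1 x y) (fun α β x hx h => ?_) η hη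
    · have h1 := mul α 0 1 (by simpa using algebraMap_mem_parity (V := V) 1)
        (by simpa using scalar 1)
      rw [zero_add, mul_one] at h1
      exact h1
    · have h1 := mul β 1 x hx h
      rw [two] at h1
      have h2 := mul α 0 _ (two ▸ mul_mem_parity (oneForm_mem_parity β) hx) h1
      rw [zero_add, ← mul_assoc] at h2
      exact h2

theorem interior_mem_parity (X : CVec V) {k : ZMod 2} {η : Ext V} (hη : η ∈ parity V k) :
    interior X η ∈ parity V (k + 1) := by
  refine parity_induction (P := fun k η => interior X η ∈ parity V (k + 1)) (fun r => ?_)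
    (fun k x y hx hy => ?_) (fun α k x hx h => ?_) hη
  · rw [Algebra.algebraMap_eq_smul_one, map_smul, interior_one, smul_zero]
    exact zero_mem _
  · rw [map_add]
    exact add_mem hx hy
  · rw [interior_oneForm_mul]
    have two : (1 : ZMod 2) + 1 = 0 := by decide
    refine sub_mem (Submodule.smul_mem _ _ ?_) ?_
    · rwa [add_assoc, two, add_zero]
    · rw [add_comm (k + 1) 1]
      exact mul_mem_parity (oneForm_mem_parity α) h

theorem cliff_mem_parity (a : GenTan V) {k : ZMod 2} {η : Ext V} (hη : η ∈ parity V k) :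
    cliff a η ∈ parity V (k + 1) := by
  refine add_mem (interior_mem_parity _ hη) ?_
  rw [add_comm]
  exact mul_mem_parity (oneForm_mem_parity _) hη

theorem pullExt_mem_parity (L : V →ₗ[ℝ] W) {k : ZMod 2} {η : Ext W} (hη : η ∈ parity W k) :
    pullExt L η ∈ parity V k := by
  refine parity_induction (P := fun k η => pullExt L η ∈ parity V k) (fun r => ?_)
    (fun k x y hx hy => ?_) (fun α k x _ h => ?_) hη
  · rw [AlgHom.commutes]
    exact algebraMap_mem_parity r
  · rw [map_add]
    exact add_mem hx hy
  · rw [map_mul, pullExt_oneForm, add_comm]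
    exact mul_mem_parity (oneForm_mem_parity _) h

theorem extIso_mem_parity_iff (e : V ≃ₗ[ℝ] W) {k : ZMod 2} {η : Ext V} :
    extIso e η ∈ parity W k ↔ η ∈ parity V k :=
  ⟨fun h => by simpa [← extIso_symm_apply] using pullExt_mem_parity e.toLinearMap h,
    fun h => pullExt_mem_parity _ h⟩

end LinearFunctoriality

/-! ### The fibrewise duality transformation -/

section Turn

variable (U : Type*) [AddCommGroup U] [Module ℝ U]

/-- The real covector `dr` on `U × ℝ`. -/
abbrev lastCovec : CCovec (U × ℝ) := CCovec.ofReal (LinearMap.snd ℝ U ℝ)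

/-- The generalized tangent vector `∂ᵣ - dr` on `U × ℝ`. -/
def axis : GenTan (U × ℝ) := (CVec.ofReal (0, 1), -lastCovec U)

/-- The value -1 is what makes `turn` invertible, with inverse its negative, and `reflect` an
involution. -/
theorem pairing_axis : pairing (axis U) (axis U) = -1 := by
  simp [pairing, axis]

/-- The Clifford action of `∂ᵣ - dr`, which exchanges `α + dr ∧ β` and `β - dr ∧ α`. -/
def turn : Ext (U × ℝ) ≃ₗ[ℂ] Ext (U × ℝ) where
  toFun η := cliff (axis U) η
  map_add' := map_add (cliffHom (axis U))
  map_smul' := map_smul (cliffHom (axis U))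
  invFun η := -cliff (axis U) η
  left_inv η := by simp [cliff_cliff, pairing_axis]
  right_inv η := by
    have h : cliff (axis U) (-cliff (axis U) η) = -cliff (axis U) (cliff (axis U) η) :=
      map_neg (cliffHom (axis U)) _
    simp [h, cliff_cliff, pairing_axis]

/-- The reflection of generalized tangent vectors on `U × ℝ` that exchanges `f ∂ᵣ + g dr`
and `-(g ∂ᵣ + f dr)` and is `-1` on `U`. -/
def reflect : GenTan (U × ℝ) ≃ₗ[ℂ] GenTan (U × ℝ) :=
  LinearEquiv.ofInvolutive
    (-LinearMap.id - (2 : ℂ) • (pairingHom (axis U)).smulRight (axis U)) (fun a => by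
      simp only [LinearMap.sub_apply, LinearMap.neg_apply, LinearMap.id_apply,
        LinearMap.smul_apply, LinearMap.smulRight_apply, map_sub, map_neg, map_smul]
      simp only [pairingHom_apply, pairing_axis, smul_smul]
      module)

variable {U}

theorem turn_apply (η : Ext (U × ℝ)) : turn U η = cliff (axis U) η := rfl

theorem reflect_apply (a : GenTan (U × ℝ)) :
    reflect U a = -a - (2 * pairing (axis U) a) • axis U := by
  rw [mul_smul]
  rfl

/-- Write n for the axis. The Clifford relation gives n a = -a n + 2⟨n, a⟩, and since n² = -1 the
right side equals (-a - 2⟨n, a⟩ n) n. This is the pointwise form of the compatibility of τ with μ.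
-/
theorem turn_cliff (a : GenTan (U × ℝ)) (η : Ext (U × ℝ)) :
    turn U (cliff a η) = cliff (reflect U a) (turn U η) := by
  have h := cliff_cliff_add (axis U) a η
  rw [← eq_sub_iff_add_eq] at h
  rw [turn_apply, turn_apply, h, reflect_apply]
  rw [← cliffHom_apply (-a - _), map_sub, map_neg, map_smul]
  simp only [LinearMap.sub_apply, LinearMap.neg_apply, LinearMap.smul_apply, cliffHom_apply,
    cliff_cliff, pairing_axis]
  module

theorem pairing_reflect (a b : GenTan (U × ℝ)) :
    pairing (reflect U a) (reflect U b) = pairing a b := by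
  simp only [reflect_apply, ← pairingHom_apply, map_sub, map_neg, map_smul, LinearMap.sub_apply,
    LinearMap.neg_apply, LinearMap.smul_apply]
  simp only [pairingHom_apply, pairing_axis, pairing_comm a (axis U), smul_eq_mul]
  ring

theorem turn_mem_parity_iff {k : ZMod 2} {η : Ext (U × ℝ)} :
    turn U η ∈ parity (U × ℝ) (k + 1) ↔ η ∈ parity (U × ℝ) k := by
  refine ⟨fun h => ?_, fun h => cliff_mem_parity _ h⟩
  have two : (1 : ZMod 2) + 1 = 0 := by decide
  -- A second Clifford multiplication by the axis returns -η and shifts the parity by 1 + 1 = 0.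
  have h1 := cliff_mem_parity (axis U) h
  rw [turn_apply, cliff_cliff, pairing_axis, add_assoc, two, add_zero] at h1
  simpa using h1

/-- The isomorphism of `U × ℝ` induced by an isomorphism of `U`. -/
abbrev prodLine {U' : Type*} [AddCommGroup U'] [Module ℝ U'] (D : U ≃ₗ[ℝ] U') :
    (U × ℝ) ≃ₗ[ℝ] (U' × ℝ) := D.prodCongr (LinearEquiv.refl ℝ ℝ)

/-- The axis does not involve U, so `turn` and `reflect` commute with every change of coordinates on
the base. They can therefore be inserted into framings. -/
theorem genIso_axis {U' : Type*} [AddCommGroup U'] [Module ℝ U'] (D : U ≃ₗ[ℝ] U') :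
    genIso (prodLine D) (axis U) = axis U' := by
  refine Prod.ext ?_ ?_
  · simp only [genIso_apply, axis]
    rw [push_ofReal]
    simp
  · simp only [genIso_apply, axis, map_neg]
    rfl

theorem turn_extIso {U' : Type*} [AddCommGroup U'] [Module ℝ U'] (D : U ≃ₗ[ℝ] U')
    (η : Ext (U × ℝ)) :
    turn U' (extIso (prodLine D) η) = extIso (prodLine D) (turn U η) := by
  rw [turn_apply, turn_apply, extIso_cliff, genIso_axis]

theorem reflect_genIso {U' : Type*} [AddCommGroup U'] [Module ℝ U'] (D : U ≃ₗ[ℝ] U')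
    (a : GenTan (U × ℝ)) :
    reflect U' (genIso (prodLine D) a) = genIso (prodLine D) (reflect U a) := by
  rw [reflect_apply, reflect_apply, ← genIso_axis D, pairing_genIso]
  simp

/-- If two linear maps to `U × ℝ` have the same component in `U`, the pull-back of a form along
the first, times `e^{b ∧ a}`, is expressed by pull-backs along the second. -/
theorem pullExt_mul_expWedge {C : Type*} [AddCommGroup C] [Module ℝ C] (E₁ E₂ : C →ₗ[ℝ] U × ℝ)
    (h : ∀ w, (E₁ w).1 = (E₂ w).1) (η : Ext (U × ℝ)) :
    pullExt E₁ η * expWedge (pull E₂ (lastCovec U)) (pull E₁ (lastCovec U)) =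
      pullExt E₂ η + oneForm (pull E₁ (lastCovec U) - pull E₂ (lastCovec U)) *
        pullExt E₂ (turn U η) := by
  induction η using ext_induction with
  | one =>
    -- With a, b the pull-backs of dr along E₁, E₂, the correction term is -(a - b) ∧ b = b ∧ a,
    -- which is the nonconstant part of the exponential.
    have ht : turn U (1 : Ext (U × ℝ)) = -oneForm (lastCovec U) := by
      simp [turn_apply, cliff, axis, interior_one, oneForm_neg]
    rw [ht, map_neg, pullExt_oneForm, map_one, map_one, one_mul, expWedge, sub_eq_add_neg,
      oneForm_add, oneForm_neg, mul_neg, add_mul, neg_mul, oneForm_mul_self,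
      oneForm_mul_swap (pull E₁ _)]
    simp
  | smul r x hx =>
    rw [map_smul, map_smul, map_smul, map_smul, smul_mul_assoc, hx]
    simp
  | add x y hx hy =>
    rw [map_add, map_add, map_add, map_add, add_mul, hx, hy, mul_add]
    abel
  | mul α x hx =>
    -- The two maps differ only in the ℝ component, so the two pull-backs of α differ by a multiple
    -- of the one covector d, the difference of the pull-backs of dr. In the product the extra term
    -- is removed by d ∧ d = 0, and the scalar α(0, 1) is matched by the contraction inside `turn`.
    have hα : pull E₁ α = pull E₂ α + (α (0, 1)) •
        (pull E₁ (lastCovec U) - pull E₂ (lastCovec U)) := by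
      ext w
      have e1 : E₁ w - E₂ w = ((E₁ w).2 - (E₂ w).2) • ((0 : U), (1 : ℝ)) := by
        ext <;> simp [h w]
      have e2 := congrArg α e1
      rw [map_sub, map_smul, sub_eq_iff_eq_add'] at e2
      simp [e2, mul_comm]
    have ht : turn U (oneForm α * x) = (α (0, 1)) • x - oneForm α * turn U x := by
      simp only [turn_apply, cliff, axis, interior_oneForm_mul, oneForm_neg, neg_mul, mul_add,
        CVec.ofReal_apply, mul_neg]
      rw [oneForm_mul_oneForm_mul]
      abel
    rw [map_mul, mul_assoc, hx, ht, pullExt_oneForm, hα]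
    simp only [map_mul, map_sub, map_smul, pullExt_oneForm, mul_add, mul_sub]
    generalize pull E₁ (lastCovec U) - pull E₂ (lastCovec U) = d
    rw [oneForm_add, oneForm_smul]
    simp only [add_mul, smul_mul_assoc, mul_smul_comm]
    rw [← mul_assoc (oneForm d) (oneForm d), oneForm_mul_self,
      oneForm_mul_oneForm_mul d (pull E₂ α)]
    simp
    abel

end Turn

/-! ### Sums and integrals in finite dimensional spaces -/

section WeakLimits

variable {W : Type*} [AddCommGroup W] [Module ℂ W] {W' : Type*} [AddCommGroup W'] [Module ℂ W']

theorem eq_of_forall_dual {w w' : W} (h : ∀ l : Module.Dual ℂ W, l w = l w') : w = w' := by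
  rw [← sub_eq_zero, ← Module.forall_dual_apply_eq_zero_iff ℂ]
  intro l
  rw [map_sub, h, sub_self]

theorem HasWeakSum.unique {f : ℤ → W} {w w' : W} (h : HasWeakSum f w) (h' : HasWeakSum f w') :
    w = w' :=
  eq_of_forall_dual fun l => (h l).unique (h' l)

theorem HasWeakSum.map {f : ℤ → W} {w : W} (h : HasWeakSum f w) (L : W →ₗ[ℂ] W') :
    HasWeakSum (fun m => L (f m)) (L w) := fun l => h (l ∘ₗ L)

/-- A vector outside S is detected by a functional that vanishes on S, and this functional kills
every term of the sum. -/
theorem HasWeakSum.mem {f : ℤ → W} {w : W} (h : HasWeakSum f w) {S : Submodule ℂ W}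
    (hS : ∀ m, f m ∈ S) : w ∈ S := by
  by_contra hw
  obtain ⟨l, hl, hSl⟩ := Submodule.exists_dual_map_eq_bot_of_notMem hw inferInstance
  refine hl ((h l).unique ?_)
  have : (fun m => l (f m)) = fun _ => 0 := by
    funext m
    have : l (f m) ∈ S.map l := Submodule.mem_map_of_mem (hS m)
    rwa [hSl, Submodule.mem_bot] at this
  rw [this]
  exact hasSum_zero

theorem HasWeakIntegral.unique {f : ℝ → W} {w w' : W} (h : HasWeakIntegral f w)
    (h' : HasWeakIntegral f w') : w = w' :=
  eq_of_forall_dual fun l => (h l).2.trans (h' l).2.symm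

theorem HasWeakIntegral.map {f : ℝ → W} {w : W} (h : HasWeakIntegral f w) (L : W →ₗ[ℂ] W') :
    HasWeakIntegral (fun t => L (f t)) (L w) := fun l => h (l ∘ₗ L)

theorem HasWeakIntegral.add {f g : ℝ → W} {w w' : W} (h : HasWeakIntegral f w)
    (h' : HasWeakIntegral g w') : HasWeakIntegral (fun t => f t + g t) (w + w') := fun l => by
  simp only [map_add]
  exact ⟨(h l).1.add (h' l).1, by
    rw [(h l).2, (h' l).2, intervalIntegral.integral_add (h l).1 (h' l).1]⟩

theorem HasWeakIntegral.mem {f : ℝ → W} {w : W} (h : HasWeakIntegral f w) {S : Submodule ℂ W}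
    (hS : ∀ t, f t ∈ S) : w ∈ S := by
  by_contra hw
  obtain ⟨l, hl, hSl⟩ := Submodule.exists_dual_map_eq_bot_of_notMem hw inferInstance
  refine hl ?_
  rw [(h l).2]
  have : (fun t => l (f t)) = fun _ => 0 := by
    funext m
    have : l (f m) ∈ S.map l := Submodule.mem_map_of_mem (hS m)
    rwa [hSl, Submodule.mem_bot] at this
  rw [this]
  simp

variable [Module.Finite ℂ W]

theorem dual_eq_sum (l : Module.Dual ℂ W) (w : W) :
    l w = ∑ i, (Module.finBasis ℂ W).coord i w * l (Module.finBasis ℂ W i) := by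
  conv_lhs => rw [← (Module.finBasis ℂ W).sum_repr w, map_sum]
  simp

/-- Finite dimensionality enters here: the sum is assembled from the sums of the coordinates in a
basis. -/
theorem exists_hasWeakSum {f : ℤ → W} (h : ∀ l : Module.Dual ℂ W, Summable fun m => l (f m)) :
    ∃ w, HasWeakSum f w := by
  let b := Module.finBasis ℂ W
  refine ⟨∑ i, (∑' m, b.coord i (f m)) • b i, fun l => ?_⟩
  have h1 : HasSum (fun m => ∑ i, b.coord i (f m) * l (b i))
      (∑ i, (∑' m, b.coord i (f m)) * l (b i)) :=
    hasSum_sum fun i _ => (h (b.coord i)).hasSum.mul_right _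
  convert h1 using 1
  · funext m
    exact dual_eq_sum l (f m)
  · simp

theorem exists_hasWeakIntegral {f : ℝ → W}
    (h : ∀ l : Module.Dual ℂ W, Continuous fun t => l (f t)) : ∃ w, HasWeakIntegral f w := by
  let b := Module.finBasis ℂ W
  refine ⟨∑ i, (∫ t in (0 : ℝ)..1, b.coord i (f t)) • b i,
    fun l => ⟨(h l).intervalIntegrable _ _, ?_⟩⟩
  have h1 : (fun t => l (f t)) = fun t => ∑ i, b.coord i (f t) * l (b i) := by
    funext t
    exact dual_eq_sum l (f t)
  rw [h1, intervalIntegral.integral_finsetSum]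
  · simp
  · intro i _
    exact ((h (b.coord i)).mul continuous_const).intervalIntegrable _ _

end WeakLimits

/-! ### Characters of the circle -/

section Characters

theorem coe_rot_zpow (n : ℤ) (s : ℝ) :
    (rot s : ℂ) ^ n = Complex.exp ((2 * Real.pi * n * Complex.I) * s) := by
  rw [rot, Circle.coe_exp, ← Complex.exp_int_mul]
  congr 1
  push_cast
  ring

theorem rot_add (s t : ℝ) : rot (s + t) = rot s * rot t := by
  rw [rot, mul_add, Circle.exp_add]
  rfl

theorem rot_zero : rot 0 = 1 := by simp [rot]

theorem rot_one : rot 1 = 1 := by simp [rot]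

theorem rot_surjective : Function.Surjective rot := fun c => by
  refine ⟨Complex.arg c / (2 * Real.pi), ?_⟩
  rw [rot, mul_div_cancel₀ _ (by positivity), Circle.exp_arg]

theorem norm_rot_zpow (n : ℤ) (s : ℝ) : ‖(rot s : ℂ) ^ n‖ = 1 := by
  rw [norm_zpow, Circle.norm_coe, one_zpow]

theorem contDiff_rot_zpow (n : ℤ) : ContDiff ℝ ∞ fun s : ℝ => (rot s : ℂ) ^ n := by
  simp_rw [coe_rot_zpow]
  exact Complex.contDiff_exp.comp (contDiff_const.mul Complex.ofRealCLM.contDiff)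

theorem continuous_rot_zpow (n : ℤ) : Continuous fun s : ℝ => (rot s : ℂ) ^ n :=
  (contDiff_rot_zpow n).continuous

theorem hasDerivAt_rot_zpow (n : ℤ) (s : ℝ) :
    HasDerivAt (fun s : ℝ => (rot s : ℂ) ^ n)
      ((2 * Real.pi * n * Complex.I) * (rot s : ℂ) ^ n) s := by
  simp_rw [coe_rot_zpow]
  have h := ((Complex.ofRealCLM.hasDerivAt (x := s)).const_mul (2 * Real.pi * n * Complex.I)).cexp
  simp only [Complex.ofRealCLM_apply, Complex.ofReal_one, mul_one] at h
  convert h using 1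
  ring

theorem iteratedDeriv_rot_zpow (n : ℤ) (j : ℕ) :
    iteratedDeriv j (fun s : ℝ => (rot s : ℂ) ^ n) =
      fun s => (2 * Real.pi * n * Complex.I) ^ j * (rot s : ℂ) ^ n := by
  induction j with
  | zero => simp
  | succ j ih =>
    rw [iteratedDeriv_succ, ih]
    funext s
    rw [((hasDerivAt_rot_zpow n s).const_mul _).deriv]
    ring

theorem integral_rot_zpow (n : ℤ) :
    ∫ s in (0 : ℝ)..1, (rot s : ℂ) ^ n = if n = 0 then 1 else 0 := by
  split_ifs with h
  · simp [h]
  · have hc : (2 * Real.pi * n * Complex.I : ℂ) ≠ 0 := by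
      simp [h, Real.pi_ne_zero]
    have h1 : ∀ s ∈ Set.uIcc (0 : ℝ) 1, HasDerivAt
        (fun s : ℝ => (2 * Real.pi * n * Complex.I : ℂ)⁻¹ * (rot s : ℂ) ^ n)
        ((rot s : ℂ) ^ n) s := by
      intro s _
      exact ((hasDerivAt_rot_zpow n s).const_mul (2 * Real.pi * n * Complex.I : ℂ)⁻¹).congr_deriv
        (inv_mul_cancel_left₀ hc _)
    rw [intervalIntegral.integral_eq_sub_of_hasDerivAt h1
      ((continuous_rot_zpow n).intervalIntegrable _ _)]
    simp [rot_one, rot_zero]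

/-- Dominated convergence: the characters have modulus one, so the m-th term is bounded by ‖c m‖
times a bound for g on [0, 1]. -/
theorem hasSum_integral_rot_mul {c : ℤ → ℂ} (hc : Summable fun m => ‖c m‖) {f g : ℝ → ℂ}
    (hg : Continuous g) (hf : ∀ s, HasSum (fun m => c m * (rot s : ℂ) ^ (-m)) (f s)) :
    HasSum (fun m => c m * ∫ s in (0 : ℝ)..1, (rot s : ℂ) ^ (-m) * g s)
      (∫ s in (0 : ℝ)..1, f s * g s) := by
  obtain ⟨D, hD⟩ := (isCompact_Icc (a := (0 : ℝ)) (b := 1)).exists_bound_of_continuousOn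
    hg.continuousOn
  have h := intervalIntegral.hasSum_integral_of_dominated_convergence (a := 0) (b := 1)
    (μ := MeasureTheory.volume)
    (F := fun m s => c m * (rot s : ℂ) ^ (-m) * g s) (f := fun s => f s * g s)
    (fun m _ => ‖c m‖ * D) (fun m => ?_) (fun m => ?_) ?_ ?_ ?_
  · simpa only [mul_assoc, intervalIntegral.integral_const_mul] using h
  · exact ((continuous_const.mul (continuous_rot_zpow _)).mul hg).aestronglyMeasurable
  · refine Filter.Eventually.of_forall fun s hs => ?_
    rw [norm_mul, norm_mul, norm_rot_zpow, mul_one]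
    rw [Set.uIoc_of_le zero_le_one] at hs
    exact mul_le_mul_of_nonneg_left (hD s (Set.Ioc_subset_Icc_self hs)) (norm_nonneg _)
  · exact Filter.Eventually.of_forall fun s _ => hc.mul_right D
  · exact intervalIntegrable_const
  · exact Filter.Eventually.of_forall fun s _ => (hf s).mul_right _

/-- Uniqueness of Fourier coefficients, by orthogonality of characters. The sign convention is that
of the weights: the coefficient with index n belongs to the component of weight -n. -/
theorem integral_rot_mul_of_hasSum {c : ℤ → ℂ} (hc : Summable fun m => ‖c m‖) {f : ℝ → ℂ}
    (hf : ∀ s, HasSum (fun m => c m * (rot s : ℂ) ^ (-m)) (f s)) (n : ℤ) :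
    ∫ s in (0 : ℝ)..1, (rot s : ℂ) ^ n * f s = c n := by
  have h := hasSum_integral_rot_mul hc (continuous_rot_zpow n) hf
  have h1 : (fun m => c m * ∫ s in (0 : ℝ)..1, (rot s : ℂ) ^ (-m) * (rot s : ℂ) ^ n) =
      fun m => if m = n then c n else 0 := by
    funext m
    have h2 : ∀ s : ℝ, (rot s : ℂ) ^ (-m) * (rot s : ℂ) ^ n = (rot s : ℂ) ^ (n - m) := fun s => by
      rw [← zpow_add₀ (Circle.coe_ne_zero _)]
      congr 1
      ring
    simp_rw [h2, integral_rot_zpow]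
    by_cases hm : m = n
    · simp [hm]
    · have : n - m ≠ 0 := by omega
      simp [hm, this]
  rw [h1] at h
  simp_rw [mul_comm _ (f _)]
  exact h.unique (hasSum_ite_eq n (c n))

end Characters

/-! ### Integrals depending smoothly on a parameter -/

section Line

variable {E : Type*} [NormedAddCommGroup E] [NormedSpace ℝ E] {V : Set E}

/-- The partial derivative in the last variable. -/
def lastDeriv (F : E × ℝ → ℂ) (x : E × ℝ) : ℂ := deriv (fun s => F (x.1, s)) x.2

theorem contDiff_line {F : E × ℝ → ℂ} (hF : ContDiffOn ℝ ∞ F (V ×ˢ Set.univ)) {t : E}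
    (ht : t ∈ V) : ContDiff ℝ ∞ fun s : ℝ => F (t, s) := by
  rw [← contDiffOn_univ]
  exact hF.comp (by fun_prop) fun s _ => ⟨ht, Set.mem_univ s⟩

theorem contDiffOn_lastDeriv (hV : IsOpen V) {F : E × ℝ → ℂ}
    (hF : ContDiffOn ℝ ∞ F (V ×ˢ Set.univ)) : ContDiffOn ℝ ∞ (lastDeriv F) (V ×ˢ Set.univ) := by
  have hO : IsOpen (V ×ˢ (Set.univ : Set ℝ)) := hV.prod isOpen_univ
  have h1 : ContDiffOn ℝ ∞ (fun x => fderiv ℝ F x (0, 1)) (V ×ˢ Set.univ) :=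
    (hF.fderiv_of_isOpen hO (by simp)).clm_apply contDiffOn_const
  refine h1.congr fun x hx => ?_
  have h2 : HasFDerivAt F (fderiv ℝ F x) (x.1, x.2) :=
    ((hF.contDiffAt (hO.mem_nhds hx)).differentiableAt (by simp)).hasFDerivAt
  exact (h2.comp_hasDerivAt x.2 ((hasDerivAt_const x.2 x.1).prodMk (hasDerivAt_id x.2))).deriv

end Line

/-! ### Differentiation under the integral sign and decay of Fourier coefficients. -/

section Parametric

variable {E : Type*} [NormedAddCommGroup E] [NormedSpace ℝ E] [FiniteDimensional ℝ E]
  {G : Type*} [NormedAddCommGroup G] [NormedSpace ℝ G] [NormedSpace ℂ G] [SMulCommClass ℝ ℂ G]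
  {V : Set E}

theorem integral_linearIsometryEquiv {X X' : Type*} [NormedAddCommGroup X] [NormedSpace ℝ X]
    [CompleteSpace X] [NormedAddCommGroup X'] [NormedSpace ℝ X'] [CompleteSpace X']
    (e : X ≃ₗᵢ[ℝ] X') {f : ℝ → X}
    (hf : Continuous f) : ∫ s in (0 : ℝ)..1, e (f s) = e (∫ s in (0 : ℝ)..1, f s) :=
  e.toContinuousLinearEquiv.toContinuousLinearMap.intervalIntegral_comp_comm
    (hf.intervalIntegrable 0 1)

/-- The derivative of f is bounded on a compact ball times [0, 1], and this bound dominates the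
integrands because w is unimodular. The target G is general so that the result applies to the
iterated derivatives themselves. -/
theorem hasFDerivAt_integral_smul (hV : IsOpen V) {w : ℝ → ℂ} (hw : Continuous w)
    (hw1 : ∀ s, ‖w s‖ = 1) {f : E × ℝ → G} (hf : ContDiffOn ℝ 1 f (V ×ˢ Set.univ)) {t₀ : E}
    (ht₀ : t₀ ∈ V) :
    HasFDerivAt (fun t => ∫ s in (0 : ℝ)..1, w s • f (t, s))
      (∫ s in (0 : ℝ)..1, w s • (fderiv ℝ f (t₀, s)).comp (ContinuousLinearMap.inl ℝ E ℝ)) t₀ := by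
  have hO : IsOpen (V ×ˢ (Set.univ : Set ℝ)) := hV.prod isOpen_univ
  obtain ⟨r, hr, hrV⟩ := Metric.nhds_basis_closedBall.mem_iff.1 (hV.mem_nhds ht₀)
  have hcd : ContinuousOn (fderiv ℝ f) (V ×ˢ Set.univ) :=
    hf.continuousOn_fderiv_of_isOpen hO le_rfl
  have hK : IsCompact (Metric.closedBall t₀ r ×ˢ Set.Icc (0 : ℝ) 1) :=
    (isCompact_closedBall t₀ r).prod isCompact_Icc
  obtain ⟨C, hC⟩ := hK.exists_bound_of_continuousOn
    (hcd.mono (Set.prod_mono hrV (Set.subset_univ _)))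
  have hline : ∀ t ∈ V, Continuous fun s : ℝ => f (t, s) := fun t ht =>
    hf.continuousOn.comp_continuous (by fun_prop) fun s => ⟨ht, Set.mem_univ s⟩
  have hdline : Continuous fun s : ℝ => fderiv ℝ f (t₀, s) :=
    hcd.comp_continuous (by fun_prop) fun s => ⟨ht₀, Set.mem_univ s⟩
  refine (intervalIntegral.hasFDerivAt_integral_of_dominated_of_fderiv_le
    (F := fun t s => w s • f (t, s)) (μ := MeasureTheory.volume)
    (F' := fun t s => w s • (fderiv ℝ f (t, s)).comp (ContinuousLinearMap.inl ℝ E ℝ))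
    (bound := fun _ => C) (s := Metric.closedBall t₀ r) (Metric.closedBall_mem_nhds t₀ hr)
    ?_ ?_ ?_ ?_ ?_ ?_)
  · filter_upwards [hV.mem_nhds ht₀] with t ht
    exact (hw.smul (hline t ht)).aestronglyMeasurable
  · exact (hw.smul (hline t₀ ht₀)).intervalIntegrable _ _
  · exact (hw.smul (hdline.clm_comp continuous_const)).aestronglyMeasurable
  · refine Filter.Eventually.of_forall fun s hs t ht => ?_
    rw [Set.uIoc_of_le zero_le_one] at hs
    rw [norm_smul, hw1, one_mul]
    refine (ContinuousLinearMap.opNorm_comp_le _ _).trans ?_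
    refine (mul_le_of_le_one_right (norm_nonneg _)
      (ContinuousLinearMap.norm_inl_le_one ℝ E ℝ)).trans ?_
    exact hC (t, s) ⟨ht, Set.Ioc_subset_Icc_self hs⟩
  · exact intervalIntegrable_const
  · refine Filter.Eventually.of_forall fun s _ t ht => ?_
    have h1 : HasFDerivAt f (fderiv ℝ f (t, s)) (t, s) :=
      ((hf.contDiffAt (hO.mem_nhds ⟨hrV ht, Set.mem_univ s⟩)).differentiableAt
        one_ne_zero).hasFDerivAt
    exact (h1.comp t (hasFDerivAt_prodMk_left t s)).const_smul (w s)

/-- The Taylor series is the integral of that of F, restricted to directions in E. Having it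
explicitly gives not only smoothness but also bounds on all derivatives that do not depend on w. -/
theorem hasFTaylorSeriesUpToOn_integral (hV : IsOpen V) {w : ℝ → ℂ} (hw : Continuous w)
    (hw1 : ∀ s, ‖w s‖ = 1) {F : E × ℝ → ℂ} (hF : ContDiffOn ℝ ∞ F (V ×ˢ Set.univ)) :
    HasFTaylorSeriesUpToOn ∞ (fun t => ∫ s in (0 : ℝ)..1, w s * F (t, s))
      (fun t j => ∫ s in (0 : ℝ)..1, w s • (iteratedFDeriv ℝ j F (t, s)).compContinuousLinearMap
        fun _ => ContinuousLinearMap.inl ℝ E ℝ) V := by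
  have hO : IsOpen (V ×ˢ (Set.univ : Set ℝ)) := hV.prod isOpen_univ
  let L (j : ℕ) : ((E × ℝ) [×j]→L[ℝ] ℂ) →L[ℝ] (E [×j]→L[ℝ] ℂ) :=
    ContinuousMultilinearMap.compContinuousLinearMapL fun _ => ContinuousLinearMap.inl ℝ E ℝ
  have hL : ∀ (j : ℕ) (x : E × ℝ), (iteratedFDeriv ℝ j F x).compContinuousLinearMap
      (fun _ => ContinuousLinearMap.inl ℝ E ℝ) = L j (iteratedFDeriv ℝ j F x) := fun j x => rfl
  have hsm : ∀ j : ℕ, ContDiffOn ℝ 1 (fun x => L j (iteratedFDeriv ℝ j F x)) (V ×ˢ Set.univ) :=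
    fun j x hx => ((L j).contDiff.contDiffAt.comp x ((hF.contDiffAt
      (hO.mem_nhds hx)).iteratedFDeriv_right (by exact_mod_cast le_top))).contDiffWithinAt
  have key : ∀ (j : ℕ), ∀ t ∈ V, HasFDerivAt
      (fun t => ∫ s in (0 : ℝ)..1, w s • L j (iteratedFDeriv ℝ j F (t, s)))
      ((∫ s in (0 : ℝ)..1, w s • L (j + 1) (iteratedFDeriv ℝ (j + 1) F (t, s)) :
        E [×(j + 1)]→L[ℝ] ℂ).curryLeft) t := by
    intro j t ht
    have h := hasFDerivAt_integral_smul hV hw hw1 (hsm j) ht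
    refine h.congr_fderiv ?_
    let e : (E [×(j + 1)]→L[ℝ] ℂ) ≃ₗᵢ[ℝ] (E →L[ℝ] (E [×j]→L[ℝ] ℂ)) :=
      continuousMultilinearCurryLeftEquiv ℝ (fun _ : Fin (j + 1) => E) ℂ
    have hint : Continuous fun s : ℝ => w s • L (j + 1) (iteratedFDeriv ℝ (j + 1) F (t, s)) :=
      hw.smul ((hsm (j + 1)).continuousOn.comp_continuous (by fun_prop)
        fun s => ⟨ht, Set.mem_univ s⟩)
    have he : ∫ s in (0 : ℝ)..1, e (w s • L (j + 1) (iteratedFDeriv ℝ (j + 1) F (t, s))) =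
        ContinuousMultilinearMap.curryLeft
          (∫ s in (0 : ℝ)..1, w s • L (j + 1) (iteratedFDeriv ℝ (j + 1) F (t, s))) := by
      have he' := integral_linearIsometryEquiv (X := E [×(j + 1)]→L[ℝ] ℂ)
        (X' := E →L[ℝ] (E [×j]→L[ℝ] ℂ)) e hint
      exact he'
    refine Eq.trans ?_ he
    refine intervalIntegral.integral_congr fun s _ => ?_
    have hd : DifferentiableAt ℝ (iteratedFDeriv ℝ j F) (t, s) :=
      ((hF.contDiffAt (hO.mem_nhds ⟨ht, Set.mem_univ s⟩)).iteratedFDeriv_right (m := 1)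
        (by exact_mod_cast le_top)).differentiableAt one_ne_zero
    have h1 : fderiv ℝ (fun x => L j (iteratedFDeriv ℝ j F x)) (t, s) =
        (L j).comp (fderiv ℝ (iteratedFDeriv ℝ j F) (t, s)) :=
      ((L j).hasFDerivAt.comp _ hd.hasFDerivAt).fderiv
    rw [h1]
    ext v m
    rfl
  constructor
  · intro t ht
    let e := (continuousMultilinearCurryFin0 ℝ E ℂ).toContinuousLinearEquiv.toContinuousLinearMap
    have hint : Continuous fun s : ℝ => w s • L 0 (iteratedFDeriv ℝ 0 F (t, s)) :=
      hw.smul ((hsm 0).continuousOn.comp_continuous (by fun_prop) fun s => ⟨ht, Set.mem_univ s⟩)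
    refine (e.intervalIntegral_comp_comm (hint.intervalIntegrable 0 1)).symm.trans ?_
    exact intervalIntegral.integral_congr fun s _ => rfl
  · intro j _ t ht
    exact (key j t ht).hasFDerivWithinAt
  · intro j _ t ht
    exact (key j t ht).continuousAt.continuousWithinAt

theorem contDiffOn_integral (hV : IsOpen V) {w : ℝ → ℂ} (hw : Continuous w)
    (hw1 : ∀ s, ‖w s‖ = 1) {F : E × ℝ → ℂ} (hF : ContDiffOn ℝ ∞ F (V ×ˢ Set.univ)) :
    ContDiffOn ℝ ∞ (fun t => ∫ s in (0 : ℝ)..1, w s * F (t, s)) V :=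
  (hasFTaylorSeriesUpToOn_integral hV hw hw1 hF).contDiffOn

/-- The order of quantifiers is the point: C is chosen before w, so that it serves all characters at
once. -/
theorem exists_bound_iteratedFDeriv_integral (hV : IsOpen V) {F : E × ℝ → ℂ}
    (hF : ContDiffOn ℝ ∞ F (V ×ˢ Set.univ)) {K : Set E} (hKV : K ⊆ V) (hK : IsCompact K) (j : ℕ) :
    ∃ C, ∀ w : ℝ → ℂ, Continuous w → (∀ s, ‖w s‖ = 1) → ∀ t ∈ K,
      ‖iteratedFDeriv ℝ j (fun t => ∫ s in (0 : ℝ)..1, w s * F (t, s)) t‖ ≤ C := by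
  have hO : IsOpen (V ×ˢ (Set.univ : Set ℝ)) := hV.prod isOpen_univ
  have hc : ContinuousOn (iteratedFDeriv ℝ j F) (V ×ˢ Set.univ) := fun x hx =>
    ((hF.contDiffAt (hO.mem_nhds hx)).iteratedFDeriv_right (m := 0)
      (by exact_mod_cast le_top)).continuousAt.continuousWithinAt
  obtain ⟨C, hC⟩ := (hK.prod (isCompact_Icc (a := (0 : ℝ)) (b := 1))).exists_bound_of_continuousOn
    (hc.mono (Set.prod_mono hKV (Set.subset_univ _)))
  refine ⟨C, fun w hw hw1 t ht => ?_⟩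
  have hT := (hasFTaylorSeriesUpToOn_integral hV hw hw1 hF).eq_iteratedFDerivWithin_of_uniqueDiffOn
    (m := j) (by exact_mod_cast le_top) hV.uniqueDiffOn (hKV ht)
  rw [← iteratedFDerivWithin_of_isOpen j hV (hKV ht), ← hT]
  refine (intervalIntegral.norm_integral_le_of_norm_le_const (C := C) fun s hs => ?_).trans
    (by simp)
  rw [Set.uIoc_of_le zero_le_one] at hs
  rw [norm_smul, hw1, one_mul]
  refine (ContinuousMultilinearMap.norm_compContinuousLinearMap_le _ _).trans ?_
  refine (mul_le_of_le_one_right (norm_nonneg _) ?_).trans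
    (hC (t, s) ⟨ht, Set.Ioc_subset_Icc_self hs⟩)
  exact Finset.prod_le_one (fun _ _ => norm_nonneg _)
    fun _ _ => ContinuousLinearMap.norm_inl_le_one ℝ E ℝ

/-- Integration by parts; periodicity cancels the boundary terms. -/
theorem integral_rot_zpow_mul_deriv {f : ℝ → ℂ} (hf : ContDiff ℝ 1 f) (hper : f 1 = f 0) (n : ℤ) :
    ∫ s in (0 : ℝ)..1, (rot s : ℂ) ^ n * deriv f s =
      -(2 * Real.pi * n * Complex.I) * ∫ s in (0 : ℝ)..1, (rot s : ℂ) ^ n * f s := by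
  rw [intervalIntegral.integral_mul_deriv_eq_deriv_mul (fun s _ => hasDerivAt_rot_zpow n s)
    (fun s _ => (hf.differentiable one_ne_zero s).hasDerivAt)
    ((continuous_const.mul (continuous_rot_zpow n)).intervalIntegrable _ _)
    ((hf.continuous_deriv le_rfl).intervalIntegrable _ _)]
  simp [rot_one, rot_zero, hper, mul_assoc]

/-- The Fourier coefficients of a smooth family of periodic functions decrease rapidly. -/
theorem rapidOn_integral (hV : IsOpen V) {F : E × ℝ → ℂ} (hF : ContDiffOn ℝ ∞ F (V ×ˢ Set.univ))
    (hper : ∀ t ∈ V, ∀ s, F (t, s + 1) = F (t, s)) :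
    RapidOn V fun n t => ∫ s in (0 : ℝ)..1, (rot s : ℂ) ^ n * F (t, s) := by
  refine ⟨fun n => contDiffOn_integral hV (continuous_rot_zpow n) (norm_rot_zpow n) hF,
    fun K hK hKc j k => ?_⟩
  -- Induction on the power k with F generalized: replacing F by its derivative along the circle
  -- multiplies the n-th coefficient by -2πin, whose modulus is at least |n|.
  have main : ∀ k : ℕ, ∀ F : E × ℝ → ℂ, ContDiffOn ℝ ∞ F (V ×ˢ Set.univ) →
      (∀ t ∈ V, ∀ s, F (t, s + 1) = F (t, s)) → ∃ C : ℝ, ∀ n : ℤ, ∀ t ∈ K, |(n : ℝ)| ^ k *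
        ‖iteratedFDeriv ℝ j (fun t => ∫ s in (0 : ℝ)..1, (rot s : ℂ) ^ n * F (t, s)) t‖ ≤ C := by
    intro k
    induction k with
    | zero =>
      intro F hF _
      obtain ⟨C, hC⟩ := exists_bound_iteratedFDeriv_integral hV hF hK hKc j
      refine ⟨C, fun n t ht => ?_⟩
      rw [pow_zero, one_mul]
      exact hC _ (continuous_rot_zpow n) (norm_rot_zpow n) t ht
    | succ k ih =>
      intro F hF hper
      obtain ⟨C, hC⟩ := ih (lastDeriv F) (contDiffOn_lastDeriv hV hF) (fun t ht s => by
        have : (fun s => F (t, s)) = fun s => F (t, s + 1) := by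
          funext s
          exact (hper t ht s).symm
        rw [lastDeriv, lastDeriv]
        conv_rhs => rw [this]
        exact (deriv_comp_add_const (fun s => F (t, s)) 1 s).symm)
      refine ⟨C, fun n t ht => le_trans ?_ (hC n t ht)⟩
      have h1 : iteratedFDeriv ℝ j
          (fun t => ∫ s in (0 : ℝ)..1, (rot s : ℂ) ^ n * lastDeriv F (t, s)) t =
          (-(2 * Real.pi * n * Complex.I)) • iteratedFDeriv ℝ j
            (fun t => ∫ s in (0 : ℝ)..1, (rot s : ℂ) ^ n * F (t, s)) t := by
        rw [← iteratedFDeriv_const_smul_apply' (((contDiffOn_integral hV (continuous_rot_zpow n)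
          (norm_rot_zpow n) hF).contDiffAt (hV.mem_nhds (hK ht))).of_le
            (by exact_mod_cast le_top))]
        refine Filter.EventuallyEq.eq_of_nhds (Filter.EventuallyEq.iteratedFDeriv ℝ ?_ j)
        filter_upwards [hV.mem_nhds (hK ht)] with t' ht'
        have h0 := hper t' ht' 0
        rw [zero_add] at h0
        exact integral_rot_zpow_mul_deriv ((contDiff_line hF ht').of_le (by simp)) h0 n
      rw [h1, norm_smul, pow_succ, mul_assoc]
      refine mul_le_mul_of_nonneg_left (mul_le_mul_of_nonneg_right ?_ (norm_nonneg _))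
        (by positivity)
      have h2 : ‖(-(2 * Real.pi * n * Complex.I) : ℂ)‖ = 2 * Real.pi * |(n : ℝ)| := by
        simp [abs_of_pos Real.pi_pos]
      rw [h2]
      refine le_mul_of_one_le_left (abs_nonneg _) ?_
      linarith [Real.pi_gt_three]
  obtain ⟨C, hC⟩ := main 0 F hF hper
  obtain ⟨D, hD⟩ := main k F hF hper
  -- The constant comes from (1 + |n|)^k ≤ 2^k (1 + |n|^k), with C bounding the derivative itself
  -- and D bounding |n|^k times it.
  refine ⟨2 ^ k * (C + D), fun n t ht => ?_⟩
  have h1 := hC n t ht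
  have h2 := hD n t ht
  rw [pow_zero, one_mul] at h1
  have h3 : (1 + |(n : ℝ)|) ^ k ≤ 2 ^ k * (1 + |(n : ℝ)| ^ k) := by
    rcases le_total |(n : ℝ)| 1 with h | h
    · calc (1 + |(n : ℝ)|) ^ k ≤ 2 ^ k := pow_le_pow_left₀ (by positivity) (by linarith) k
        _ ≤ 2 ^ k * (1 + |(n : ℝ)| ^ k) :=
          le_mul_of_one_le_right (by positivity) (by linarith [pow_nonneg (abs_nonneg (n : ℝ)) k])
    · calc (1 + |(n : ℝ)|) ^ k ≤ (2 * |(n : ℝ)|) ^ k :=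
            pow_le_pow_left₀ (by positivity) (by linarith) k
        _ = 2 ^ k * |(n : ℝ)| ^ k := mul_pow _ _ _
        _ ≤ 2 ^ k * (1 + |(n : ℝ)| ^ k) :=
          mul_le_mul_of_nonneg_left (by linarith) (by positivity)
  refine (mul_le_mul_of_nonneg_right h3 (norm_nonneg _)).trans ?_
  rw [mul_assoc, add_mul, one_mul]
  exact mul_le_mul_of_nonneg_left (add_le_add h1 h2) (by positivity)

end Parametric

/-! ### Rapidly convergent Fourier series -/

section Series

theorem natCast_le_infty (j : ℕ) : (j : WithTop ℕ∞) ≤ ∞ := by exact_mod_cast le_top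

/-- A Taylor series for the sum is obtained termwise: the bound of order k + 1 allows the series of
k-th derivatives to be differentiated. Connectedness is a hypothesis of the differentiation theorem
for series and costs nothing, since balls suffice in the application. -/
theorem contDiffOn_tsum {ι X : Type*} [NormedAddCommGroup X] [NormedSpace ℝ X] {S : Set X}
    (hS : IsOpen S) (hc : IsPreconnected S) {f : ι → X → ℂ} (hf : ∀ i, ContDiffOn ℝ ∞ (f i) S)
    {v : ℕ → ι → ℝ} (hv : ∀ k, Summable (v k))
    (hb : ∀ k i, ∀ x ∈ S, ‖iteratedFDeriv ℝ k (f i) x‖ ≤ v k i) :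
    ContDiffOn ℝ ∞ (fun x => ∑' i, f i x) S := by
  have hsum : ∀ k, ∀ x ∈ S, Summable fun i => iteratedFDeriv ℝ k (f i) x := fun k x hx =>
    Summable.of_norm_bounded (hv k) fun i => hb k i x hx
  have hd : ∀ k i, ∀ x ∈ S, HasFDerivAt (iteratedFDeriv ℝ k (f i))
      (fderiv ℝ (iteratedFDeriv ℝ k (f i)) x) x := fun k i x hx =>
    ((((hf i).contDiffAt (hS.mem_nhds hx)).iteratedFDeriv_right (m := 1)
      (by exact_mod_cast le_top)).differentiableAt one_ne_zero).hasFDerivAt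
  have hnorm : ∀ k i, ∀ x ∈ S, ‖fderiv ℝ (iteratedFDeriv ℝ k (f i)) x‖ ≤ v (k + 1) i := by
    intro k i x hx
    rw [fderiv_iteratedFDeriv, Function.comp_apply, LinearIsometryEquiv.norm_map]
    exact hb (k + 1) i x hx
  have key : ∀ k, ∀ x ∈ S, HasFDerivAt (fun x => ∑' i, iteratedFDeriv ℝ k (f i) x)
      (∑' i, iteratedFDeriv ℝ (k + 1) (f i) x).curryLeft x := by
    intro k x hx
    refine (hasFDerivAt_tsum_of_isPreconnected (hv (k + 1)) hS hc (hd k) (hnorm k) hx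
      (hsum k x hx) hx).congr_fderiv ?_
    let e : (X [×(k + 1)]→L[ℝ] ℂ) ≃ₗᵢ[ℝ] (X →L[ℝ] (X [×k]→L[ℝ] ℂ)) :=
      continuousMultilinearCurryLeftEquiv ℝ (fun _ : Fin (k + 1) => X) ℂ
    exact (e.toContinuousLinearEquiv.map_tsum (f := fun i => iteratedFDeriv ℝ (k + 1) (f i) x)).symm
  refine HasFTaylorSeriesUpToOn.contDiffOn
    (f' := fun x k => ∑' i, iteratedFDeriv ℝ k (f i) x) ⟨fun x hx => ?_, fun k _ x hx => ?_,
      fun k _ x hx => ?_⟩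
  · exact (continuousMultilinearCurryFin0 ℝ X ℂ).toContinuousLinearEquiv.map_tsum
      (f := fun i => iteratedFDeriv ℝ 0 (f i) x)
  · exact (key k x hx).hasFDerivWithinAt
  · exact (key k x hx).continuousAt.continuousWithinAt

theorem summable_inv_one_add_abs_sq : Summable fun n : ℤ => ((1 + |(n : ℝ)|) ^ 2)⁻¹ := by
  have h := (Real.summable_one_div_int_pow (p := 2)).2 one_lt_two
  refine Summable.of_norm_bounded_eventually h ?_
  refine (Set.finite_singleton (0 : ℤ)).subset ?_
  intro n hn
  by_contra hn0
  refine hn ?_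
  have hn1 : 0 < |(n : ℝ)| := abs_pos.2 (by exact_mod_cast hn0)
  show ‖((1 + |(n : ℝ)|) ^ 2)⁻¹‖ ≤ 1 / (n : ℝ) ^ 2
  rw [Real.norm_of_nonneg (by positivity), one_div, ← sq_abs (n : ℝ)]
  gcongr
  linarith

variable {E : Type*} [NormedAddCommGroup E] [NormedSpace ℝ E] {V : Set E} {u : ℤ → E → ℂ}

theorem RapidOn.exists_bound (hu : RapidOn V u) {K : Set E} (hKV : K ⊆ V) (hK : IsCompact K)
    (j k : ℕ) : ∃ C : ℝ, 0 ≤ C ∧ ∀ n : ℤ, ∀ t ∈ K,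
      ‖iteratedFDeriv ℝ j (u n) t‖ ≤ C * ((1 + |(n : ℝ)|) ^ k)⁻¹ := by
  obtain ⟨C, hC⟩ := hu.2 K hKV hK j k
  refine ⟨max C 0, le_max_right _ _, fun n t ht => ?_⟩
  rw [← div_eq_mul_inv, le_div_iff₀ (by positivity), mul_comm]
  exact (hC n t ht).trans (le_max_left _ _)

theorem RapidOn.summable_norm (hu : RapidOn V u) {t : E} (ht : t ∈ V) :
    Summable fun n => ‖u n t‖ := by
  obtain ⟨C, -, hC⟩ := hu.exists_bound (Set.singleton_subset_iff.2 ht) isCompact_singleton 0 2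
  refine Summable.of_nonneg_of_le (fun n => norm_nonneg _) (fun n => ?_)
    (summable_inv_one_add_abs_sq.mul_left C)
  have := hC n t rfl
  rwa [norm_iteratedFDeriv_zero] at this

theorem RapidOn.summable (hu : RapidOn V u) {t : E} (ht : t ∈ V) (s : ℝ) :
    Summable fun n => u n t * (rot s : ℂ) ^ (-n) := by
  refine Summable.of_norm ?_
  simp_rw [norm_mul, norm_rot_zpow, mul_one]
  exact hu.summable_norm ht

theorem norm_iteratedFDeriv_rot_zpow_le (n : ℤ) {i k : ℕ} (hik : i ≤ k) (s : ℝ) :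
    ‖iteratedFDeriv ℝ i (fun s : ℝ => (rot s : ℂ) ^ n) s‖ ≤
      (2 * Real.pi) ^ k * (1 + |(n : ℝ)|) ^ k := by
  rw [norm_iteratedFDeriv_eq_norm_iteratedDeriv, iteratedDeriv_rot_zpow, norm_mul, norm_rot_zpow,
    mul_one, norm_pow, ← mul_pow]
  have h2 : ‖(2 * Real.pi * n * Complex.I : ℂ)‖ = 2 * Real.pi * |(n : ℝ)| := by
    simp [abs_of_pos Real.pi_pos]
  have hpi := Real.pi_gt_three
  rw [h2]
  calc (2 * Real.pi * |(n : ℝ)|) ^ i ≤ (2 * Real.pi * (1 + |(n : ℝ)|)) ^ i := by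
        gcongr
        linarith
    _ ≤ (2 * Real.pi * (1 + |(n : ℝ)|)) ^ k := by
        refine pow_le_pow_right₀ ?_ hik
        nlinarith [abs_nonneg (n : ℝ)]

variable [FiniteDimensional ℝ E]

/-- A rapidly decreasing family of Fourier coefficients defines a smooth family of functions. -/
theorem RapidOn.contDiffOn_tsum (hV : IsOpen V) (hu : RapidOn V u) :
    ContDiffOn ℝ ∞ (fun x : E × ℝ => ∑' n, u n x.1 * (rot x.2 : ℂ) ^ (-n)) (V ×ˢ Set.univ) := by
  rintro ⟨t₀, s₀⟩ ⟨ht₀, -⟩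
  obtain ⟨r, hr, hrV⟩ := Metric.nhds_basis_closedBall.mem_iff.1 (hV.mem_nhds ht₀)
  have hball : Metric.ball t₀ r ⊆ V := Metric.ball_subset_closedBall.trans hrV
  have hO : IsOpen (V ×ˢ (Set.univ : Set ℝ)) := hV.prod isOpen_univ
  have hfst : ∀ n, ContDiffOn ℝ ∞ (fun x : E × ℝ => u n x.1) (V ×ˢ Set.univ) := fun n =>
    (hu.1 n).comp contDiffOn_fst fun x hx => hx.1
  have hsnd : ∀ n : ℤ, ContDiff ℝ ∞ (fun x : E × ℝ => (rot x.2 : ℂ) ^ (-n)) := fun n =>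
    (contDiff_rot_zpow (-n)).comp contDiff_snd
  choose C hC0 hC using fun j k => hu.exists_bound hrV (isCompact_closedBall t₀ r) j k
  -- Leibniz constants. Decay of order k + 2 is taken from the coefficients: k powers pay for at
  -- most k derivatives of the character, and two remain for summability over n.
  let D : ℕ → ℝ := fun k => ∑ i ∈ Finset.range (k + 1), (k.choose i : ℝ) *
    (C i (k + 2) * (2 * Real.pi) ^ k)
  have hbound : ∀ k n, ∀ x ∈ Metric.ball t₀ r ×ˢ (Set.univ : Set ℝ),
      ‖iteratedFDeriv ℝ k (fun x : E × ℝ => u n x.1 * (rot x.2 : ℂ) ^ (-n)) x‖ ≤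
        D k * ((1 + |(n : ℝ)|) ^ 2)⁻¹ := by
    rintro k n ⟨t, s⟩ ⟨ht, -⟩
    have htV : t ∈ V := hball ht
    have hx : (t, s) ∈ V ×ˢ (Set.univ : Set ℝ) := ⟨htV, Set.mem_univ s⟩
    have h1 := norm_iteratedFDerivWithin_mul_le (n := k) (N := ∞) (hfst n) (hsnd n).contDiffOn
      hO.uniqueDiffOn hx (by exact_mod_cast le_top)
    rw [iteratedFDerivWithin_of_isOpen k hO hx] at h1
    refine h1.trans ?_
    rw [Finset.sum_mul]
    refine Finset.sum_le_sum fun i hi => ?_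
    have hik : i ≤ k := Nat.lt_succ_iff.1 (Finset.mem_range.1 hi)
    have h2 : ‖iteratedFDerivWithin ℝ i (fun x : E × ℝ => u n x.1) (V ×ˢ Set.univ) (t, s)‖ ≤
        C i (k + 2) * ((1 + |(n : ℝ)|) ^ (k + 2))⁻¹ := by
      have hpre : ContinuousLinearMap.fst ℝ E ℝ ⁻¹' V = V ×ˢ Set.univ := by
        ext
        simp
      have h3 := (ContinuousLinearMap.fst ℝ E ℝ).iteratedFDerivWithin_comp_right (hu.1 n)
        hV.uniqueDiffOn (hpre ▸ hO.uniqueDiffOn) (x := (t, s)) htV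
        (i := i) (by exact_mod_cast le_top)
      rw [hpre] at h3
      have h6 : ‖iteratedFDerivWithin ℝ i (fun x : E × ℝ => u n x.1) (V ×ˢ Set.univ) (t, s)‖ ≤
          ‖iteratedFDerivWithin ℝ i (u n) V t‖ := by
        refine (congrArg norm h3).trans_le
          ((ContinuousMultilinearMap.norm_compContinuousLinearMap_le _ _).trans ?_)
        exact mul_le_of_le_one_right (norm_nonneg _) (Finset.prod_le_one (fun _ _ => norm_nonneg _)
          fun _ _ => ContinuousLinearMap.norm_fst_le ℝ E ℝ)
      rw [iteratedFDerivWithin_of_isOpen i hV htV] at h6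
      exact h6.trans (hC i (k + 2) n t (Metric.ball_subset_closedBall ht))
    have h4 : ‖iteratedFDerivWithin ℝ (k - i) (fun x : E × ℝ => (rot x.2 : ℂ) ^ (-n))
        (V ×ˢ Set.univ) (t, s)‖ ≤ (2 * Real.pi) ^ k * (1 + |(n : ℝ)|) ^ k := by
      rw [iteratedFDerivWithin_of_isOpen _ hO hx]
      have h5 := (ContinuousLinearMap.snd ℝ E ℝ).iteratedFDeriv_comp_right
        (contDiff_rot_zpow (-n)) (t, s) (i := k - i) (natCast_le_infty _)
      refine (congrArg norm h5).trans_le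
        ((ContinuousMultilinearMap.norm_compContinuousLinearMap_le _ _).trans ?_)
      refine (mul_le_of_le_one_right (norm_nonneg _) (Finset.prod_le_one
        (fun _ _ => norm_nonneg _) fun _ _ => ContinuousLinearMap.norm_snd_le ℝ E ℝ)).trans ?_
      simpa using norm_iteratedFDeriv_rot_zpow_le (-n) (Nat.sub_le k i) s
    have hpos : (0 : ℝ) < 1 + |(n : ℝ)| := by positivity
    calc _ ≤ (k.choose i : ℝ) * (C i (k + 2) * ((1 + |(n : ℝ)|) ^ (k + 2))⁻¹) *
          ((2 * Real.pi) ^ k * (1 + |(n : ℝ)|) ^ k) := by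
          have := hC0 i (k + 2)
          gcongr
      _ = _ := by
          rw [pow_add]
          field_simp
  have hs : IsOpen (Metric.ball t₀ r ×ˢ (Set.univ : Set ℝ)) := Metric.isOpen_ball.prod isOpen_univ
  have hpre : IsPreconnected (Metric.ball t₀ r ×ˢ (Set.univ : Set ℝ)) :=
    ((convex_ball t₀ r).isPreconnected).prod isPreconnected_univ
  have h := ExoticCourant.contDiffOn_tsum hs hpre (fun n => ((hfst n).mul
    (hsnd n).contDiffOn).mono (Set.prod_mono hball subset_rfl))
    (fun k => summable_inv_one_add_abs_sq.mul_left (D k)) hbound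
  exact (h.contDiffAt (hs.mem_nhds ⟨Metric.mem_ball_self hr, Set.mem_univ s₀⟩)).contDiffWithinAt

end Series

/-! ### Fourier inversion and convolution for smooth periodic functions. -/

section Inversion

variable {f : ℝ → ℂ}

theorem summable_norm_integral_rot_mul (hf : ContDiff ℝ ∞ f) (hper : ∀ s, f (s + 1) = f s) :
    Summable fun n : ℤ => ‖∫ s in (0 : ℝ)..1, (rot s : ℂ) ^ n * f s‖ :=
  (rapidOn_integral (E := ℝ) (F := fun x => f x.2) isOpen_univ
    (hf.comp contDiff_snd).contDiffOn fun _ _ s => hper s).summable_norm (Set.mem_univ (0 : ℝ))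

/-- Fourier inversion. -/
theorem hasSum_integral_rot_mul_rot (hf : ContDiff ℝ ∞ f) (hper : ∀ s, f (s + 1) = f s) (t : ℝ) :
    HasSum (fun n : ℤ => (∫ s in (0 : ℝ)..1, (rot s : ℂ) ^ n * f s) * (rot t : ℂ) ^ (-n))
      (f t) := by
  have : Fact ((0 : ℝ) < 1) := ⟨one_pos⟩
  have hp : Function.Periodic f 1 := hper
  let g : C(AddCircle (1 : ℝ), ℂ) := ⟨hp.lift, continuous_coinduced_dom.mpr hf.continuous⟩
  have hchar : ∀ (n : ℤ) (s : ℝ), fourier (T := 1) n (s : AddCircle (1 : ℝ)) = (rot s : ℂ) ^ n := by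
    intro n s
    rw [fourier_coe_apply, coe_rot_zpow]
    congr 1
    push_cast
    ring
  have hcoef : ∀ n : ℤ, fourierCoeff g n = ∫ s in (0 : ℝ)..1, (rot s : ℂ) ^ (-n) * f s := by
    intro n
    rw [fourierCoeff_eq_intervalIntegral _ _ 0]
    simp only [hchar, div_one, one_smul, zero_add, smul_eq_mul]
    rfl
  -- Rapid decrease gives absolute summability, which for a continuous function on the circle
  -- implies pointwise convergence of its Fourier series.
  have hsum : Summable (fourierCoeff g) := by
    refine Summable.of_norm ?_
    simp_rw [hcoef]
    exact ((Equiv.neg ℤ).summable_iff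
      (f := fun n : ℤ => ‖∫ s in (0 : ℝ)..1, (rot s : ℂ) ^ n * f s‖)).2
      (summable_norm_integral_rot_mul hf hper)
  have h := has_pointwise_sum_fourier_series_of_summable hsum (t : AddCircle (1 : ℝ))
  simp_rw [hchar, hcoef, smul_eq_mul] at h
  -- `fourierCoeff` integrates against the character of index -n, so the summation index is negated
  -- to match the convention for weights.
  have h2 := (Equiv.neg ℤ).hasSum_iff.2 h
  have h3 : g (t : AddCircle (1 : ℝ)) = f t := rfl
  rw [h3] at h2
  simpa [Function.comp_def] using h2

/-- Fourier coefficients of a product are given by convolution. -/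
theorem hasSum_integral_rot_mul_mul (hf : ContDiff ℝ ∞ f) (hper : ∀ s, f (s + 1) = f s)
    {g : ℝ → ℂ} (hg : Continuous g) (n : ℤ) :
    HasSum (fun m : ℤ => (∫ s in (0 : ℝ)..1, (rot s : ℂ) ^ m * f s) *
      ∫ s in (0 : ℝ)..1, (rot s : ℂ) ^ (n - m) * g s)
      (∫ s in (0 : ℝ)..1, (rot s : ℂ) ^ n * (f s * g s)) := by
  have h := hasSum_integral_rot_mul (summable_norm_integral_rot_mul hf hper)
    (g := fun s => (rot s : ℂ) ^ n * g s) ((continuous_rot_zpow n).mul hg)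
    (hasSum_integral_rot_mul_rot hf hper)
  convert h using 3 with m s
  · refine intervalIntegral.integral_congr fun s _ => ?_
    rw [← mul_assoc, ← zpow_add₀ (Circle.coe_ne_zero _), sub_eq_neg_add]
  · ring

end Inversion

/-! ### Smooth functions with values in finite dimensional spaces -/

section WeakSmooth

variable (E : Type*) [NormedAddCommGroup E] [NormedSpace ℝ E]
  {N : Type*} [TopologicalSpace N] [ChartedSpace E N]
  {W : Type*} [AddCommGroup W] [Module ℂ W]
  {W' : Type*} [AddCommGroup W'] [Module ℂ W'] {W'' : Type*} [AddCommGroup W''] [Module ℂ W'']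

/-- A function with values in a (finite dimensional) vector space is smooth at a point if its
compositions with all linear functionals are. -/
def WSmoothAt (f : N → W) (y : N) : Prop :=
  ∀ l : Module.Dual ℂ W, ContMDiffAt 𝓘(ℝ, E) 𝓘(ℝ, ℂ) ∞ (fun x => l (f x)) y

variable {E} {y : N}

theorem WSmoothAt.const (w : W) : WSmoothAt E (fun _ : N => w) y := fun _ => contMDiffAt_const

theorem WSmoothAt.congr {f g : N → W} (hf : WSmoothAt E f y) (h : g =ᶠ[nhds y] f) :
    WSmoothAt E g y := fun l =>
  (hf l).congr_of_eventuallyEq (h.mono fun _ hx => congrArg l hx)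

theorem WSmoothAt.map {f : N → W} (hf : WSmoothAt E f y) (L : W →ₗ[ℂ] W') :
    WSmoothAt E (fun x => L (f x)) y := fun l => hf (l ∘ₗ L)

theorem WSmoothAt.add {f g : N → W} (hf : WSmoothAt E f y) (hg : WSmoothAt E g y) :
    WSmoothAt E (fun x => f x + g x) y := fun l => by
  simp only [map_add]
  exact (hf l).add (hg l)

theorem WSmoothAt.comp {E' : Type*} [NormedAddCommGroup E'] [NormedSpace ℝ E'] {N' : Type*}
    [TopologicalSpace N'] [ChartedSpace E' N'] {f : N → W} {g : N' → N} {x : N'}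
    (hf : WSmoothAt E f (g x)) (hg : ContMDiffAt 𝓘(ℝ, E') 𝓘(ℝ, E) ∞ g x) :
    WSmoothAt E' (fun x => f (g x)) x := fun l =>
  ContMDiffAt.comp (g := fun z => l (f z)) x (hf l) hg

theorem contMDiffAt_mul {f g : N → ℂ} (hf : ContMDiffAt 𝓘(ℝ, E) 𝓘(ℝ, ℂ) ∞ f y)
    (hg : ContMDiffAt 𝓘(ℝ, E) 𝓘(ℝ, ℂ) ∞ g y) :
    ContMDiffAt 𝓘(ℝ, E) 𝓘(ℝ, ℂ) ∞ (fun x => f x * g x) y :=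
  (contDiff_mul (𝕜 := ℝ) (𝔸 := ℂ)).contMDiff.contMDiffAt.comp y (hf.prodMk_space hg)

/-- Smooth families of linear maps, applied to smooth functions. -/
theorem WSmoothAt.apply [Module.Finite ℂ W] {Θ : N → W →ₗ[ℂ] W'} {f : N → W}
    (hΘ : ∀ w, WSmoothAt E (fun x => Θ x w) y) (hf : WSmoothAt E f y) :
    WSmoothAt E (fun x => Θ x (f x)) y := fun l => by
  have : (fun x => l (Θ x (f x))) = fun x => ∑ i,
      (Module.finBasis ℂ W).coord i (f x) * l (Θ x (Module.finBasis ℂ W i)) := by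
    funext x
    exact dual_eq_sum (l ∘ₗ Θ x) (f x)
  rw [this]
  exact contMDiffAt_finsetSum fun i _ => contMDiffAt_mul (hf _) (hΘ _ l)

theorem WSmoothAt.bilin [Module.Finite ℂ W] {f : N → W} {g : N → W'}
    (b : W →ₗ[ℂ] W' →ₗ[ℂ] W'') (hf : WSmoothAt E f y) (hg : WSmoothAt E g y) :
    WSmoothAt E (fun x => b (f x) (g x)) y :=
  WSmoothAt.apply (Θ := fun x => b.flip (g x)) (fun w => hg.map (b w)) hf

theorem WSmoothAt.comp_equiv {f : N → W} (e : W ≃ₗ[ℂ] W') (hf : WSmoothAt E (fun x => e (f x)) y) :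
    WSmoothAt E f y := by
  simpa using hf.map e.symm.toLinearMap

end WeakSmooth

/-! ### Smoothness of the operations induced by smooth families of linear maps. -/

section LinearFamilies

variable {E : Type*} [NormedAddCommGroup E] [NormedSpace ℝ E]
  {V : Type*} [NormedAddCommGroup V] [NormedSpace ℝ V] [FiniteDimensional ℝ V]
  {V' : Type*} [NormedAddCommGroup V'] [NormedSpace ℝ V'] [FiniteDimensional ℝ V']
  {L : E → V →ₗ[ℝ] V'} {t : E}

/-- In a dual basis the pull-back has the coordinates α(L x bᵢ), which are smooth by assumption. -/
theorem wSmoothAt_pull (hL : ∀ v, ContDiffAt ℝ ∞ (fun x => L x v) t) (α : CCovec V') :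
    WSmoothAt E (fun x => pull (L x) α) t := by
  intro l
  let b := Module.finBasis ℝ V
  have : (fun x => l (pull (L x) α)) = fun x => ∑ i,
      α (L x (b i)) * l (CCovec.ofReal (b.coord i)) := by
    funext x
    have h1 : pull (L x) α = ∑ i, α (L x (b i)) • CCovec.ofReal (b.coord i) := by
      refine b.ext fun j => ?_
      simp [Finsupp.single_apply, apply_ite]
    rw [h1, map_sum]
    simp
  rw [this]
  refine contMDiffAt_finsetSum fun i _ => contMDiffAt_mul ?_ contMDiffAt_const
  rw [contMDiffAt_iff_contDiffAt]
  exact (LinearMap.toContinuousLinearMap α).contDiff.contDiffAt.comp t (hL (b i))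

/-- By reflexivity every functional on vectors is evaluation at a covector, which reduces the claim
to pull-backs. -/
theorem wSmoothAt_push (hL : ∀ v, ContDiffAt ℝ ∞ (fun x => L x v) t) (X : CVec V) :
    WSmoothAt E (fun x => push (L x) X) t := by
  intro l
  obtain ⟨α, rfl⟩ := (Module.evalEquiv ℂ (CCovec V')).surjective l
  exact wSmoothAt_pull hL α X

theorem wSmoothAt_pullExt (hL : ∀ v, ContDiffAt ℝ ∞ (fun x => L x v) t) (η : Ext V') :
    WSmoothAt E (fun x => pullExt (L x) η) t := by
  induction η using ext_induction with
  | one => simpa using WSmoothAt.const (1 : Ext V)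
  | smul r x hx =>
    simp only [map_smul]
    exact hx.map (r • LinearMap.id)
  | add x y hx hy => simpa using hx.add hy
  | mul α x hx =>
    simp only [map_mul, pullExt_oneForm]
    exact WSmoothAt.bilin (LinearMap.mul ℂ (Ext V))
      ((wSmoothAt_pull hL α).map (ExteriorAlgebra.ι ℂ)) hx

theorem contDiffAt_toContinuousLinearMap {V' : Type*} [NormedAddCommGroup V'] [NormedSpace ℝ V']
    {L : E → V →ₗ[ℝ] V'} (hL : ∀ v, ContDiffAt ℝ ∞ (fun x => L x v) t) :
    ContDiffAt ℝ ∞ (fun x => LinearMap.toContinuousLinearMap (L x)) t := by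
  let b := Module.finBasis ℝ V
  have : (fun x => LinearMap.toContinuousLinearMap (L x)) = fun x => ∑ i,
      ContinuousLinearMap.smulRightL ℝ V V' (LinearMap.toContinuousLinearMap (b.coord i))
        (L x (b i)) := by
    funext x
    apply ContinuousLinearMap.coe_injective
    refine b.ext fun j => ?_
    simp [Finsupp.single_apply]
  rw [this]
  exact ContDiffAt.sum fun i _ =>
    (ContinuousLinearMap.smulRightL ℝ V V' _).contDiff.contDiffAt.comp t (hL (b i))

/-- Inversion is smooth on invertible continuous linear maps. This turns smoothness of a frame in
charts into smoothness of its inverse. -/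
theorem contDiffAt_inverse_family {V' : Type*} [NormedAddCommGroup V'] [NormedSpace ℝ V']
    {L : E → V →ₗ[ℝ] V'} {L' : E → V' →ₗ[ℝ] V}
    (hL : ∀ v, ContDiffAt ℝ ∞ (fun x => L x v) t)
    (h : ∀ᶠ x in nhds t, L x ∘ₗ L' x = LinearMap.id ∧ L' x ∘ₗ L x = LinearMap.id) (v : V') :
    ContDiffAt ℝ ∞ (fun x => L' x v) t := by
  have e : ∀ x, L x ∘ₗ L' x = LinearMap.id ∧ L' x ∘ₗ L x = LinearMap.id →
      ∃ e : V ≃L[ℝ] V', (e : V →L[ℝ] V') = LinearMap.toContinuousLinearMap (L x) ∧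
        ∀ v, e.symm v = L' x v := fun x hx =>
    ⟨(LinearEquiv.ofLinearMap (L x) (L' x) hx.1 hx.2).toContinuousLinearEquiv, rfl, fun v => rfl⟩
  obtain ⟨e₀, he₀, -⟩ := e t h.self_of_nhds
  have h1 : ContDiffAt ℝ ∞ ContinuousLinearMap.inverse (LinearMap.toContinuousLinearMap (L t)) := by
    rw [← he₀]
    exact contDiffAt_map_inverse e₀
  have h2 := (h1.comp t (contDiffAt_toContinuousLinearMap hL)).clm_apply
    (contDiffAt_const (c := v))
  refine h2.congr_of_eventuallyEq ?_
  filter_upwards [h] with x hx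
  obtain ⟨e₁, he₁, he₂⟩ := e x hx
  simp [← he₁, ← he₂]

end LinearFamilies

/-! ### Geometry of principal circle bundles -/

section Geometry

variable {EM EZ : Type*} [NormedAddCommGroup EM] [NormedSpace ℝ EM]
  [NormedAddCommGroup EZ] [NormedSpace ℝ EZ]
  {M Z : Type*} [TopologicalSpace M] [ChartedSpace EM M] [TopologicalSpace Z] [ChartedSpace EZ Z]
  [MulAction Circle Z] {p : Z → M}

theorem contMDiff_rot : ContMDiff 𝓘(ℝ, ℝ) (𝓡 1) ∞ rot :=
  contMDiff_circleExp.comp (contDiff_const.mul contDiff_id).contMDiff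

namespace IsPrincipalCircleBundle

variable (hp : IsPrincipalCircleBundle EM EZ p)
include hp

theorem exists_triv_at (z₀ : Z) : ∃ U : Set M, IsOpen U ∧ p z₀ ∈ U ∧
    ∃ Φ : OpenPartialHomeomorph (M × Circle) Z,
      Φ.source = U ×ˢ Set.univ ∧ Φ.target = p ⁻¹' U ∧
      ContMDiffOn (𝓘(ℝ, EM).prod (𝓡 1)) 𝓘(ℝ, EZ) ∞ Φ Φ.source ∧
      ContMDiffOn 𝓘(ℝ, EZ) (𝓘(ℝ, EM).prod (𝓡 1)) ∞ Φ.symm Φ.target ∧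
      (∀ y ∈ U, ∀ c : Circle, p (Φ (y, c)) = y ∧ Φ (y, c) = c • Φ (y, 1)) ∧
      ∀ z, p z ∈ U → Φ (p z, (Φ.symm z).2) = z := by
  obtain ⟨U, hU, hx, Φ, hs, ht, h1, h2, h3⟩ := hp.exists_triv (p z₀)
  refine ⟨U, hU, hx, Φ, hs, ht, h1, h2, h3, fun z hz => ?_⟩
  have hzt : z ∈ Φ.target := by rw [ht]; exact hz
  have h4 := Φ.map_target hzt
  rw [hs] at h4
  have h5 := (h3 _ h4.1 (Φ.symm z).2).1
  rw [Prod.mk.eta, Φ.right_inv hzt] at h5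
  rw [h5, Prod.mk.eta, Φ.right_inv hzt]

theorem proj_smul (c : Circle) (z : Z) : p (c • z) = p z := by
  obtain ⟨U, -, hx, Φ, -, -, -, -, h3, h4⟩ := hp.exists_triv_at z
  have h5 := h4 z hx
  rw [(h3 _ hx _).2] at h5
  rw [← h5, smul_smul, ← (h3 _ hx _).2, ← (h3 _ hx _).2, (h3 _ hx _).1, (h3 _ hx _).1]

theorem exists_smul_eq {z z' : Z} (h : p z = p z') : ∃ c : Circle, z' = c • z := by
  obtain ⟨U, -, hx, Φ, -, -, -, -, h3, h4⟩ := hp.exists_triv_at z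
  have h5 := h4 z hx
  have h6 := h4 z' (h ▸ hx)
  rw [← h, (h3 _ hx _).2] at h6
  rw [(h3 _ hx _).2] at h5
  refine ⟨(Φ.symm z').2 * (Φ.symm z).2⁻¹, ?_⟩
  calc z' = (Φ.symm z').2 • Φ (p z, 1) := h6.symm
    _ = ((Φ.symm z').2 * (Φ.symm z).2⁻¹) • (Φ.symm z).2 • Φ (p z, 1) := by
      rw [smul_smul, inv_mul_cancel_right]
    _ = _ := by rw [h5]

theorem surjective : Function.Surjective p := fun x => by
  obtain ⟨U, -, hx, Φ, -, -, -, -, h3⟩ := hp.exists_triv x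
  exact ⟨Φ (x, 1), (h3 x hx 1).1⟩

/-- Near each point, a principal circle bundle has a section through the point and an angular
coordinate with respect to it. -/
theorem exists_local_coordinate (z₀ : Z) : ∃ (U : Set M) (σ : M → Z) (s : Z → ℝ), IsOpen U ∧
    p z₀ ∈ U ∧ IsLocalSection EM EZ p U σ ∧ σ (p z₀) = z₀ ∧ s z₀ = 0 ∧
    ContMDiffAt 𝓘(ℝ, EZ) 𝓘(ℝ, ℝ) ∞ s z₀ ∧ ∀ z, p z ∈ U → z = rot (s z) • σ (p z) := by
  obtain ⟨U, hU, hx, Φ, hs, ht, h1, h2, h3, h4⟩ := hp.exists_triv_at z₀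
  -- The trivialization is rotated by c₀, so that z₀ lies on the section and its angle is 0, away
  -- from the cut of the argument.
  let c₀ := (Φ.symm z₀).2
  let γ : Z → Circle := fun z => c₀⁻¹ * (Φ.symm z).2
  let s : Z → ℝ := fun z => Complex.arg (γ z) / (2 * Real.pi)
  have hrot : ∀ z, rot (s z) = γ z := fun z => by
    rw [rot, mul_div_cancel₀ _ (by positivity), Circle.exp_arg]
  have hγ₀ : γ z₀ = 1 := inv_mul_cancel c₀
  refine ⟨U, fun x => Φ (x, c₀), s, hU, hx, ⟨?_, fun x hx => (h3 x hx c₀).1⟩, h4 z₀ hx, ?_, ?_,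
    fun z hz => ?_⟩
  · rw [hs] at h1
    exact h1.comp (contMDiffOn_id.prodMk contMDiffOn_const) fun x hx => ⟨hx, Set.mem_univ _⟩
  · simp [s, hγ₀]
  · have h5 : ContMDiffAt 𝓘(ℝ, EZ) (𝓡 1) ∞ γ z₀ := by
      have h6 : ContMDiffAt 𝓘(ℝ, EZ) (𝓘(ℝ, EM).prod (𝓡 1)) ∞ Φ.symm z₀ :=
        h2.contMDiffAt (Φ.open_target.mem_nhds (by rw [ht]; exact hx))
      exact contMDiffAt_const.mul (contMDiffAt_snd.comp z₀ h6)
    have h6 : ContMDiffAt 𝓘(ℝ, EZ) 𝓘(ℝ, ℂ) ∞ (fun z => (γ z : ℂ)) z₀ := by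
      have : Fact (Module.finrank ℝ ℂ = 1 + 1) := finrank_real_complex_fact'
      have h7 : ContMDiff (𝓡 1) 𝓘(ℝ, ℂ) ∞ (fun c : Circle => (c : ℂ)) := contMDiff_coe_sphere
      exact h7.contMDiffAt.comp z₀ h5
    -- Near γ z₀ = 1 the angle is the imaginary part of the principal logarithm, which is smooth
    -- there.
    have h8 : ContDiffAt ℝ ∞ (fun w : ℂ => (Complex.log w).im / (2 * Real.pi)) (γ z₀ : ℂ) := by
      have h9 : ContDiffAt ℂ ∞ Complex.log (γ z₀ : ℂ) := by
        refine Complex.contDiffAt_log ?_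
        rw [hγ₀, Circle.coe_one]
        exact Complex.one_mem_slitPlane
      exact (Complex.imCLM.contDiff.contDiffAt.comp _ (h9.restrict_scalars ℝ)).div_const _
    have h9 := h8.contMDiffAt.comp z₀ h6
    simpa only [Function.comp_def, Complex.log_im] using h9
  · change z = rot (s z) • Φ (p z, c₀)
    rw [hrot, (h3 _ hz c₀).2, smul_smul, mul_comm, mul_inv_cancel_left, ← (h3 _ hz _).2, h4 z hz]

end IsPrincipalCircleBundle

theorem contMDiff_smul_const (hp : IsPrincipalCircleBundle EM EZ p) (z : Z) :
    ContMDiff (𝓡 1) 𝓘(ℝ, EZ) ∞ fun c : Circle => c • z :=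
  hp.contMDiff_smul.comp (contMDiff_id.prodMk contMDiff_const)

theorem contMDiff_const_smul (hp : IsPrincipalCircleBundle EM EZ p) (c : Circle) :
    ContMDiff 𝓘(ℝ, EZ) 𝓘(ℝ, EZ) ∞ fun z : Z => c • z :=
  hp.contMDiff_smul.comp (contMDiff_const.prodMk contMDiff_id)

/-- The projection is constant along orbits; differentiate at time 0. -/
theorem dProj_gen (hp : IsPrincipalCircleBundle EM EZ p) (z : Z) :
    dProj EM EZ p z (gen EZ z) = 0 := by
  have h1 : MDifferentiableAt 𝓘(ℝ, ℝ) 𝓘(ℝ, EZ) (fun t : ℝ => rot t • z) 0 :=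
    (((contMDiff_smul_const hp z).comp contMDiff_rot).mdifferentiable (by simp)) 0
  have h2 : MDifferentiableAt 𝓘(ℝ, EZ) 𝓘(ℝ, EM) p z := hp.contMDiff_proj.mdifferentiable (by simp) z
  have h0 : rot 0 • z = z := by rw [rot_zero, one_smul]
  have h3 := mfderiv_comp_of_eq (x := (0 : ℝ)) (y := z) h2 h1 h0
  have h4 : p ∘ (fun t : ℝ => rot t • z) = fun _ => p z := by
    funext t
    exact hp.proj_smul _ z
  rw [h4, mfderiv_const] at h3
  -- The chain rule yields the derivative at `rot 0 • z`, which equals z only propositionally. The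
  -- two derivatives are compared as maps of the model spaces.
  have h5 : ∀ z', z' = z → ((mfderiv 𝓘(ℝ, EZ) 𝓘(ℝ, EM) p z' : _) : EZ →L[ℝ] EM) =
      mfderiv 𝓘(ℝ, EZ) 𝓘(ℝ, EM) p z := by
    rintro _ rfl; rfl
  have h6 := congrArg (fun L : ℝ →L[ℝ] EM => L 1) h3
  have h7 : ((mfderiv 𝓘(ℝ, EZ) 𝓘(ℝ, EM) p (rot 0 • z) : _) : EZ →L[ℝ] EM) (gen EZ z) = 0 := h6.symm
  rw [h5 _ h0] at h7
  exact h7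

/-- Differentiate p ∘ σ = id for a local section σ through z. -/
theorem dProj_surjective (hp : IsPrincipalCircleBundle EM EZ p) (z : Z) :
    Function.Surjective (dProj EM EZ p z) := by
  obtain ⟨U, σ, s, hU, hx, hσ, hσz, -⟩ := hp.exists_local_coordinate z
  have h1 : MDifferentiableAt 𝓘(ℝ, EM) 𝓘(ℝ, EZ) σ (p z) :=
    (hσ.smooth.contMDiffAt (hU.mem_nhds hx)).mdifferentiableAt (by simp)
  have h2 : MDifferentiableAt 𝓘(ℝ, EZ) 𝓘(ℝ, EM) p z := hp.contMDiff_proj.mdifferentiable (by simp) z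
  have h3 := mfderiv_comp_of_eq (x := p z) (y := z) h2 h1 hσz
  have h4 : p ∘ σ =ᶠ[nhds (p z)] id := by
    filter_upwards [hU.mem_nhds hx] with x hx
    exact hσ.right_inv x hx
  have h5 : ∀ z', z' = z → ((mfderiv 𝓘(ℝ, EZ) 𝓘(ℝ, EM) p z' : _) : EZ →L[ℝ] EM) =
      mfderiv 𝓘(ℝ, EZ) 𝓘(ℝ, EM) p z := by
    rintro _ rfl; rfl
  have h6 : ((mfderiv 𝓘(ℝ, EM) 𝓘(ℝ, EM) (p ∘ σ) (p z) : _) : EM →L[ℝ] EM) =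
      ContinuousLinearMap.id ℝ EM := by
    rw [h4.mfderiv_eq]
    exact mfderiv_id
  intro x
  refine ⟨(mfderiv 𝓘(ℝ, EM) 𝓘(ℝ, EZ) σ (p z) : EM →L[ℝ] EZ) x, ?_⟩
  have h7 := congrArg (fun L : EM →L[ℝ] EM => L x) (h6.symm.trans h3)
  have h8 : ((mfderiv 𝓘(ℝ, EZ) 𝓘(ℝ, EM) p (σ (p z)) : _) : EZ →L[ℝ] EM)
      ((mfderiv 𝓘(ℝ, EM) 𝓘(ℝ, EZ) σ (p z) : EM →L[ℝ] EZ) x) = x := h7.symm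
  rw [h5 _ hσz] at h8
  exact h8

/-- Differentiate the identity z = e^{2πi s(z)} σ(p z). On the kernel of dp the part coming from σ
vanishes, and only the angular part remains, a multiple of the generator. This gives exactness of
the vertical sequence without a dimension count. -/
theorem exists_smul_gen (hp : IsPrincipalCircleBundle EM EZ p) (z : Z) (w : T EZ z)
    (hw : dProj EM EZ p z w = 0) : ∃ r : ℝ, w = r • gen EZ z := by
  obtain ⟨U, σ, s, hU, hx, hσ, hσz, hs0, hs, hz⟩ := hp.exists_local_coordinate z
  let m : Circle × Z → Z := fun a => a.1 • a.2
  let D : Circle → Z → (EuclideanSpace ℝ (Fin 1) × EZ →L[ℝ] EZ) := fun c z' =>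
    mfderiv ((𝓡 1).prod 𝓘(ℝ, EZ)) 𝓘(ℝ, EZ) m (c, z')
  have hm : MDifferentiable ((𝓡 1).prod 𝓘(ℝ, EZ)) 𝓘(ℝ, EZ) m :=
    hp.contMDiff_smul.mdifferentiable (by simp)
  have hrot : MDifferentiable 𝓘(ℝ, ℝ) (𝓡 1) rot := contMDiff_rot.mdifferentiable (by simp)
  have hpz : MDifferentiableAt 𝓘(ℝ, EZ) 𝓘(ℝ, EM) p z :=
    hp.contMDiff_proj.mdifferentiable (by simp) z
  have hsz : MDifferentiableAt 𝓘(ℝ, EZ) 𝓘(ℝ, ℝ) s z := hs.mdifferentiableAt (by simp)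
  have hσx : MDifferentiableAt 𝓘(ℝ, EM) 𝓘(ℝ, EZ) σ (p z) :=
    (hσ.smooth.contMDiffAt (hU.mem_nhds hx)).mdifferentiableAt (by simp)
  let R : ℝ → (ℝ →L[ℝ] EuclideanSpace ℝ (Fin 1)) := fun r => mfderiv 𝓘(ℝ, ℝ) (𝓡 1) rot r
  let S : EZ →L[ℝ] ℝ := mfderiv 𝓘(ℝ, EZ) 𝓘(ℝ, ℝ) s z
  let Q : EM →L[ℝ] EZ := mfderiv 𝓘(ℝ, EM) 𝓘(ℝ, EZ) σ (p z)
  have hgen : gen EZ z = D (rot 0) z (R 0 1, 0) := by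
    have h1 : HasMFDerivAt 𝓘(ℝ, ℝ) ((𝓡 1).prod 𝓘(ℝ, EZ)) (fun t : ℝ => (rot t, z)) 0
        ((R 0).prod 0) := (hrot 0).hasMFDerivAt.prodMk (hasMFDerivAt_const z 0)
    have h2 := (hm (rot 0, z)).hasMFDerivAt.comp (0 : ℝ) h1
    have h3 := h2.mfderiv
    exact congrArg (fun L : ℝ →L[ℝ] EZ => L 1) h3
  have hw' : w = D (rot (s z)) (σ (p z))
      (R (s z) (S w), 0) := by
    have h1 := ((hrot (s z)).hasMFDerivAt.comp z hsz.hasMFDerivAt).prodMk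
      (hσx.hasMFDerivAt.comp z hpz.hasMFDerivAt)
    have h2 := (hm (rot (s z), σ (p z))).hasMFDerivAt.comp z h1
    have h3 := h2.mfderiv
    have h4 : (m ∘ fun x => ((rot ∘ s) x, (σ ∘ p) x)) =ᶠ[nhds z] id := by
      filter_upwards [(hU.preimage hp.contMDiff_proj.continuous).mem_nhds hx] with z' hz'
      exact (hz z' hz').symm
    have h5 : ((mfderiv 𝓘(ℝ, EZ) 𝓘(ℝ, EZ) (m ∘ fun x => ((rot ∘ s) x, (σ ∘ p) x)) z : _) :
        EZ →L[ℝ] EZ) = ContinuousLinearMap.id ℝ EZ := by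
      rw [h4.mfderiv_eq]
      exact mfderiv_id
    have h6 := congrArg (fun L : EZ →L[ℝ] EZ => L w) (h5.symm.trans h3)
    have h7 : w = D (rot (s z)) (σ (p z))
      (R (s z) (S w),
        Q (dProj EM EZ p z w)) := h6
    rw [hw, map_zero] at h7
    exact h7
  -- The angle vanishes at z and the section passes through z, so both w and the generator are
  -- values of the differential of the action at the same point (1, z).
  rw [hs0, hσz] at hw'
  refine ⟨S w, ?_⟩
  rw [hgen]
  generalize (S w) = r at hw'
  have h8 : (R 0 r, (0 : EZ)) = r • (R 0 1, (0 : EZ)) := by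
    rw [Prod.smul_mk, smul_zero, ← map_smul, smul_eq_mul, mul_one]
  rw [h8, map_smul] at hw'
  exact hw'

/-- The splitting of the tangent space given by a connection form. -/
def frame (hp : IsPrincipalCircleBundle EM EZ p) {A : ∀ z : Z, T EZ z →ₗ[ℝ] ℝ}
    (hA : IsConnectionForm EZ A) (z : Z) : T EZ z ≃ₗ[ℝ] EM × ℝ :=
  LinearEquiv.ofBijective ((dProj EM EZ p z).prod (A z)) (by
    constructor
    · rw [← LinearMap.ker_eq_bot, LinearMap.ker_eq_bot']
      intro w hw
      obtain ⟨r, rfl⟩ := exists_smul_gen hp z w (congrArg Prod.fst hw)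
      have h1 : A z (r • gen EZ z) = 0 := congrArg Prod.snd hw
      rw [map_smul, hA.gen_eq_one, smul_eq_mul, mul_one] at h1
      rw [h1, zero_smul]
    · rintro ⟨x, r⟩
      obtain ⟨w, hw⟩ := dProj_surjective hp z x
      refine ⟨w + (r - A z w) • gen EZ z, ?_⟩
      simp [dProj_gen hp, hA.gen_eq_one, hw])

theorem frame_apply (hp : IsPrincipalCircleBundle EM EZ p) {A : ∀ z : Z, T EZ z →ₗ[ℝ] ℝ}
    (hA : IsConnectionForm EZ A) (z : Z) (w : T EZ z) :
    frame hp hA z w = (dProj EM EZ p z w, A z w) := rfl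

/-- Both components of the frame are invariant under the action. Invariance of a field thus means
that its expression in the frame is constant along fibres. -/
theorem frame_dAct (hp : IsPrincipalCircleBundle EM EZ p) {A : ∀ z : Z, T EZ z →ₗ[ℝ] ℝ}
    (hA : IsConnectionForm EZ A) (c : Circle) (z : Z) (w : T EZ z) :
    frame hp hA (c • z) (dAct EZ c z w) = frame hp hA z w := by
  rw [frame_apply, frame_apply]
  refine Prod.ext ?_ (congrArg (fun L : T EZ z →ₗ[ℝ] ℝ => L w) (hA.invariant c z))
  have h1 : MDifferentiableAt 𝓘(ℝ, EZ) 𝓘(ℝ, EZ) (fun z : Z => c • z) z :=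
    (contMDiff_const_smul hp c).mdifferentiable (by simp) z
  have h2 : MDifferentiableAt 𝓘(ℝ, EZ) 𝓘(ℝ, EM) p (c • z) :=
    hp.contMDiff_proj.mdifferentiable (by simp) _
  have h3 := mfderiv_comp z h2 h1
  have h4 : p ∘ (fun z : Z => c • z) = p := by
    funext z
    exact hp.proj_smul c z
  have h5 : ((mfderiv 𝓘(ℝ, EZ) 𝓘(ℝ, EM) (p ∘ fun z : Z => c • z) z : _) : EZ →L[ℝ] EM) =
      mfderiv 𝓘(ℝ, EZ) 𝓘(ℝ, EM) p z := by
    rw [h4]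
  exact (congrArg (fun L : EZ →L[ℝ] EM => L w) (h5.symm.trans h3)).symm

end Geometry

/-! ### Convolution of vector valued Fourier coefficients -/

section Convolution

variable {W₁ W₂ W₃ : Type*} [AddCommGroup W₁] [Module ℂ W₁] [AddCommGroup W₂] [Module ℂ W₂]
  [AddCommGroup W₃] [Module ℂ W₃] [Module.Finite ℂ W₁] [Module.Finite ℂ W₂]

/-- Expanding b in bases reduces the statement to finitely many scalar convolutions. Only the first
factor needs smoothness, since its Fourier series is the one that is expanded. -/
theorem hasWeakSum_convolution (b : W₁ →ₗ[ℂ] W₂ →ₗ[ℂ] W₃) {g₁ : ℝ → W₁} {g₂ : ℝ → W₂}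
    (hg₁ : ∀ l : Module.Dual ℂ W₁, ContDiff ℝ ∞ fun t => l (g₁ t))
    (hper : ∀ t, g₁ (t + 1) = g₁ t)
    (hg₂ : ∀ l : Module.Dual ℂ W₂, Continuous fun t => l (g₂ t)) {w₁ : ℤ → W₁} {w₂ : ℤ → W₂}
    {w₃ : W₃} {n : ℤ}
    (h₁ : ∀ m : ℤ, HasWeakIntegral (fun t => (rot t : ℂ) ^ m • g₁ t) (w₁ m))
    (h₂ : ∀ m : ℤ, HasWeakIntegral (fun t => (rot t : ℂ) ^ m • g₂ t) (w₂ m))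
    (h₃ : HasWeakIntegral (fun t => (rot t : ℂ) ^ n • b (g₁ t) (g₂ t)) w₃) :
    HasWeakSum (fun m => b (w₁ m) (w₂ (n - m))) w₃ := by
  intro l
  let b₁ := Module.finBasis ℂ W₁
  let b₂ := Module.finBasis ℂ W₂
  obtain ⟨κ, hb⟩ : ∃ κ : _ → _ → ℂ, ∀ x y,
      l (b x y) = ∑ i, ∑ j, b₁.coord i x * b₂.coord j y * κ i j := by
    refine ⟨fun i j => l (b (b₁ i) (b₂ j)), fun x y => ?_⟩
    have h4 := dual_eq_sum (l ∘ₗ b.flip y) x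
    simp only [LinearMap.comp_apply, LinearMap.flip_apply] at h4
    rw [h4]
    refine Finset.sum_congr rfl fun i _ => ?_
    have h5 := dual_eq_sum (l ∘ₗ b (b₁ i)) y
    simp only [LinearMap.comp_apply] at h5
    rw [h5, Finset.mul_sum]
    exact Finset.sum_congr rfl fun j _ => by ring
  have hw₃ : l w₃ = ∑ i, ∑ j, (∫ t in (0 : ℝ)..1, (rot t : ℂ) ^ n *
      (b₁.coord i (g₁ t) * b₂.coord j (g₂ t))) * κ i j := by
    rw [(h₃ l).2]
    have hc : ∀ i j, Continuous fun t => (rot t : ℂ) ^ n *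
        (b₁.coord i (g₁ t) * b₂.coord j (g₂ t)) * κ i j := fun i j =>
      ((continuous_rot_zpow n).mul ((hg₁ _).continuous.mul (hg₂ _))).mul continuous_const
    have hl : (fun t => l ((rot t : ℂ) ^ n • b (g₁ t) (g₂ t))) = fun t => ∑ i, ∑ j,
        (rot t : ℂ) ^ n * (b₁.coord i (g₁ t) * b₂.coord j (g₂ t)) * κ i j := by
      funext t
      rw [map_smul, hb, smul_eq_mul, Finset.mul_sum]
      refine Finset.sum_congr rfl fun i _ => ?_
      rw [Finset.mul_sum]
      exact Finset.sum_congr rfl fun j _ => (mul_assoc _ _ _).symm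
    rw [hl, intervalIntegral.integral_finsetSum fun i _ =>
      (continuous_finsetSum _ fun j _ => hc i j).intervalIntegrable _ _]
    refine Finset.sum_congr rfl fun i _ => ?_
    rw [intervalIntegral.integral_finsetSum fun j _ => (hc i j).intervalIntegrable _ _]
    exact Finset.sum_congr rfl fun j _ => intervalIntegral.integral_mul_const _ _
  rw [hw₃]
  simp_rw [hb]
  refine hasSum_sum fun i _ => hasSum_sum fun j _ => HasSum.mul_right _ ?_
  have h6 := hasSum_integral_rot_mul_mul (hg₁ (b₁.coord i)) (fun t => by rw [hper])
    (hg₂ (b₂.coord j)) n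
  have h7 : (fun m => b₁.coord i (w₁ m) * b₂.coord j (w₂ (n - m))) = fun m : ℤ =>
      (∫ t in (0 : ℝ)..1, (rot t : ℂ) ^ m * b₁.coord i (g₁ t)) *
        ∫ t in (0 : ℝ)..1, (rot t : ℂ) ^ (n - m) * b₂.coord j (g₂ t) := by
    funext m
    rw [(h₁ m (b₁.coord i)).2, (h₂ (n - m) (b₂.coord j)).2]
    simp only [map_smul, smul_eq_mul]
  rw [h7]
  exact h6

end Convolution

theorem RapidOn.congr {E : Type*} [NormedAddCommGroup E] [NormedSpace ℝ E] {V : Set E}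
    {u w : ℤ → E → ℂ} (hV : IsOpen V) (hu : RapidOn V u) (h : ∀ n, ∀ t ∈ V, w n t = u n t) :
    RapidOn V w := by
  refine ⟨fun n => (hu.1 n).congr (h n), fun K hK hKc j k => ?_⟩
  obtain ⟨C, hC⟩ := hu.2 K hK hKc j k
  refine ⟨C, fun n t ht => ?_⟩
  have h1 : w n =ᶠ[nhds t] u n := by
    filter_upwards [hV.mem_nhds (hK ht)] with x hx
    exact h n x hx
  rw [(h1.iteratedFDeriv ℝ j).eq_of_nhds]
  exact hC n t ht

/-! ### Framings -/

section Framing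

variable {EM E : Type*} [NormedAddCommGroup EM]
  [NormedAddCommGroup E] [NormedSpace ℝ E]
  {M N : Type*} [TopologicalSpace M] [ChartedSpace EM M] [TopologicalSpace N] [ChartedSpace E N]
  {F : N → Type*} [∀ y, AddCommGroup (F y)] [∀ y, Module ℂ (F y)]
  {W : Type*} [AddCommGroup W] [Module ℂ W] {W₀ : Type*} [AddCommGroup W₀] [Module ℂ W₀]

/-- The part of the chart of `N` at `y₀` that `q` maps to the chart of `M` at `x₀`. -/
def chartPreimage (E : Type*) [NormedAddCommGroup E] [NormedSpace ℝ E] [ChartedSpace E N]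
    (q : N → M) (y₀ : N) (x₀ : M) : Set E :=
  (chartAt E y₀).target ∩ (chartAt E y₀).symm ⁻¹' (q ⁻¹' (chartAt EM x₀).source)

variable (EM) in
/-- Trivializations `e y` of the spaces `F y` which become smooth when they are composed with the
transition maps `θ x₀ x` that describe the coordinates at `x` coming from the chart at `x₀`. -/
def IsFraming (q : N → M) (R : N → (∀ y, F y) →ₗ[ℂ] (E → W)) (e : ∀ y, F y ≃ₗ[ℂ] W₀)
    (θ : M → M → W₀ ≃ₗ[ℂ] W₀) : Prop :=
  ∀ (y₀ : N) (x₀ : M), ∃ (Θ : E → W₀ →ₗ[ℂ] W) (Θ' : E → W →ₗ[ℂ] W₀),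
    ∀ t ∈ chartPreimage (EM := EM) E q y₀ x₀,
      (∀ w, WSmoothAt E (fun t => Θ t w) t) ∧ (∀ w, WSmoothAt E (fun t => Θ' t w) t) ∧
      ∀ (u : ∀ y, F y) (y : N), y = (chartAt E y₀).symm t →
        R y₀ u t = Θ t (θ x₀ (q y) (e y (u y))) ∧ θ x₀ (q y) (e y (u y)) = Θ' t (R y₀ u t)

theorem isOpen_chartPreimage {q : N → M} (hq : Continuous q) (y₀ : N) (x₀ : M) :
    IsOpen (chartPreimage (EM := EM) E q y₀ x₀) :=
  (chartAt E y₀).symm.isOpen_inter_preimage ((chartAt EM x₀).open_source.preimage hq)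

variable [IsManifold 𝓘(ℝ, E) ∞ N] {q : N → M} {R : N → (∀ y, F y) →ₗ[ℂ] (E → W)}
  {e : ∀ y, F y ≃ₗ[ℂ] W₀} {θ : M → M → W₀ ≃ₗ[ℂ] W₀}

theorem contMDiffAt_chart (y₀ y : N) (hy : y ∈ (chartAt E y₀).source) :
    ContMDiffAt 𝓘(ℝ, E) 𝓘(ℝ, E) ∞ (chartAt E y₀) y :=
  contMDiffOn_chart.contMDiffAt ((chartAt E y₀).open_source.mem_nhds hy)

theorem contMDiffAt_chart_symm (y₀ : N) (t : E) (ht : t ∈ (chartAt E y₀).target) :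
    ContMDiffAt 𝓘(ℝ, E) 𝓘(ℝ, E) ∞ (chartAt E y₀).symm t :=
  contMDiffOn_chart_symm.contMDiffAt ((chartAt E y₀).open_target.mem_nhds ht)

/-- The twist by θ is unavoidable: tangent spaces of M at x are copies of `EM` through the preferred
chart at x, which may jump with x. The map θ x₀ x passes to the fixed chart at x₀. It depends on
base points only, hence is constant along each fibre and does not interfere with Fourier
coefficients. -/
theorem IsFraming.wSmoothAt [Module.Finite ℂ W] (h : IsFraming EM q R e θ) (hq : Continuous q)
    {u : ∀ y, F y} (hu : u ∈ smoothFields R) {x₀ : M} {y : N} (hy : q y ∈ (chartAt EM x₀).source) :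
    WSmoothAt E (fun y => θ x₀ (q y) (e y (u y))) y := by
  obtain ⟨Θ, Θ', hΘ⟩ := h y x₀
  have hys := mem_chart_source E y
  have hyt : chartAt E y y ∈ chartPreimage (EM := EM) E q y x₀ := by
    refine ⟨(chartAt E y).map_source hys, ?_⟩
    rw [Set.mem_preimage, (chartAt E y).left_inv hys]
    exact hy
  have h1 : WSmoothAt E (fun t => R y u t) (chartAt E y y) := fun l => by
    rw [contMDiffAt_iff_contDiffAt]
    exact (hu y l).contDiffAt ((chartAt E y).open_target.mem_nhds hyt.1)
  have h2 : WSmoothAt E (fun t => Θ' t (R y u t)) (chartAt E y y) :=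
    WSmoothAt.apply (hΘ _ hyt).2.1 h1
  refine (h2.comp (contMDiffAt_chart y y hys)).congr ?_
  filter_upwards [(chartAt E y).open_source.mem_nhds hys,
    ((chartAt EM x₀).open_source.preimage hq).mem_nhds hy] with y' hy' hy''
  refine ((hΘ _ ⟨(chartAt E y).map_source hy', ?_⟩).2.2 u y' ?_).2
  · rw [Set.mem_preimage, (chartAt E y).left_inv hy']
    exact hy''
  · exact ((chartAt E y).left_inv hy').symm

/-- The converse passage. Since smoothness is local, at each point the chart of M centred at its own
image may be used. -/
theorem IsFraming.mem_smoothFields [Module.Finite ℂ W₀] (h : IsFraming EM q R e θ)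
    (hq : Continuous q) {u : ∀ y, F y}
    (hu : ∀ y₀, WSmoothAt E (fun y => θ (q y₀) (q y) (e y (u y))) y₀) :
    u ∈ smoothFields R := by
  intro y₀ l t ht
  let y := (chartAt E y₀).symm t
  obtain ⟨Θ, Θ', hΘ⟩ := h y₀ (q y)
  have hyt : t ∈ chartPreimage (EM := EM) E q y₀ (q y) := ⟨ht, mem_chart_source EM (q y)⟩
  have h1 := (hu y).comp (x := t) (contMDiffAt_chart_symm y₀ t ht)
  have h2 := (WSmoothAt.apply (hΘ t hyt).1 h1) l
  rw [contMDiffAt_iff_contDiffAt] at h2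
  refine ContDiffAt.contDiffWithinAt (h2.congr_of_eventuallyEq ?_)
  filter_upwards [(isOpen_chartPreimage hq y₀ (q y)).mem_nhds hyt] with t' ht'
  exact congrArg l ((hΘ t' ht').2.2 u _ rfl).1

end Framing

/-! ### Fourier coefficients along the orbits of the circle -/

section Orbits

variable {Z : Type*} [MulAction Circle Z] {W₀ : Type*} [AddCommGroup W₀] [Module ℂ W₀]

/-- `g` is smooth along the orbits of the circle. -/
def OrbitSmooth (g : Z → W₀) : Prop :=
  ∀ (z : Z) (l : Module.Dual ℂ W₀), ContDiff ℝ ∞ fun t : ℝ => l (g (rot t • z))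

/-- The Fourier coefficients of `g` along the orbits of the circle. -/
def orbitCoeff (g : Z → W₀) (n : ℤ) (z : Z) : W₀ :=
  Classical.epsilon (HasWeakIntegral fun t => (rot t : ℂ) ^ n • g (rot t • z))

variable {g : Z → W₀}

theorem rot_add_one_smul (t : ℝ) (z : Z) : rot (t + 1) • z = rot t • z := by
  rw [rot_add, rot_one, mul_one]

theorem OrbitSmooth.continuous (hg : OrbitSmooth g) (z : Z) (n : ℤ) (l : Module.Dual ℂ W₀) :
    Continuous fun t => l ((rot t : ℂ) ^ n • g (rot t • z)) := by
  simp only [map_smul, smul_eq_mul]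
  exact (continuous_rot_zpow n).mul (hg z l).continuous

theorem hasWeakIntegral_orbitCoeff [Module.Finite ℂ W₀] (hg : OrbitSmooth g) (n : ℤ) (z : Z) :
    HasWeakIntegral (fun t => (rot t : ℂ) ^ n • g (rot t • z)) (orbitCoeff g n z) :=
  Classical.epsilon_spec (exists_hasWeakIntegral fun l => hg.continuous z n l)

/-- Translate the variable of integration by the angle of c and use periodicity. The factor c⁻ⁿ is
the equivariance that characterizes values in the n-th power of L. -/
theorem orbitCoeff_smul [Module.Finite ℂ W₀] (hg : OrbitSmooth g) (n : ℤ) (c : Circle) (z : Z) :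
    orbitCoeff g n (c • z) = (c : ℂ) ^ (-n) • orbitCoeff g n z := by
  obtain ⟨a, rfl⟩ := rot_surjective c
  refine eq_of_forall_dual fun l => ?_
  let f : ℝ → ℂ := fun t => (rot t : ℂ) ^ n * l (g (rot t • z))
  have hf : Function.Periodic f 1 := fun t => by
    simp only [f, rot_add, rot_one, mul_one]
  rw [(hasWeakIntegral_orbitCoeff hg n (rot a • z) l).2, map_smul,
    (hasWeakIntegral_orbitCoeff hg n z l).2]
  have h1 : ∀ t, l ((rot t : ℂ) ^ n • g (rot t • rot a • z)) = (rot a : ℂ) ^ (-n) * f (t + a) := by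
    intro t
    simp only [f, map_smul, smul_eq_mul, smul_smul, ← rot_add]
    rw [rot_add, Circle.coe_mul, mul_zpow, zpow_neg]
    field_simp
  simp_rw [h1]
  rw [intervalIntegral.integral_const_mul, intervalIntegral.integral_comp_add_right, zero_add,
    add_comm 1 a, hf.intervalIntegral_add_eq a 0, zero_add]
  simp only [f, map_smul, smul_eq_mul]

/-- Fourier inversion along the orbit of z, evaluated at time 0. -/
theorem hasWeakSum_orbitCoeff [Module.Finite ℂ W₀] (hg : OrbitSmooth g) (z : Z) :
    HasWeakSum (fun n => orbitCoeff g n z) (g z) := by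
  intro l
  have h := hasSum_integral_rot_mul_rot (hg z l) (fun s => by rw [rot_add_one_smul]) 0
  rw [rot_zero, one_smul] at h
  convert h using 2 with n
  rw [(hasWeakIntegral_orbitCoeff hg n z l).2]
  simp

end Orbits

/-! ### The Fourier isomorphism -/

section Transport

variable {EM EZ E : Type*} [NormedAddCommGroup EM] [NormedSpace ℝ EM]
  [NormedAddCommGroup EZ] [NormedSpace ℝ EZ] [NormedAddCommGroup E] [NormedSpace ℝ E]
  {M Z N : Type*} [TopologicalSpace M] [ChartedSpace EM M]
  [TopologicalSpace Z] [ChartedSpace EZ Z] [MulAction Circle Z]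
  [TopologicalSpace N] [ChartedSpace E N]
  {p : Z → M} {q : N → M}
  {FZ : Z → Type*} [∀ y, AddCommGroup (FZ y)] [∀ y, Module ℂ (FZ y)]
  {FN : N → Type*} [∀ y, AddCommGroup (FN y)] [∀ y, Module ℂ (FN y)]
  {WZ : Type*} [AddCommGroup WZ] [Module ℂ WZ]
  {WN : Type*} [AddCommGroup WN] [Module ℂ WN]
  {W₀ : Type*} [AddCommGroup W₀] [Module ℂ W₀]
  {RZ : Z → (∀ y, FZ y) →ₗ[ℂ] (EZ → WZ)} {RN : N → (∀ y, FN y) →ₗ[ℂ] (E → WN)}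
  {eZ : ∀ y, FZ y ≃ₗ[ℂ] W₀} {eN : ∀ y, FN y ≃ₗ[ℂ] W₀} {θ : M → M → W₀ ≃ₗ[ℂ] W₀}

/-- Invariance of an exotic field in the fibre directions of `q`, with respect to the
trivializations `eN`. -/
def IsFibreInvariant (eN : ∀ y, FN y ≃ₗ[ℂ] W₀) (u : ℤ → ∀ y : N, Fib p (q y) → FN y) : Prop :=
  ∀ (n : ℤ) (y y' : N) (z : Fib p (q y)) (z' : Fib p (q y')), z'.1 = z.1 →
    eN y' (u n y' z') = eN y (u n y z)

/-- The map `q` is a smooth surjection with smooth local sections. -/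
structure HasLocalSections (EM E : Type*) [NormedAddCommGroup EM] [NormedSpace ℝ EM]
    [NormedAddCommGroup E] [NormedSpace ℝ E] [ChartedSpace EM M] [ChartedSpace E N]
    (q : N → M) : Prop where
  contMDiff : ContMDiff 𝓘(ℝ, E) 𝓘(ℝ, EM) ∞ q
  surjective : Function.Surjective q
  exists_section : ∀ y, ∃ σ : M → N, σ (q y) = y ∧ ContMDiffAt 𝓘(ℝ, EM) 𝓘(ℝ, E) ∞ σ (q y) ∧
    ∀ᶠ x in nhds (q y), q (σ x) = x

theorem IsPrincipalCircleBundle.hasLocalSections (hp : IsPrincipalCircleBundle EM EZ p) :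
    HasLocalSections EM EZ p :=
  ⟨hp.contMDiff_proj, hp.surjective, fun z => by
    obtain ⟨U, σ, -, hU, hx, hσ, hσz, -⟩ := hp.exists_local_coordinate z
    exact ⟨σ, hσz, hσ.smooth.contMDiffAt (hU.mem_nhds hx), by
      filter_upwards [hU.mem_nhds hx] with x hx
      exact hσ.right_inv x hx⟩⟩

theorem hasLocalSections_id : HasLocalSections EM EM (fun x : M => x) :=
  ⟨contMDiff_id, fun x => ⟨x, rfl⟩, fun _ => ⟨id, rfl, contMDiffAt_id,
    Filter.Eventually.of_forall fun _ => rfl⟩⟩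

theorem along_apply {σ : M → Z} {u : ∀ y : N, Fib p (q y) → FN y} {y : N}
    (h : p (σ (q y)) = q y) : along p σ u y = u y ⟨σ (q y), h⟩ := by
  simp [along, h]

variable [IsManifold 𝓘(ℝ, EZ) ∞ Z] [IsManifold 𝓘(ℝ, E) ∞ N]
  [Module.Finite ℂ WZ] [Module.Finite ℂ WN] [Module.Finite ℂ W₀]

/-- All points of an orbit lie over one x, so the same θ x x applies throughout and can be removed
by its inverse. -/
theorem IsFraming.orbitSmooth (hp : IsPrincipalCircleBundle EM EZ p) (hZ : IsFraming EM p RZ eZ θ)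
    {η : ∀ z, FZ z} (hη : η ∈ smoothFields RZ) : OrbitSmooth fun z => eZ z (η z) := by
  intro z
  have h1 : ∀ t : ℝ, WSmoothAt ℝ (fun t : ℝ => eZ (rot t • z) (η (rot t • z))) t := by
    intro t
    have h2 := hZ.wSmoothAt hp.contMDiff_proj.continuous hη (x₀ := p z) (y := rot t • z)
      (by rw [hp.proj_smul]; exact mem_chart_source EM (p z))
    have h3 := h2.comp (x := t) (((contMDiff_smul_const hp z).comp contMDiff_rot).contMDiffAt)
    simp only [Function.comp_def, hp.proj_smul] at h3
    exact h3.comp_equiv (θ (p z) (p z))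
  intro l
  rw [contDiff_iff_contDiffAt]
  intro t
  rw [← contMDiffAt_iff_contDiffAt]
  exact h1 t l

/-- The exotic field given by the Fourier coefficients of a smooth field. -/
def fourierField (q : N → M) (eZ : ∀ y, FZ y ≃ₗ[ℂ] W₀) (eN : ∀ y, FN y ≃ₗ[ℂ] W₀)
    (η : ∀ z, FZ z) (n : ℤ) (y : N) (z : Fib p (q y)) : FN y :=
  (eN y).symm (orbitCoeff (fun z => eZ z (η z)) n z.1)

/-- In the frame given by σ, the n-th component is the n-th Fourier coefficient, in s, of one smooth
periodic family, the field at e^{2πis} σ(x). The decay of Fourier coefficients then applies. -/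
theorem IsFraming.fourierField_mem (hp : IsPrincipalCircleBundle EM EZ p)
    (hq : ContMDiff 𝓘(ℝ, E) 𝓘(ℝ, EM) ∞ q) [FiniteDimensional ℝ E]
    (hZ : IsFraming EM p RZ eZ θ) (hN : IsFraming EM q RN eN θ) {η : ∀ z, FZ z}
    (hη : η ∈ smoothFields RZ) :
    fourierField q eZ eN η ∈ completedSum EM EZ p RN := by
  let g : Z → W₀ := fun z => eZ z (η z)
  have hg : OrbitSmooth g := hZ.orbitSmooth hp hη
  refine ⟨fun n y z z' c hz => ?_, fun U σ hU hσ y₀ l V hVU hV => ?_⟩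
  · rw [fourierField, fourierField, hz]
    exact (congrArg _ (orbitCoeff_smul hg n c z.1)).trans (map_smul _ _ _)
  let Y : E → N := (chartAt E y₀).symm
  let F : E × ℝ → ℂ := fun a =>
    l (RN y₀ (fun y => (eN y).symm (g (rot a.2 • σ (q y)))) a.1)
  -- The chart expression at t is a linear function of the framed value at the point with
  -- coordinates t. Hence it commutes with the integral over the circle.
  have hRN : ∀ t ∈ V, ∃ L : W₀ →ₗ[ℂ] WN, ∀ u : ∀ y, FN y, RN y₀ u t = L (eN (Y t) (u (Y t))) := by
    intro t ht
    obtain ⟨Θ, Θ', hΘ⟩ := hN y₀ (q (Y t))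
    have h1 := hΘ t ⟨(hVU ht).1, mem_chart_source EM (q (Y t))⟩
    exact ⟨Θ t ∘ₗ (θ (q (Y t)) (q (Y t))).toLinearMap, fun u => (h1.2.2 u _ rfl).1⟩
  have hF : ContDiffOn ℝ ∞ F (V ×ˢ Set.univ) := by
    rintro ⟨t₀, s₀⟩ ⟨ht₀, -⟩
    let x₀ := q (Y t₀)
    obtain ⟨Θ, Θ', hΘ⟩ := hN y₀ x₀
    have ht₀' : t₀ ∈ chartPreimage (EM := EM) E q y₀ x₀ :=
      ⟨(hVU ht₀).1, mem_chart_source EM x₀⟩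
    have hY : ContMDiffAt 𝓘(ℝ, E × ℝ) 𝓘(ℝ, EM) ∞ (fun a : E × ℝ => q (Y a.1)) (t₀, s₀) :=
      hq.contMDiffAt.comp (t₀, s₀) ((contMDiffAt_chart_symm y₀ t₀ (hVU ht₀).1).comp (t₀, s₀)
        contDiff_fst.contMDiff.contMDiffAt)
    have hσt : ContMDiffAt 𝓘(ℝ, EM) 𝓘(ℝ, EZ) ∞ σ x₀ :=
      hσ.smooth.contMDiffAt (hU.mem_nhds (hVU ht₀).2)
    have hmap : ContMDiffAt 𝓘(ℝ, E × ℝ) 𝓘(ℝ, EZ) ∞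
        (fun a : E × ℝ => rot a.2 • σ (q (Y a.1))) (t₀, s₀) :=
      ContMDiffAt.comp (t₀, s₀) (g := fun a : Circle × Z => a.1 • a.2)
        (f := fun a : E × ℝ => (rot a.2, σ (q (Y a.1)))) hp.contMDiff_smul.contMDiffAt
        ((ContMDiffAt.comp (t₀, s₀) (g := rot) (f := fun a : E × ℝ => a.2)
          contMDiff_rot.contMDiffAt contDiff_snd.contMDiff.contMDiffAt).prodMk
          (ContMDiffAt.comp (t₀, s₀) (g := σ) hσt hY))
    have hpσ : p (rot s₀ • σ (q (Y t₀))) = x₀ := by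
      rw [hp.proj_smul, hσ.right_inv _ (hVU ht₀).2]
    have h1 := (hZ.wSmoothAt hp.contMDiff_proj.continuous hη (x₀ := x₀)
      (y := rot s₀ • σ (q (Y t₀))) (by rw [hpσ]; exact mem_chart_source EM x₀)).comp
      (x := (t₀, s₀)) hmap
    have h2 := WSmoothAt.apply (Θ := fun a : E × ℝ => Θ a.1) (y := (t₀, s₀))
      (fun w => ((hΘ t₀ ht₀').1 w).comp (g := Prod.fst) (x := (t₀, s₀))
        contDiff_fst.contMDiff.contMDiffAt) h1 l
    rw [contMDiffAt_iff_contDiffAt] at h2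
    refine (h2.congr_of_eventuallyEq ?_).contDiffWithinAt
    have hO : IsOpen ((V ∩ chartPreimage (EM := EM) E q y₀ x₀) ×ˢ (Set.univ : Set ℝ)) :=
      (hV.inter (isOpen_chartPreimage hq.continuous y₀ x₀)).prod isOpen_univ
    filter_upwards [hO.mem_nhds (x := (t₀, s₀)) ⟨⟨ht₀, ht₀'⟩, Set.mem_univ _⟩] with a ha
    refine congrArg l (((hΘ a.1 ha.1.2).2.2 _ (Y a.1) rfl).1.trans ?_)
    rw [LinearEquiv.apply_symm_apply, hp.proj_smul, hσ.right_inv _ (hVU ha.1.1).2]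
  have hper : ∀ t ∈ V, ∀ s, F (t, s + 1) = F (t, s) := fun t _ s => by
    simp only [F, rot_add_one_smul]
  refine (rapidOn_integral hV hF hper).congr hV fun n t ht => ?_
  obtain ⟨L, hL⟩ := hRN t ht
  have hσt : p (σ (q (Y t))) = q (Y t) := hσ.right_inv _ (hVU ht).2
  rw [hL, along_apply hσt, fourierField, LinearEquiv.apply_symm_apply]
  have h3 := (hasWeakIntegral_orbitCoeff hg n (σ (q (Y t))) (l ∘ₗ L)).2
  rw [LinearMap.comp_apply] at h3
  rw [h3]
  refine intervalIntegral.integral_congr fun s _ => ?_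
  simp only [F, hL, LinearEquiv.apply_symm_apply, map_smul, LinearMap.comp_apply, smul_eq_mul]

/-- Rapidly decreasing invariant exotic fields are Fourier coefficients: local form. -/
theorem IsFraming.exists_local_sum (hp : IsPrincipalCircleBundle EM EZ p)
    (hq : HasLocalSections EM E q) [FiniteDimensional ℝ E] (hN : IsFraming EM q RN eN θ)
    {u : ℤ → ∀ y : N, Fib p (q y) → FN y} (hu : u ∈ completedSum EM EZ p RN)
    {h : ℤ → Z → W₀} (hh : ∀ n y (z : Fib p (q y)), eN y (u n y z) = h n z.1)
    (hequi : ∀ n (c : Circle) z, h n (c • z) = (c : ℂ) ^ (-n) • h n z) (z₀ : Z) :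
    ∃ G : Z → W₀, WSmoothAt EZ G z₀ ∧
      ∀ᶠ z in nhds z₀, HasWeakSum (fun n => θ (p z₀) (p z) (h n z)) (G z) := by
  obtain ⟨U, σ, s, hU, hx₀, hσ, hσz, hs₀, hs, hz⟩ := hp.exists_local_coordinate z₀
  let x₀ := p z₀
  obtain ⟨y₀, hy₀⟩ := hq.surjective x₀
  obtain ⟨σN, hσN₀, hσN, hσN'⟩ := hq.exists_section y₀
  rw [hy₀] at hσN₀ hσN hσN'
  let χ := chartAt E y₀
  obtain ⟨Θ, Θ', hΘ⟩ := hN y₀ x₀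
  -- Coordinates of points over which the section σ, the chart of M and the framing are all
  -- available.
  let V : Set E := χ.target ∩ χ.symm ⁻¹' (q ⁻¹' (U ∩ (chartAt EM x₀).source))
  have hV : IsOpen V := χ.symm.isOpen_inter_preimage
    ((hU.inter (chartAt EM x₀).open_source).preimage hq.contMDiff.continuous)
  have hVU : V ⊆ χ.target ∩ χ.symm ⁻¹' (q ⁻¹' U) := fun t ht => ⟨ht.1, ht.2.1⟩
  have hVΘ : V ⊆ chartPreimage (EM := EM) E q y₀ x₀ := fun t ht => ⟨ht.1, ht.2.2⟩
  have hrapid := fun l : Module.Dual ℂ WN => hu.2 U σ hU hσ y₀ l V hVU hV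
  have hw : ∀ a : E × ℝ, ∃ w, a ∈ V ×ˢ (Set.univ : Set ℝ) →
      HasWeakSum (fun n => (rot a.2 : ℂ) ^ (-n) • RN y₀ (along p σ (u n)) a.1) w := by
    intro a
    by_cases ha : a ∈ V ×ˢ (Set.univ : Set ℝ)
    · obtain ⟨w, hw⟩ := exists_hasWeakSum
        (f := fun n => (rot a.2 : ℂ) ^ (-n) • RN y₀ (along p σ (u n)) a.1) (fun l => by
          simp only [map_smul, smul_eq_mul]
          simpa only [mul_comm] using (hrapid l).summable ha.1 a.2)
      exact ⟨w, fun _ => hw⟩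
    · exact ⟨0, fun h => absurd h ha⟩
  choose w hw using hw
  have hO : IsOpen (V ×ˢ (Set.univ : Set ℝ)) := hV.prod isOpen_univ
  have hwsm : ∀ a ∈ V ×ˢ (Set.univ : Set ℝ), WSmoothAt (E × ℝ) w a := by
    intro a ha l
    rw [contMDiffAt_iff_contDiffAt]
    refine ContDiffAt.congr_of_eventuallyEq
      (((hrapid l).contDiffOn_tsum hV).contDiffAt (hO.mem_nhds ha)) ?_
    filter_upwards [hO.mem_nhds ha] with b hb
    rw [← (hw b hb l).tsum_eq]
    refine tsum_congr fun n => ?_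
    rw [map_smul, smul_eq_mul, mul_comm]
  -- A point of Z is given coordinates on N by lifting its base point with a local section of q. By
  -- fibre invariance the choice of the lift does not matter.
  let T : Z → E := fun z => χ (σN (p z))
  have hpz : ContMDiffAt 𝓘(ℝ, EZ) 𝓘(ℝ, EM) ∞ p z₀ := hp.contMDiff_proj.contMDiffAt
  have hσNp : ContMDiffAt 𝓘(ℝ, EZ) 𝓘(ℝ, E) ∞ (fun z => σN (p z)) z₀ :=
    ContMDiffAt.comp z₀ (g := σN) hσN hpz
  have hy₀s : σN (p z₀) ∈ χ.source := by
    rw [hσN₀]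
    exact mem_chart_source E y₀
  have hT : ContMDiffAt 𝓘(ℝ, EZ) 𝓘(ℝ, E) ∞ T z₀ :=
    ContMDiffAt.comp z₀ (g := χ) (contMDiffAt_chart y₀ _ hy₀s) hσNp
  have hgood : ∀ᶠ z in nhds z₀, T z ∈ V ∧ χ.symm (T z) = σN (p z) ∧ q (σN (p z)) = p z ∧
      p z ∈ U := by
    filter_upwards [hpz.continuousAt.eventually hσN',
      hpz.continuousAt.eventually (hU.mem_nhds hx₀),
      hpz.continuousAt.eventually ((chartAt EM x₀).open_source.mem_nhds (mem_chart_source EM x₀)),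
      hσNp.continuousAt.eventually (χ.open_source.mem_nhds hy₀s)] with z h1 h2 h3 h4
    have h5 : χ.symm (T z) = σN (p z) := χ.left_inv h4
    refine ⟨⟨χ.map_source h4, ?_⟩, h5, h1, h2⟩
    rw [Set.mem_preimage, h5, Set.mem_preimage, h1]
    exact ⟨h2, h3⟩
  -- With z = e^{2πi s(z)} σ(p z), equivariance gives h n z = e^{-2πi n s(z)} h n (σ(p z)). So the
  -- sum at z is the series w at (T z, s z), returned to the frame by Θ'.
  refine ⟨fun z => Θ' (T z) (w (T z, s z)), ?_, ?_⟩
  · have hT₀ : T z₀ ∈ V := hgood.self_of_nhds.1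
    refine WSmoothAt.apply (Θ := fun z => Θ' (T z)) (fun w' => ?_) ?_
    · exact ((hΘ _ (hVΘ hT₀)).2.1 w').comp (g := T) hT
    · exact (hwsm (T z₀, s z₀) ⟨hT₀, Set.mem_univ _⟩).comp (g := fun z => (T z, s z))
        (hT.prodMk_space hs)
  · filter_upwards [hgood] with z hz'
    obtain ⟨h1, h2, h3, h4⟩ := hz'
    have h5 := (hw (T z, s z) ⟨h1, Set.mem_univ _⟩).map (Θ' (T z))
    have h6 : ∀ n, Θ' (T z) ((rot (s z) : ℂ) ^ (-n) • RN y₀ (along p σ (u n)) (T z)) =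
        θ (p z₀) (p z) (h n z) := by
      intro n
      have h7 := ((hΘ _ (hVΘ h1)).2.2 (along p σ (u n)) (σN (p z)) h2.symm).2
      have h8 : p (σ (q (σN (p z)))) = q (σN (p z)) := by
        rw [h3]
        exact hσ.right_inv _ h4
      rw [map_smul, ← h7, along_apply h8, hh, ← map_smul, ← hequi]
      simp only [h3]
      rw [← hz z h4]
    simp only [h6] at h5
    exact h5

/-- `Ξ` takes a field on the circle bundle to its Fourier coefficients along the fibres. -/
def IsFourierTransform {q : N → M} (eZ : ∀ y, FZ y ≃ₗ[ℂ] W₀) (eN : ∀ y, FN y ≃ₗ[ℂ] W₀)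
    {S : Submodule ℂ (ℤ → ∀ y : N, Fib p (q y) → FN y)} (Ξ : smoothFields RZ ≃ₗ[ℂ] S) : Prop :=
  (∀ η n y (z : Fib p (q y)), HasWeakIntegral
    (fun t => (rot t : ℂ) ^ n • eZ (rot t • z.1) (η.1 (rot t • z.1)))
    (eN y ((Ξ η).1 n y z))) ∧
  ∀ η y (z : Fib p (q y)), HasWeakSum (fun n => eN y ((Ξ η).1 n y z)) (eZ z.1 (η.1 z.1))

/-- Smooth fields on the circle bundle are the same as completed sums of invariant exotic
fields, by Fourier expansion along the fibres. -/
theorem IsFraming.exists_transport (hp : IsPrincipalCircleBundle EM EZ p)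
    (hq : HasLocalSections EM E q) [FiniteDimensional ℝ E]
    (hZ : IsFraming EM p RZ eZ θ) (hN : IsFraming EM q RN eN θ)
    (S : Submodule ℂ (ℤ → ∀ y : N, Fib p (q y) → FN y))
    (hS : ∀ u, u ∈ S ↔ u ∈ completedSum EM EZ p RN ∧ IsFibreInvariant eN u) :
    ∃ Ξ : smoothFields RZ ≃ₗ[ℂ] S, IsFourierTransform eZ eN Ξ := by
  have hmem : ∀ η : smoothFields RZ, fourierField q eZ eN η.1 ∈ S := fun η =>
    (hS _).2 ⟨hZ.fourierField_mem hp hq.contMDiff hN η.2, fun n y y' z z' hz => by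
      simp only [fourierField, LinearEquiv.apply_symm_apply, hz]⟩
  have hint : ∀ (η : smoothFields RZ) n y (z : Fib p (q y)), HasWeakIntegral
      (fun t => (rot t : ℂ) ^ n • eZ (rot t • z.1) (η.1 (rot t • z.1)))
      (eN y (fourierField q eZ eN η.1 n y z)) := fun η n y z => by
    rw [fourierField, LinearEquiv.apply_symm_apply]
    exact hasWeakIntegral_orbitCoeff (hZ.orbitSmooth hp η.2) n z.1
  have hsum : ∀ (η : smoothFields RZ) y (z : Fib p (q y)),
      HasWeakSum (fun n => eN y (fourierField q eZ eN η.1 n y z)) (eZ z.1 (η.1 z.1)) :=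
    fun η y z => by
      simp only [fourierField, LinearEquiv.apply_symm_apply]
      exact hasWeakSum_orbitCoeff (hZ.orbitSmooth hp η.2) z.1
  let Λ : smoothFields RZ →ₗ[ℂ] S :=
    { toFun := fun η => ⟨fourierField q eZ eN η.1, hmem η⟩
      map_add' := fun η η' => by
        refine Subtype.ext (funext fun n => funext fun y => funext fun z => (eN y).injective ?_)
        have h := (hint η n y z).add (hint η' n y z)
        refine (hint (η + η') n y z).unique ?_
        have h' : eN y ((fourierField q eZ eN η.1 + fourierField q eZ eN η'.1 :
            ℤ → ∀ y : N, Fib p (q y) → FN y) n y z) =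
          eN y (fourierField q eZ eN η.1 n y z) + eN y (fourierField q eZ eN η'.1 n y z) :=
          map_add _ _ _
        refine h' ▸ ?_
        simpa using h
      map_smul' := fun r η => by
        refine Subtype.ext (funext fun n => funext fun y => funext fun z => (eN y).injective ?_)
        have h := (hint η n y z).map (r • LinearMap.id)
        refine (hint (r • η) n y z).unique ?_
        have h' : eN y ((r • fourierField q eZ eN η.1 :
            ℤ → ∀ y : N, Fib p (q y) → FN y) n y z) =
          r • eN y (fourierField q eZ eN η.1 n y z) := map_smul _ _ _
        refine h' ▸ ?_
        simpa [smul_comm r] using h }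
  -- A field is the sum of its Fourier components, so it vanishes when they all do.
  have hinj : Function.Injective Λ := by
    rw [← LinearMap.ker_eq_bot, LinearMap.ker_eq_bot']
    intro η hη
    refine Subtype.ext (funext fun z => (eZ z).injective ?_)
    obtain ⟨y, hy⟩ := hq.surjective (p z)
    have h1 := hsum η y ⟨z, hy.symm⟩
    have h2 : ∀ n, fourierField q eZ eN η.1 n y ⟨z, hy.symm⟩ = 0 := fun n =>
      congrFun (congrFun (congrFun (congrArg Subtype.val hη) n) y) ⟨z, hy.symm⟩
    simp only [h2, map_zero] at h1
    refine (h1.unique fun l => ?_).trans (map_zero (eZ z)).symm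
    simp
  have hsurj : Function.Surjective Λ := by
    rintro ⟨u, hu⟩
    obtain ⟨huc, hinv⟩ := (hS u).1 hu
    -- Fibre invariance lets the components descend to functions h n on Z; any choice of points over
    -- M gives the same values.
    choose Y hY using hq.surjective
    let h : ℤ → Z → W₀ := fun n z => eN (Y (p z)) (u n (Y (p z)) ⟨z, (hY (p z)).symm⟩)
    have hh : ∀ n y (z : Fib p (q y)), eN y (u n y z) = h n z.1 := fun n y z =>
      hinv n _ y ⟨z.1, (hY _).symm⟩ z rfl
    have hequi : ∀ n (c : Circle) z, h n (c • z) = (c : ℂ) ^ (-n) • h n z := by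
      intro n c z
      have h1 := huc.1 n (Y (p z)) ⟨z, (hY _).symm⟩
        ⟨c • z, (hp.proj_smul c z).trans (hY _).symm⟩ c rfl
      rw [← hh n (Y (p z)) ⟨c • z, (hp.proj_smul c z).trans (hY _).symm⟩, h1, map_smul]
    have hloc := hN.exists_local_sum hp hq huc hh hequi
    have hg : ∀ z, ∃ w, HasWeakSum (fun n => h n z) w := fun z => by
      obtain ⟨G, -, hG⟩ := hloc z
      refine ⟨(θ (p z) (p z)).symm (G z), ?_⟩
      simpa using (hG.self_of_nhds).map (θ (p z) (p z)).symm.toLinearMap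
    choose g hg using hg
    have hη : (fun z => (eZ z).symm (g z)) ∈ smoothFields RZ := by
      refine hZ.mem_smoothFields hp.contMDiff_proj.continuous fun z₀ => ?_
      obtain ⟨G, hG, hG'⟩ := hloc z₀
      refine hG.congr ?_
      filter_upwards [hG'] with z hz
      rw [LinearEquiv.apply_symm_apply]
      exact ((hg z).map (θ (p z₀) (p z)).toLinearMap).unique hz
    refine ⟨⟨_, hη⟩, Subtype.ext (funext fun n => funext fun y => funext fun z =>
      (eN y).injective ?_)⟩
    refine (hint ⟨_, hη⟩ n y z).unique fun l => ⟨?_, ?_⟩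
    · exact (hint ⟨_, hη⟩ n y z l).1
    -- By equivariance, the series defining g along the orbit of z is a Fourier series with
    -- coefficients h m z. Uniqueness of coefficients recovers the given family.
    · have h1 : ∀ s, HasSum (fun m => l (h m z.1) * (rot s : ℂ) ^ (-m)) (l (g (rot s • z.1))) := by
        intro s
        have h2 := hg (rot s • z.1) l
        simp only [hequi, map_smul, smul_eq_mul] at h2
        simpa only [mul_comm] using h2
      have h3 := integral_rot_mul_of_hasSum (summable_norm_iff.2 (hg z.1 l).summable) h1 n
      rw [hh, ← h3]
      simp only [LinearEquiv.apply_symm_apply, map_smul, smul_eq_mul]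
  exact ⟨LinearEquiv.ofBijective Λ ⟨hinj, hsurj⟩, hint, hsum⟩

end Transport

/-! ### Framings of forms, generalized vectors and functions -/

section LinearFraming

variable {EM E : Type*} [NormedAddCommGroup EM] [NormedSpace ℝ EM]
  [NormedAddCommGroup E] [NormedSpace ℝ E]
  {M N : Type*} [TopologicalSpace M] [ChartedSpace EM M] [TopologicalSpace N] [ChartedSpace E N]
  {q : N → M}

open Classical in
/-- The derivative at `x` of the chart at `x₀` (and the identity outside of the chart). -/
def chartEquiv (EM : Type*) [NormedAddCommGroup EM] [NormedSpace ℝ EM] [ChartedSpace EM M]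
    [IsManifold 𝓘(ℝ, EM) ∞ M] (x₀ x : M) : EM ≃ₗ[ℝ] EM :=
  if h : x ∈ (chartAt EM x₀).source then
    ((mdifferentiable_chart (I := 𝓘(ℝ, EM)) x₀).mfderiv h).toLinearEquiv
  else LinearEquiv.refl ℝ EM

theorem chartEquiv_apply [IsManifold 𝓘(ℝ, EM) ∞ M] {x₀ x : M} (h : x ∈ (chartAt EM x₀).source)
    (v : EM) : chartEquiv EM x₀ x v =
      (mfderiv 𝓘(ℝ, EM) 𝓘(ℝ, EM) (chartAt EM x₀) x : EM →L[ℝ] EM) v := by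
  have h1 : chartEquiv EM x₀ x = _ := dif_pos h
  exact congrArg (fun e : EM ≃ₗ[ℝ] EM => e v) h1

theorem dChart_comp_dChartSymm [IsManifold 𝓘(ℝ, E) ∞ N] {y₀ : N} {t : E}
    (ht : t ∈ (chartAt E y₀).target) :
    dChart E y₀ t ∘ₗ dChartSymm E y₀ t = LinearMap.id := by
  have h := (mdifferentiable_chart (I := 𝓘(ℝ, E)) y₀).comp_symm_deriv ht
  exact congrArg (fun L : E →L[ℝ] E => L.toLinearMap) h

/-- In finite dimension a one-sided inverse of a square map is two-sided. -/
theorem dChartSymm_comp_dChart [FiniteDimensional ℝ E] [IsManifold 𝓘(ℝ, E) ∞ N] {y₀ : N} {t : E}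
    (ht : t ∈ (chartAt E y₀).target) :
    dChartSymm E y₀ t ∘ₗ dChart E y₀ t = LinearMap.id := by
  have h : ∀ f g : E →ₗ[ℝ] E, f ∘ₗ g = LinearMap.id → g ∘ₗ f = LinearMap.id := fun _ _ =>
    (LinearMap.comp_eq_id_comm ℝ E).1
  exact h _ _ (dChart_comp_dChartSymm ht)

/-- A linear trivialization of the tangent bundle, in charts. -/
def linFrame {M : Type*} {q : N → M} (f : ∀ y : N, T E y ≃ₗ[ℝ] EM × ℝ) (D : M → M → EM ≃ₗ[ℝ] EM)
    (y₀ : N) (x₀ : M) (t : E) : E →ₗ[ℝ] EM × ℝ :=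
  (prodLine (D x₀ (q ((chartAt E y₀).symm t)))).toLinearMap ∘ₗ
    (f ((chartAt E y₀).symm t)).toLinearMap ∘ₗ dChartSymm E y₀ t

/-- The inverse of a linear trivialization of the tangent bundle, in charts. -/
def linFrameInv {M : Type*} {q : N → M} (f : ∀ y : N, T E y ≃ₗ[ℝ] EM × ℝ)
    (D : M → M → EM ≃ₗ[ℝ] EM) (y₀ : N) (x₀ : M) (t : E) : EM × ℝ →ₗ[ℝ] E :=
  dChart E y₀ t ∘ₗ (f ((chartAt E y₀).symm t)).symm.toLinearMap ∘ₗ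
    (prodLine (D x₀ (q ((chartAt E y₀).symm t)))).symm.toLinearMap

variable [FiniteDimensional ℝ E] [FiniteDimensional ℝ EM] [IsManifold 𝓘(ℝ, E) ∞ N]
  {f : ∀ y : N, T E y ≃ₗ[ℝ] EM × ℝ} {D : M → M → EM ≃ₗ[ℝ] EM}

theorem linFrame_comp_inv {y₀ : N} {x₀ : M} {t : E} (ht : t ∈ (chartAt E y₀).target) :
    linFrame (q := q) f D y₀ x₀ t ∘ₗ linFrameInv (q := q) f D y₀ x₀ t = LinearMap.id ∧
      linFrameInv (q := q) f D y₀ x₀ t ∘ₗ linFrame (q := q) f D y₀ x₀ t = LinearMap.id := by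
  refine ⟨LinearMap.ext fun v => ?_, LinearMap.ext fun v => ?_⟩
  · have h := fun w => congrArg (fun L : T E ((chartAt E y₀).symm t) →ₗ[ℝ] _ => L w)
      (dChartSymm_comp_dChart ht)
    simp only [LinearMap.comp_apply, LinearMap.id_apply] at h
    simp only [linFrame, linFrameInv, LinearMap.comp_apply, LinearEquiv.coe_coe, h,
      LinearEquiv.apply_symm_apply, LinearMap.id_apply]
  · have h := fun w => congrArg (fun L : E →ₗ[ℝ] E => L w) (dChart_comp_dChartSymm ht)
    simp only [LinearMap.comp_apply, LinearMap.id_apply] at h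
    simp only [linFrame, linFrameInv, LinearMap.comp_apply, LinearEquiv.coe_coe, h,
      LinearEquiv.symm_apply_apply, LinearMap.id_apply]

theorem contDiffAt_linFrameInv (hq : Continuous q)
    (hf : ∀ y₀ x₀, ∀ t ∈ chartPreimage (EM := EM) E q y₀ x₀, ∀ v,
      ContDiffAt ℝ ∞ (fun t => linFrame (q := q) f D y₀ x₀ t v) t) {y₀ : N} {x₀ : M} {t : E}
    (ht : t ∈ chartPreimage (EM := EM) E q y₀ x₀) (v : EM × ℝ) :
    ContDiffAt ℝ ∞ (fun t => linFrameInv (q := q) f D y₀ x₀ t v) t := by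
  refine contDiffAt_inverse_family (hf y₀ x₀ t ht) ?_ v
  filter_upwards [(isOpen_chartPreimage hq y₀ x₀).mem_nhds ht] with t' ht'
  exact linFrame_comp_inv ht'.1

/-- The comparison maps are pull-backs along the frame written in charts and along its inverse. Both
are smooth because the inverse of a smooth family of isomorphisms is smooth. -/
theorem isFraming_extRep (hq : Continuous q)
    (hf : ∀ y₀ x₀, ∀ t ∈ chartPreimage (EM := EM) E q y₀ x₀, ∀ v,
      ContDiffAt ℝ ∞ (fun t => linFrame (q := q) f D y₀ x₀ t v) t) :
    IsFraming EM q (extRep E) (fun y => extIso (f y)) (fun x₀ x => extIso (prodLine (D x₀ x))) := by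
  intro y₀ x₀
  refine ⟨fun t => (pullExt (linFrame (q := q) f D y₀ x₀ t)).toLinearMap,
    fun t => (pullExt (linFrameInv (q := q) f D y₀ x₀ t)).toLinearMap, fun t ht =>
    ⟨wSmoothAt_pullExt (hf y₀ x₀ t ht), wSmoothAt_pullExt (contDiffAt_linFrameInv hq hf ht), ?_⟩⟩
  rintro u _ rfl
  have h1 : pullExt (linFrame (q := q) f D y₀ x₀ t)
      (extIso (prodLine (D x₀ (q ((chartAt E y₀).symm t)))) (extIso (f ((chartAt E y₀).symm t))
        (u ((chartAt E y₀).symm t)))) = extRep E y₀ u t := by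
    rw [linFrame, pullExt_comp, ← extIso_symm_apply, LinearEquiv.symm_apply_apply, pullExt_comp,
      ← extIso_symm_apply, LinearEquiv.symm_apply_apply]
    rfl
  refine ⟨h1.symm, ?_⟩
  rw [← h1, AlgHom.toLinearMap_apply, ← pullExt_comp, (linFrame_comp_inv ht.1).1, pullExt_id]

theorem isFraming_genRep (hq : Continuous q)
    (hf : ∀ y₀ x₀, ∀ t ∈ chartPreimage (EM := EM) E q y₀ x₀, ∀ v,
      ContDiffAt ℝ ∞ (fun t => linFrame (q := q) f D y₀ x₀ t v) t) :
    IsFraming EM q (genRep E) (fun y => genIso (f y)) (fun x₀ x => genIso (prodLine (D x₀ x))) := by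
  intro y₀ x₀
  let Q := linFrame (q := q) f D y₀ x₀
  let Q' := linFrameInv (q := q) f D y₀ x₀
  refine ⟨fun t => (push (Q' t)).prodMap (pull (Q t)), fun t => (push (Q t)).prodMap (pull (Q' t)),
    fun t ht => ⟨fun w => ?_, fun w => ?_, ?_⟩⟩
  · have h1 := (wSmoothAt_push (contDiffAt_linFrameInv hq hf ht) w.1).map
      (LinearMap.inl ℂ (CVec E) (CCovec E))
    have h2 := (wSmoothAt_pull (hf y₀ x₀ t ht) w.2).map (LinearMap.inr ℂ (CVec E) (CCovec E))
    refine (h1.add h2).congr (Filter.Eventually.of_forall fun t => ?_)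
    simp [Q, Q']
  · have h1 := (wSmoothAt_push (hf y₀ x₀ t ht) w.1).map
      (LinearMap.inl ℂ (CVec (EM × ℝ)) (CCovec (EM × ℝ)))
    have h2 := (wSmoothAt_pull (contDiffAt_linFrameInv hq hf ht) w.2).map
      (LinearMap.inr ℂ (CVec (EM × ℝ)) (CCovec (EM × ℝ)))
    refine (h1.add h2).congr (Filter.Eventually.of_forall fun t => ?_)
    simp [Q, Q']
  · rintro u _ rfl
    have h1 : genIso (prodLine (D x₀ (q ((chartAt E y₀).symm t))))
        (genIso (f ((chartAt E y₀).symm t)) (u ((chartAt E y₀).symm t))) =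
        (push (Q t)).prodMap (pull (Q' t)) (genRep E y₀ u t) := by
      have h := fun w => congrArg (fun L : T E ((chartAt E y₀).symm t) →ₗ[ℝ] _ => L w)
        (dChartSymm_comp_dChart ht.1)
      simp only [LinearMap.comp_apply, LinearMap.id_apply] at h
      refine Prod.ext (LinearMap.ext fun α => ?_) (LinearMap.ext fun v => ?_)
      · refine congrArg (u ((chartAt E y₀).symm t)).1 (LinearMap.ext fun w => ?_)
        exact congrArg (fun w => α (prodLine (D x₀ (q ((chartAt E y₀).symm t)))
          (f ((chartAt E y₀).symm t) w))) (h w).symm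
      · exact congrArg (u ((chartAt E y₀).symm t)).2 (h _).symm
    refine ⟨?_, h1⟩
    rw [h1]
    refine Prod.ext ?_ ?_
    · change _ = push (Q' t) (push (Q t) _)
      rw [← push_comp, (linFrame_comp_inv ht.1).2, push_id]
      rfl
    · change _ = pull (Q t) (pull (Q' t) _)
      rw [← pull_comp, (linFrame_comp_inv ht.1).2, pull_id]
      rfl

end LinearFraming

/-! ### Smoothness of the frame defined by a connection. -/

section ConnectionFraming

variable {EM E : Type*} [NormedAddCommGroup EM] [NormedSpace ℝ EM]
  [NormedAddCommGroup E] [NormedSpace ℝ E]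
  {M N : Type*} [TopologicalSpace M] [ChartedSpace EM M] [TopologicalSpace N] [ChartedSpace E N]
  [MulAction Circle N] {q : N → M}
  [IsManifold 𝓘(ℝ, EM) ∞ M] [IsManifold 𝓘(ℝ, E) ∞ N]

/-- Smoothness of a connection is formulated in the exterior algebra. The functional that takes the
degree one part and evaluates it at v recovers the coefficient of B. -/
theorem contDiffAt_connection {B : ∀ y : N, T E y →ₗ[ℝ] ℝ} (hB : IsConnectionForm E B) {y₀ : N}
    {t : E} (ht : t ∈ (chartAt E y₀).target) (v : E) :
    ContDiffAt ℝ ∞ (fun t => B ((chartAt E y₀).symm t) (dChartSymm E y₀ t v)) t := by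
  have h := (hB.smooth y₀ (CVec.ofReal v ∘ₗ ExteriorAlgebra.ιInv)).contDiffAt
    ((chartAt E y₀).open_target.mem_nhds ht)
  refine (Complex.reCLM.contDiff.contDiffAt.comp t h).congr_of_eventuallyEq
    (Filter.Eventually.of_forall fun t => ?_)
  have h1 : extRep E y₀ (fun z => oneForm (CCovec.ofReal (B z))) t =
      ExteriorAlgebra.ι ℂ (pull (dChartSymm E y₀ t) (CCovec.ofReal (B ((chartAt E y₀).symm t)))) :=
    pullExt_oneForm _ _
  have h2 : ExteriorAlgebra.ιInv (R := ℂ) (M := CCovec E) (ExteriorAlgebra.ι ℂ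
    (pull (dChartSymm E y₀ t) (CCovec.ofReal (B ((chartAt E y₀).symm t))))) = _ :=
    ExteriorAlgebra.ι_leftInverse _
  simp only [Function.comp_apply, LinearMap.comp_apply, h1, h2]
  rfl

/-- After correction by `chartEquiv`, the horizontal component is the ordinary derivative of q
written in the charts at y₀ and x₀, hence smooth in t. -/
theorem contDiffAt_linFrame (hq : IsPrincipalCircleBundle EM E q) {B : ∀ y : N, T E y →ₗ[ℝ] ℝ}
    (hB : IsConnectionForm E B) (y₀ : N) (x₀ : M) (t : E)
    (ht : t ∈ chartPreimage (EM := EM) E q y₀ x₀) (v : E) :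
    ContDiffAt ℝ ∞ (fun t => linFrame (q := q) (frame hq hB) (chartEquiv EM) y₀ x₀ t v) t := by
  refine ContDiffAt.congr_of_eventuallyEq (f := fun t : E =>
    (fderiv ℝ (fun t => chartAt EM x₀ (q ((chartAt E y₀).symm t))) t v,
      B ((chartAt E y₀).symm t) (dChartSymm E y₀ t v)))
    (ContDiffAt.prodMk ?_ (contDiffAt_connection hB ht.1 v)) ?_
  · refine ContDiffAt.clm_apply (ContDiffAt.fderiv_right (m := ∞) (n := ∞) ?_ (by simp))
      contDiffAt_const
    rw [← contMDiffAt_iff_contDiffAt]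
    exact ContMDiffAt.comp t (g := chartAt EM x₀) (contMDiffAt_chart x₀ _ ht.2)
      (hq.contMDiff_proj.contMDiffAt.comp t (contMDiffAt_chart_symm y₀ t ht.1))
  · filter_upwards [(isOpen_chartPreimage hq.contMDiff_proj.continuous y₀ x₀).mem_nhds ht]
      with t ht
    refine Prod.ext ?_ rfl
    have h1 : MDifferentiableAt 𝓘(ℝ, E) 𝓘(ℝ, E) (chartAt E y₀).symm t :=
      (contMDiffAt_chart_symm y₀ t ht.1).mdifferentiableAt (by simp)
    have h2 : MDifferentiableAt 𝓘(ℝ, E) 𝓘(ℝ, EM) q ((chartAt E y₀).symm t) :=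
      hq.contMDiff_proj.mdifferentiable (by simp) _
    have h3 : MDifferentiableAt 𝓘(ℝ, EM) 𝓘(ℝ, EM) (chartAt EM x₀) (q ((chartAt E y₀).symm t)) :=
      (contMDiffAt_chart x₀ _ ht.2).mdifferentiableAt (by simp)
    have h4 := (h3.hasMFDerivAt.comp t (h2.hasMFDerivAt.comp t h1.hasMFDerivAt)).mfderiv
    rw [mfderiv_eq_fderiv] at h4
    have h5 := congrArg (fun L : E →L[ℝ] EM => L v) h4
    refine Eq.trans ?_ h5.symm
    exact chartEquiv_apply ht.2 _

end ConnectionFraming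

/-! ### The tautological framing of functions. -/

section FunctionFraming

variable {EM E : Type*} [NormedAddCommGroup EM] [NormedSpace ℝ EM]
  [NormedAddCommGroup E] [NormedSpace ℝ E]
  {M N : Type*} [TopologicalSpace M] [ChartedSpace EM M] [TopologicalSpace N] [ChartedSpace E N]

theorem isFraming_funRep (q : N → M) :
    IsFraming EM q (funRep E) (fun _ => LinearEquiv.refl ℂ ℂ)
      (fun _ _ => LinearEquiv.refl ℂ ℂ) := by
  refine fun y₀ x₀ => ⟨fun _ => LinearMap.id, fun _ => LinearMap.id, fun t _ =>
    ⟨fun w => WSmoothAt.const w, fun w => WSmoothAt.const w, ?_⟩⟩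
  rintro u _ rfl
  exact ⟨rfl, rfl⟩

end FunctionFraming

/-- A framing composed with an automorphism that commutes with the transition maps. -/
theorem IsFraming.trans {EM E : Type*} [NormedAddCommGroup EM]
    [NormedAddCommGroup E] [NormedSpace ℝ E] {M N : Type*} [TopologicalSpace M] [ChartedSpace EM M]
    [TopologicalSpace N] [ChartedSpace E N] {F : N → Type*} [∀ y, AddCommGroup (F y)]
    [∀ y, Module ℂ (F y)] {W : Type*} [AddCommGroup W] [Module ℂ W] {W₀ : Type*} [AddCommGroup W₀]
    [Module ℂ W₀] {q : N → M} {R : N → (∀ y, F y) →ₗ[ℂ] (E → W)} {e : ∀ y, F y ≃ₗ[ℂ] W₀}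
    {θ : M → M → W₀ ≃ₗ[ℂ] W₀} (h : IsFraming EM q R e θ) (J : W₀ ≃ₗ[ℂ] W₀)
    (hJ : ∀ x₀ x w, J (θ x₀ x w) = θ x₀ x (J w)) :
    IsFraming EM q R (fun y => (e y).trans J) θ := by
  intro y₀ x₀
  obtain ⟨Θ, Θ', hΘ⟩ := h y₀ x₀
  refine ⟨fun t => Θ t ∘ₗ J.symm.toLinearMap, fun t => J.toLinearMap ∘ₗ Θ' t, fun t ht =>
    ⟨fun w => (hΘ t ht).1 (J.symm w), fun w => ((hΘ t ht).2.1 w).map J.toLinearMap,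
      fun u y hy => ?_⟩⟩
  obtain ⟨h1, h2⟩ := (hΘ t ht).2.2 u y hy
  simp only [LinearEquiv.trans_apply, ← hJ, LinearMap.comp_apply, LinearEquiv.coe_coe,
    LinearEquiv.symm_apply_apply]
  exact ⟨h1, congrArg J h2⟩

/-! ### Products of smooth fields -/

section Products

variable {EM E : Type*} [NormedAddCommGroup EM] [NormedSpace ℝ EM]
  [NormedAddCommGroup E] [NormedSpace ℝ E]
  {M N : Type*} [TopologicalSpace M] [ChartedSpace EM M] [TopologicalSpace N] [ChartedSpace E N]
  {F₁ F₂ F₃ : N → Type*} [∀ y, AddCommGroup (F₁ y)] [∀ y, Module ℂ (F₁ y)]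
  [∀ y, AddCommGroup (F₂ y)] [∀ y, Module ℂ (F₂ y)]
  [∀ y, AddCommGroup (F₃ y)] [∀ y, Module ℂ (F₃ y)]
  {V₁ V₂ V₃ : Type*} [AddCommGroup V₁] [Module ℂ V₁] [AddCommGroup V₂] [Module ℂ V₂]
  [AddCommGroup V₃] [Module ℂ V₃]
  {W₁ W₂ W₃ : Type*} [AddCommGroup W₁] [Module ℂ W₁] [AddCommGroup W₂] [Module ℂ W₂]
  [AddCommGroup W₃] [Module ℂ W₃]
  {R₁ : N → (∀ y, F₁ y) →ₗ[ℂ] (E → V₁)} {R₂ : N → (∀ y, F₂ y) →ₗ[ℂ] (E → V₂)}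
  {R₃ : N → (∀ y, F₃ y) →ₗ[ℂ] (E → V₃)}
  {e₁ : ∀ y, F₁ y ≃ₗ[ℂ] W₁} {e₂ : ∀ y, F₂ y ≃ₗ[ℂ] W₂} {e₃ : ∀ y, F₃ y ≃ₗ[ℂ] W₃}
  {θ₁ : M → M → W₁ ≃ₗ[ℂ] W₁} {θ₂ : M → M → W₂ ≃ₗ[ℂ] W₂} {θ₃ : M → M → W₃ ≃ₗ[ℂ] W₃}
  {q : N → M}

/-- The fibrewise product of smooth fields, where it is smooth. -/
def fieldProduct (β : ∀ y, F₁ y →ₗ[ℂ] F₂ y →ₗ[ℂ] F₃ y)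
    (hβ : ∀ u₁ ∈ smoothFields R₁, ∀ u₂ ∈ smoothFields R₂,
      (fun y => β y (u₁ y) (u₂ y)) ∈ smoothFields R₃) :
    smoothFields R₁ →ₗ[ℂ] smoothFields R₂ →ₗ[ℂ] smoothFields R₃ :=
  LinearMap.mk₂ ℂ (fun u₁ u₂ => ⟨fun y => β y (u₁.1 y) (u₂.1 y), hβ _ u₁.2 _ u₂.2⟩)
    (fun _ _ _ => Subtype.ext (funext fun _ => by simp))
    (fun _ _ _ => Subtype.ext (funext fun _ => by simp))
    (fun _ _ _ => Subtype.ext (funext fun _ => by simp))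
    (fun _ _ _ => Subtype.ext (funext fun _ => by simp))

variable [IsManifold 𝓘(ℝ, E) ∞ N] [Module.Finite ℂ V₁] [Module.Finite ℂ V₂]
  [Module.Finite ℂ W₁] [Module.Finite ℂ W₂] [Module.Finite ℂ W₃]

theorem IsFraming.bilin_mem (h₁ : IsFraming EM q R₁ e₁ θ₁) (h₂ : IsFraming EM q R₂ e₂ θ₂)
    (h₃ : IsFraming EM q R₃ e₃ θ₃) (hq : Continuous q) (β : ∀ y, F₁ y →ₗ[ℂ] F₂ y →ₗ[ℂ] F₃ y)
    (b : W₁ →ₗ[ℂ] W₂ →ₗ[ℂ] W₃) (hb : ∀ y a c, e₃ y (β y a c) = b (e₁ y a) (e₂ y c))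
    (hθ : ∀ x₀ x a c, θ₃ x₀ x (b a c) = b (θ₁ x₀ x a) (θ₂ x₀ x c))
    (u₁ : ∀ y, F₁ y) (hu₁ : u₁ ∈ smoothFields R₁) (u₂ : ∀ y, F₂ y) (hu₂ : u₂ ∈ smoothFields R₂) :
    (fun y => β y (u₁ y) (u₂ y)) ∈ smoothFields R₃ := by
  refine h₃.mem_smoothFields hq fun y₀ => ?_
  simp only [hb, hθ]
  exact WSmoothAt.bilin b (h₁.wSmoothAt hq hu₁ (mem_chart_source EM (q y₀)))
    (h₂.wSmoothAt hq hu₂ (mem_chart_source EM (q y₀)))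

variable [MulAction Circle N]

/-- The convolution theorem in the form common to all exotic products: the pointwise product on the
circle bundle and the product β at the exotic point are the same bilinear map b once both are read
in frames. -/
theorem IsFraming.hasWeakSum_bilin (hp : IsPrincipalCircleBundle EM E q)
    (h₁ : IsFraming EM q R₁ e₁ θ₁) (h₂ : IsFraming EM q R₂ e₂ θ₂)
    (b : W₁ →ₗ[ℂ] W₂ →ₗ[ℂ] W₃) {u₁ : ∀ y, F₁ y} (hu₁ : u₁ ∈ smoothFields R₁) {u₂ : ∀ y, F₂ y}
    (hu₂ : u₂ ∈ smoothFields R₂) {u₃ : ∀ y, F₃ y}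
    (hu₃ : ∀ y, e₃ y (u₃ y) = b (e₁ y (u₁ y)) (e₂ y (u₂ y)))
    {K₁ K₂ K₃ : Type*} [AddCommGroup K₁] [Module ℂ K₁] [AddCommGroup K₂] [Module ℂ K₂]
    [AddCommGroup K₃] [Module ℂ K₃] {k₁ : K₁ ≃ₗ[ℂ] W₁} {k₂ : K₂ ≃ₗ[ℂ] W₂} {k₃ : K₃ ≃ₗ[ℂ] W₃}
    {β : K₁ → K₂ → K₃} (hβ : ∀ a c, k₃ (β a c) = b (k₁ a) (k₂ c)) {y : N} {n : ℤ}
    {w₁ : ℤ → K₁} {w₂ : ℤ → K₂} {w₃ : K₃}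
    (i₁ : ∀ m : ℤ, HasWeakIntegral
      (fun t => (rot t : ℂ) ^ m • e₁ (rot t • y) (u₁ (rot t • y))) (k₁ (w₁ m)))
    (i₂ : ∀ m : ℤ, HasWeakIntegral
      (fun t => (rot t : ℂ) ^ m • e₂ (rot t • y) (u₂ (rot t • y))) (k₂ (w₂ m)))
    (i₃ : HasWeakIntegral
      (fun t => (rot t : ℂ) ^ n • e₃ (rot t • y) (u₃ (rot t • y))) (k₃ w₃)) :
    HasWeakSum (fun m => β (w₁ m) (w₂ (n - m))) w₃ := by
  simp only [hu₃] at i₃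
  have h := hasWeakSum_convolution b (h₁.orbitSmooth hp hu₁ y) (fun t =>
    congrArg (fun z => e₁ z (u₁ z)) (rot_add_one_smul t y))
    (fun l => (h₂.orbitSmooth hp hu₂ y l).continuous) i₁ i₂ i₃
  have h' := h.map k₃.symm.toLinearMap
  simpa [← hβ] using h'

end Products

/-! ### Invariance -/

section Invariance

variable {V V' U : Type*} [AddCommGroup V] [Module ℝ V] [AddCommGroup V'] [Module ℝ V']
  [AddCommGroup U] [Module ℝ U] (e : V ≃ₗ[ℝ] U) (e' : V' ≃ₗ[ℝ] U) {d : V →ₗ[ℝ] V'}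

/-- The hypothesis forces d to be the inverse of e' composed with e, so pull-back along d is
equality in the frames. -/
theorem extIso_eq_extIso_iff (h : ∀ v, e' (d v) = e v) (η : Ext V) (η' : Ext V') :
    extIso e' η' = extIso e η ↔ pullExt d η' = η := by
  have h1 : d = (e.trans e'.symm).toLinearMap := LinearMap.ext fun v => by simp [← h]
  have h2 : pullExt d η' = (extIso e).symm (extIso e' η') := by
    rw [extIso_symm_apply, extIso_apply, ← pullExt_comp, h1]
    rfl
  rw [h2, LinearEquiv.symm_apply_eq]

theorem genIso_eq_genIso_iff (h : ∀ v, e' (d v) = e v) (a : GenTan V) (a' : GenTan V') :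
    genIso e' a' = genIso e a ↔ push d a.1 = a'.1 ∧ a.2 = pull d a'.2 := by
  have h1 : d = (e.trans e'.symm).toLinearMap := LinearMap.ext fun v => by simp [← h]
  have h2 : push d a.1 = ((genIso e').symm (genIso e a)).1 := by
    rw [genIso_symm_apply, genIso_apply, ← push_comp, h1]
    rfl
  have h3 : pull d a'.2 = ((genIso e).symm (genIso e' a')).2 := by
    rw [genIso_symm_apply, genIso_apply, ← pull_comp, h1]
    rfl
  rw [h2, h3]
  refine ⟨fun h => ?_, fun h => ?_⟩
  · rw [h, LinearEquiv.symm_apply_apply, ← h, LinearEquiv.symm_apply_apply]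
    exact ⟨rfl, rfl⟩
  · refine Prod.ext ?_ ?_
    · rw [← (genIso e').apply_symm_apply (genIso e a), genIso_apply, genIso_apply e', h.1]
    · conv_rhs => rw [genIso_apply, h.2]
      conv_lhs => rw [← (genIso e).apply_symm_apply (genIso e' a'), genIso_apply]

end Invariance

/-! ### Modules over the Clifford algebra -/

section CliffordLift

variable {EM EZ EY : Type*} [NormedAddCommGroup EM] [NormedSpace ℝ EM]
  [NormedAddCommGroup EZ] [NormedSpace ℝ EZ] [NormedAddCommGroup EY] [NormedSpace ℝ EY]
  {M Z Y : Type*} [TopologicalSpace M] [ChartedSpace EM M] [TopologicalSpace Z] [ChartedSpace EZ Z]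
  [MulAction Circle Z] [TopologicalSpace Y] [ChartedSpace EY Y] [MulAction Circle Y]
  {p : Z → M} {q : Y → M}

/-- The universal property: a representation of the generators that respects each relation descends
to the quotient of words. -/
theorem exists_cliffordLift {𝓑 : Type*} [Ring 𝓑] [Algebra ℂ 𝓑]
    (s : ExoticScalars EM EZ p →ₗ[ℂ] 𝓑) (c : ExoticSections EM EZ EY p q →ₗ[ℂ] 𝓑)
    (one : ∀ f, IsScalarOne f → s f = 1) (mul : ∀ f g h, IsScalarMul f g h → s f * s g = s h)
    (smul : ∀ f a b, IsScalarSMul f a b → s f * c a = c b) (comm : ∀ f a, c a * s f = s f * c a)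
    (square : ∀ a f, IsExoticPairing a a f → c a * c a = s f) :
    ∃ ρ : ExoticClifford EM EZ EY p q →ₐ[ℂ] 𝓑,
      (∀ f, ρ (cliffScalar f) = s f) ∧ ∀ a, ρ (cliffSection a) = c a := by
  let Φ : CliffordWords EM EZ EY p q →ₐ[ℂ] 𝓑 := FreeAlgebra.lift ℂ (Sum.elim s c)
  have hs : ∀ f, Φ (scalarWord f) = s f := fun f => FreeAlgebra.lift_ι_apply _ _
  have hc : ∀ a, Φ (sectionWord a) = c a := fun a => FreeAlgebra.lift_ι_apply _ _
  have hΦ : ∀ ⦃x y⦄, CliffordRel EM EZ EY p q x y → Φ x = Φ y := by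
    intro x y h
    cases h with
    | scalar_add f g => simp [hs]
    | scalar_smul r f => simp [hs]
    | scalar_one f h => simp [hs, one f h]
    | scalar_mul f g h hh => simp [hs, mul f g h hh]
    | section_add a b => simp [hc]
    | section_smul r a => simp [hc]
    | scalar_section f a b h => simp [hs, hc, smul f a b h]
    | central f a => simp [hs, hc, comm]
    | square a f h => simp [hs, hc, square a f h]
  refine ⟨RingQuot.liftAlgHom ℂ ⟨Φ, hΦ⟩, fun f => ?_, fun a => ?_⟩
  · rw [cliffScalar, RingQuot.liftAlgHom_mkAlgHom_apply, hs]
  · rw [cliffSection, RingQuot.liftAlgHom_mkAlgHom_apply, hc]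

end CliffordLift

/-! ### The Hori formula and the duality of sections, fibrewise -/

section Fibrewise

variable {EM EZ EY : Type*} [NormedAddCommGroup EM] [NormedSpace ℝ EM]
  [NormedAddCommGroup EZ] [NormedSpace ℝ EZ] [NormedAddCommGroup EY] [NormedSpace ℝ EY]
  {M Z Y : Type*} [TopologicalSpace M] [ChartedSpace EM M] [TopologicalSpace Z] [ChartedSpace EZ Z]
  [MulAction Circle Z] [TopologicalSpace Y] [ChartedSpace EY Y] [MulAction Circle Y]
  {p : Z → M} {q : Y → M}
  (hp : IsPrincipalCircleBundle EM EZ p) (hq : IsPrincipalCircleBundle EM EY q)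
  {A : ∀ z : Z, T EZ z →ₗ[ℝ] ℝ} (hA : IsConnectionForm EZ A)
  {B : ∀ y : Y, T EY y →ₗ[ℝ] ℝ} (hB : IsConnectionForm EY B)

/-- The trivialization of forms on `Z` that corresponds to the frame on the dual bundle. -/
def dualExtIso (z : Z) : Ext (T EZ z) ≃ₗ[ℂ] Ext (EM × ℝ) :=
  (extIso (frame hp hA z)).trans (turn EM)

/-- The trivialization of generalized vectors on `Z` that corresponds to the frame on the dual
bundle. -/
def dualGenIso (z : Z) : GenTan (T EZ z) ≃ₗ[ℂ] GenTan (EM × ℝ) :=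
  (genIso (frame hp hA z)).trans (reflect EM)

theorem dualExtIso_cliff (z : Z) (a : GenTan (T EZ z)) (η : Ext (T EZ z)) :
    dualExtIso hp hA z (cliff a η) = cliff (dualGenIso hp hA z a) (dualExtIso hp hA z η) := by
  simp only [dualExtIso, dualGenIso, LinearEquiv.trans_apply, extIso_cliff, turn_cliff]

theorem pairing_dualGenIso (z : Z) (a b : GenTan (T EZ z)) :
    pairing (dualGenIso hp hA z a) (dualGenIso hp hA z b) = pairing a b := by
  simp only [dualGenIso, LinearEquiv.trans_apply, pairing_reflect, pairing_genIso]

theorem dualExtIso_mem_parity_iff (z : Z) {k : ZMod 2} {η : Ext (T EZ z)} :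
    dualExtIso hp hA z η ∈ parity (EM × ℝ) (k + 1) ↔ η ∈ parity (T EZ z) k := by
  rw [dualExtIso, LinearEquiv.trans_apply, turn_mem_parity_iff, extIso_mem_parity_iff]

/-- On the correspondence space the frames of Z and Y have the same horizontal component, so
`pullExt_mul_expWedge` applies. Contraction with (v, 0) then picks out the coefficient of A - B,
which is the pull-back of the turned form. -/
theorem isHoriIntegrand_dualExtIso (z : Z) (y : Y) (η : Ext (T EZ z)) :
    IsHoriIntegrand EM p q A B z y η
      ((extIso (frame hq hB y)).symm (dualExtIso hp hA z η)) := by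
  have hv : (gen EZ z, (0 : T EY y)) ∈ corrTangent EM (EZ := EZ) (EY := EY) p q z y := by
    rw [corrTangent, LinearMap.mem_ker, LinearMap.sub_apply, LinearMap.comp_apply,
      LinearMap.comp_apply, LinearMap.fst_apply, LinearMap.snd_apply, dProj_gen hp, map_zero,
      sub_zero]
  refine ⟨⟨_, hv⟩, rfl, ?_⟩
  let v : corrTangent EM (EZ := EZ) (EY := EY) p q z y := ⟨_, hv⟩
  let E₁ : corrTangent EM (EZ := EZ) (EY := EY) p q z y →ₗ[ℝ] EM × ℝ :=
    (frame hp hA z).toLinearMap ∘ₗ dFst EM p q z y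
  let E₂ : corrTangent EM (EZ := EZ) (EY := EY) p q z y →ₗ[ℝ] EM × ℝ :=
    (frame hq hB y).toLinearMap ∘ₗ dSnd EM p q z y
  have hE : ∀ w, (E₁ w).1 = (E₂ w).1 := fun w => sub_eq_zero.1 (LinearMap.mem_ker.1 w.2)
  have hE₂ : E₂ v = 0 := map_zero (frame hq hB y)
  have h1 : pullExt (dFst EM (EY := EY) p q z y) η = pullExt E₁ (extIso (frame hp hA z) η) := by
    rw [pullExt_comp, ← extIso_symm_apply, LinearEquiv.symm_apply_apply]
  have h2 : pull (dFst EM (EY := EY) p q z y) (CCovec.ofReal (A z)) = pull E₁ (lastCovec EM) := rfl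
  have h3 : pull (dSnd EM (EZ := EZ) p q z y) (CCovec.ofReal (B y)) = pull E₂ (lastCovec EM) := rfl
  -- The vector (v, 0) projects to zero in Y, so forms pulled back from Y are annihilated by the
  -- contraction.
  have h4 : ∀ θ : Ext (EM × ℝ), interior (CVec.ofReal v) (pullExt E₂ θ) = 0 := fun θ => by
    rw [← pullExt_interior, push_ofReal, hE₂]
    have h5 : CVec.ofReal (0 : EM × ℝ) = 0 := LinearMap.ext fun α => map_zero α
    rw [h5, interior, map_zero, LinearMap.zero_apply, map_zero]
  have h6 : (pull E₁ (lastCovec EM) - pull E₂ (lastCovec EM)) v = 1 := by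
    rw [LinearMap.sub_apply, pull_apply, pull_apply, hE₂, map_zero, sub_zero]
    have h7 : (E₁ v).2 = 1 := hA.gen_eq_one z
    simp [h7]
  change interior (CVec.ofReal v) _ = _
  rw [h1, h2, h3, pullExt_mul_expWedge E₁ E₂ hE, map_add, h4, interior_oneForm_mul, h4,
    CVec.ofReal_apply, h6, pullExt_comp]
  simp only [mul_zero, sub_zero, zero_add, one_smul]
  rfl

/-- The reflection subtracts the multiple 2⟨n, a⟩ = g - f of n = ∂ᵣ - dr from -a. This replaces f by
g in the vector part and g by f in the covector part. -/
theorem isDualVector_dualGenIso (z : Z) (y : Y) (a : GenTan (T EZ z)) :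
    IsDualVector EM p q A B z y a
      ((genIso (frame hq hB y)).symm (dualGenIso hp hA z a)) := by
  obtain ⟨a', rfl⟩ := (genIso (frame hp hA z)).symm.surjective a
  rw [dualGenIso, LinearEquiv.trans_apply, LinearEquiv.apply_symm_apply, reflect_apply]
  let f : ℂ := a'.1 (lastCovec EM)
  let g : ℂ := a'.2 (0, 1)
  have hfg : 2 * pairing (axis EM) a' = g - f := by
    simp only [pairing, axis, CVec.ofReal_apply, map_neg, f, g]
    ring
  -- The basic part ξ is the restriction of the covector to the horizontal space; g is its value on
  -- the vertical generator.
  have ha' : a'.2 = pull (LinearMap.fst ℝ EM ℝ) (pull (LinearMap.inl ℝ EM ℝ) a'.2) +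
      g • lastCovec EM := by
    refine LinearMap.ext fun v => ?_
    have h1 : v = (v.1, 0) + v.2 • ((0 : EM), (1 : ℝ)) := by ext <;> simp
    conv_lhs => rw [h1, map_add, map_smul]
    simp [g, mul_comm]
  have hb : (-a' - (2 * pairing (axis EM) a') • axis EM).2 =
      -(pull (LinearMap.fst ℝ EM ℝ) (pull (LinearMap.inl ℝ EM ℝ) a'.2) + f • lastCovec EM) := by
    rw [hfg, Prod.snd_sub, Prod.snd_neg, Prod.smul_snd, axis]
    conv_lhs => rw [ha']
    module
  have hpf : dProj EM EZ p z ∘ₗ (frame hp hA z).symm.toLinearMap = LinearMap.fst ℝ EM ℝ :=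
    LinearMap.ext fun v => congrArg Prod.fst ((frame hp hA z).apply_symm_apply v)
  have hps : A z ∘ₗ (frame hp hA z).symm.toLinearMap = LinearMap.snd ℝ EM ℝ :=
    LinearMap.ext fun v => congrArg Prod.snd ((frame hp hA z).apply_symm_apply v)
  have hqf : dProj EM EY q y ∘ₗ (frame hq hB y).symm.toLinearMap = LinearMap.fst ℝ EM ℝ :=
    LinearMap.ext fun v => congrArg Prod.fst ((frame hq hB y).apply_symm_apply v)
  have hqs : B y ∘ₗ (frame hq hB y).symm.toLinearMap = LinearMap.snd ℝ EM ℝ :=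
    LinearMap.ext fun v => congrArg Prod.snd ((frame hq hB y).apply_symm_apply v)
  have hb₁ : (-a' - (2 * pairing (axis EM) a') • axis EM).1 =
      -a'.1 - (g - f) • CVec.ofReal ((0 : EM), (1 : ℝ)) := by
    rw [hfg]
    rfl
  refine ⟨push (LinearMap.fst ℝ EM ℝ) a'.1, f, g, pull (LinearMap.inl ℝ EM ℝ) a'.2,
    ⟨?_, ?_, ?_⟩, ?_, ?_, ?_⟩
  · rw [genIso_symm_apply, ← push_comp, hpf]
  · rw [genIso_symm_apply, push_apply, pull_ofReal, hps]
  · rw [genIso_symm_apply]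
    conv_lhs => rw [ha', map_add, map_smul]
    rfl
  · rw [genIso_symm_apply, ← push_comp, hqf, hb₁, map_sub, map_neg, map_smul, push_ofReal]
    refine LinearMap.ext fun α => ?_
    simp
  · rw [genIso_symm_apply, push_apply, pull_ofReal, hqs, hb₁]
    change -f - (g - f) * ((1 : ℝ) : ℂ) = -g
    push_cast
    ring
  · rw [genIso_symm_apply, hb, map_neg, map_add, map_smul]
    rfl

/-- The circle acts transitively on the fibres of q and its differential is the identity in frames.
So invariance under the action is fibre invariance in frames. -/
theorem mem_exoticForms_iff (u : ℤ → ∀ y : Y, Fib p (q y) → Ext (T EY y)) :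
    u ∈ ExoticForms EM EZ EY p q ↔ u ∈ completedSum EM EZ p (extRep EY) ∧
      IsFibreInvariant (fun y => extIso (frame hq hB y)) u := by
  refine and_congr_right fun _ => ⟨fun h n y y' z z' hz => ?_, fun h n c y z z' hz => ?_⟩
  · obtain ⟨c, rfl⟩ := hq.exists_smul_eq (z.2.symm.trans ((congrArg p hz.symm).trans z'.2))
    exact (extIso_eq_extIso_iff _ _ (frame_dAct hq hB c y) _ _).2 (h n c y z z' hz)
  · exact (extIso_eq_extIso_iff _ _ (frame_dAct hq hB c y) _ _).1 (h n y (c • y) z z' hz)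

theorem mem_exoticSections_iff (u : ℤ → ∀ y : Y, Fib p (q y) → GenTan (T EY y)) :
    u ∈ ExoticSections EM EZ EY p q ↔ u ∈ completedSum EM EZ p (genRep EY) ∧
      IsFibreInvariant (fun y => genIso (frame hq hB y)) u := by
  refine and_congr_right fun _ => ⟨fun h n y y' z z' hz => ?_, fun h n c y z z' hz => ?_⟩
  · obtain ⟨c, rfl⟩ := hq.exists_smul_eq (z.2.symm.trans ((congrArg p hz.symm).trans z'.2))
    exact (genIso_eq_genIso_iff _ _ (frame_dAct hq hB c y) _ _).2 (h n c y z z' hz)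
  · exact (genIso_eq_genIso_iff _ _ (frame_dAct hq hB c y) _ _).1 (h n y (c • y) z z' hz)

/-- For scalars the map to M is the identity, whose fibres are points, so fibre invariance is
automatic. -/
theorem mem_exoticScalars_iff (u : ℤ → ∀ x : M, Fib p x → ℂ) :
    u ∈ ExoticScalars EM EZ p ↔
      u ∈ completedSum EM EZ p (q := fun x : M => x) (F := fun _ => ℂ) (funRep EM) ∧
      IsFibreInvariant (q := fun x : M => x) (FN := fun _ => ℂ)
        (fun _ => LinearEquiv.refl ℂ ℂ) u := by
  refine (and_iff_left_of_imp fun _ => ?_).symm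
  intro n x x' z z' h
  obtain rfl : x = x' := z.2.symm.trans ((congrArg p h.symm).trans z'.2)
  obtain rfl : z' = z := Subtype.ext h
  rfl

end Fibrewise

/-! ### Products on the circle bundle and products of exotic fields -/

section Multiplicativity

variable {EM EZ EY : Type*} [NormedAddCommGroup EM] [NormedSpace ℝ EM] [FiniteDimensional ℝ EM]
  [NormedAddCommGroup EZ] [NormedSpace ℝ EZ] [FiniteDimensional ℝ EZ]
  [NormedAddCommGroup EY] [NormedSpace ℝ EY] [FiniteDimensional ℝ EY]
  {M Z Y : Type*} [TopologicalSpace M] [ChartedSpace EM M] [IsManifold 𝓘(ℝ, EM) ∞ M]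
  [TopologicalSpace Z] [ChartedSpace EZ Z] [IsManifold 𝓘(ℝ, EZ) ∞ Z] [MulAction Circle Z]
  [TopologicalSpace Y] [ChartedSpace EY Y] [IsManifold 𝓘(ℝ, EY) ∞ Y] [MulAction Circle Y]
  {p : Z → M} {q : Y → M}
  (hp : IsPrincipalCircleBundle EM EZ p) (hq : IsPrincipalCircleBundle EM EY q)
  {A : ∀ z : Z, T EZ z →ₗ[ℝ] ℝ} (hA : IsConnectionForm EZ A)
  {B : ∀ y : Y, T EY y →ₗ[ℝ] ℝ} (hB : IsConnectionForm EY B)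

variable (EZ Z) in
/-- Smooth complex functions on `Z`. -/
abbrev Functions : Submodule ℂ (Z → ℂ) := smoothFields (funRep EZ)

/-- `turn` commutes with the transition maps, which act on the base directions only. The Hori
transformation is thus absorbed into the choice of frame on Z. -/
theorem isFraming_dualExtIso : IsFraming EM p (extRep EZ) (dualExtIso hp hA)
    (fun x₀ x => extIso (prodLine (chartEquiv EM x₀ x))) :=
  (isFraming_extRep hp.contMDiff_proj.continuous (contDiffAt_linFrame hp hA)).trans (turn EM)
    fun _ _ w => turn_extIso _ w

theorem isFraming_dualGenIso : IsFraming EM p (genRep EZ) (dualGenIso hp hA)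
    (fun x₀ x => genIso (prodLine (chartEquiv EM x₀ x))) :=
  (isFraming_genRep hp.contMDiff_proj.continuous (contDiffAt_linFrame hp hA)).trans (reflect EM)
    fun _ _ w => reflect_genIso _ w

/-- The product of functions on `Z`. -/
def functionMul : Functions EZ Z →ₗ[ℂ] Functions EZ Z →ₗ[ℂ] Functions EZ Z :=
  fieldProduct (fun _ : Z => LinearMap.mul ℂ ℂ)
    ((isFraming_funRep (EM := EM) p).bilin_mem (isFraming_funRep p) (isFraming_funRep p)
      hp.contMDiff_proj.continuous _ (LinearMap.mul ℂ ℂ) (fun _ _ _ => rfl) (fun _ _ _ _ => rfl))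

/-- The product of functions and sections on `Z`. -/
def sectionSMul : Functions EZ Z →ₗ[ℂ] Sections EZ Z →ₗ[ℂ] Sections EZ Z :=
  fieldProduct (fun z : Z => LinearMap.lsmul ℂ (GenTan (T EZ z)))
    ((isFraming_funRep (EM := EM) p).bilin_mem (isFraming_dualGenIso hp hA)
      (isFraming_dualGenIso hp hA) hp.contMDiff_proj.continuous _ (LinearMap.lsmul ℂ _)
      (fun z r w => map_smul (dualGenIso hp hA z) r w) (fun _ _ r w => map_smul _ r w))

/-- The product of functions and forms on `Z`. -/
def formSMul : Functions EZ Z →ₗ[ℂ] Forms EZ Z →ₗ[ℂ] Forms EZ Z :=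
  fieldProduct (fun z : Z => LinearMap.lsmul ℂ (Ext (T EZ z)))
    ((isFraming_funRep (EM := EM) p).bilin_mem (isFraming_dualExtIso hp hA)
      (isFraming_dualExtIso hp hA) hp.contMDiff_proj.continuous _ (LinearMap.lsmul ℂ _)
      (fun z r w => map_smul (dualExtIso hp hA z) r w) (fun _ _ r w => map_smul _ r w))

/-- The pairing of sections on `Z`. -/
def sectionPairing : Sections EZ Z →ₗ[ℂ] Sections EZ Z →ₗ[ℂ] Functions EZ Z :=
  fieldProduct (fun z : Z => pairingHom (V := T EZ z))
    ((isFraming_dualGenIso hp hA).bilin_mem (isFraming_dualGenIso hp hA)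
      (isFraming_funRep p) hp.contMDiff_proj.continuous _ pairingHom
      (fun z a b => (pairing_dualGenIso hp hA z a b).symm)
      (fun _ _ a b => (pairing_genIso _ a b).symm))

/-- The Clifford action of sections on forms on `Z`. -/
def sectionCliff : Sections EZ Z →ₗ[ℂ] Forms EZ Z →ₗ[ℂ] Forms EZ Z :=
  fieldProduct (fun z : Z => cliffHom (V := T EZ z))
    ((isFraming_dualGenIso hp hA).bilin_mem (isFraming_dualExtIso hp hA)
      (isFraming_dualExtIso hp hA) hp.contMDiff_proj.continuous _ cliffHom
      (fun z a b => dualExtIso_cliff hp hA z a b) (fun _ _ a b => extIso_cliff _ a b))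

variable {hp hA}

/-- This and its companions below are instances of the convolution theorem: the transform of a
pointwise product on Z is the exotic product of the transforms. They also supply convergence of the
sums over weights. -/
theorem isScalarMul_of_transform {φ : Functions EZ Z ≃ₗ[ℂ] ExoticScalars EM EZ p}
    (hφ : IsFourierTransform (q := fun x : M => x) (fun _ => LinearEquiv.refl ℂ ℂ)
      (fun _ => LinearEquiv.refl ℂ ℂ) φ) (f g : Functions EZ Z) :
    IsScalarMul (φ f) (φ g) (φ (functionMul hp f g)) := fun n x z =>
  (isFraming_funRep (EM := EM) p).hasWeakSum_bilin hp (isFraming_funRep p)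
    (e₃ := fun _ => LinearEquiv.refl ℂ ℂ) (LinearMap.mul ℂ ℂ)
    (k₁ := LinearEquiv.refl ℂ ℂ) (k₂ := LinearEquiv.refl ℂ ℂ) (k₃ := LinearEquiv.refl ℂ ℂ)
    (β := fun a b => a * b) (y := z.1) (n := n)
    (w₁ := fun m => (φ f).1 m x z)
    (w₂ := fun m => (φ g).1 m x z) (w₃ := (φ (functionMul hp f g)).1 n x z)
    (u₃ := (functionMul hp f g).1)
    f.2 g.2 (fun _ => rfl) (fun _ _ => rfl) (fun m => hφ.1 f m x z) (fun m => hφ.1 g m x z)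
    (hφ.1 _ n x z)

theorem isScalarSMul_of_transform {φ : Functions EZ Z ≃ₗ[ℂ] ExoticScalars EM EZ p}
    (hφ : IsFourierTransform (q := fun x : M => x) (fun _ => LinearEquiv.refl ℂ ℂ)
      (fun _ => LinearEquiv.refl ℂ ℂ) φ) {μ : Sections EZ Z ≃ₗ[ℂ] ExoticSections EM EZ EY p q}
    (hμ : IsFourierTransform (dualGenIso hp hA) (fun y => genIso (frame hq hB y)) μ)
    (f : Functions EZ Z) (a : Sections EZ Z) :
    IsScalarSMul (φ f) (μ a) (μ (sectionSMul hp hA f a)) := fun n y z =>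
  (isFraming_funRep (EM := EM) p).hasWeakSum_bilin hp (isFraming_dualGenIso hp hA)
    (e₃ := dualGenIso hp hA) (k₁ := LinearEquiv.refl ℂ ℂ) (k₂ := genIso (frame hq hB y))
    (k₃ := genIso (frame hq hB y)) (β := fun r w => r • w) (y := z.1) (n := n)
    (w₁ := fun m => (φ f).1 m (q y) z)
    (w₂ := fun m => (μ a).1 m y z) (w₃ := (μ (sectionSMul hp hA f a)).1 n y z)
    (u₃ := (sectionSMul hp hA f a).1)
    (LinearMap.lsmul ℂ _) f.2 a.2 (fun z => map_smul (dualGenIso hp hA z) _ _)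
    (fun r w => map_smul _ r w) (fun m => hφ.1 f m (q y) z) (fun m => hμ.1 a m y z) (hμ.1 _ n y z)

theorem isScalarAction_of_transform {φ : Functions EZ Z ≃ₗ[ℂ] ExoticScalars EM EZ p}
    (hφ : IsFourierTransform (q := fun x : M => x) (fun _ => LinearEquiv.refl ℂ ℂ)
      (fun _ => LinearEquiv.refl ℂ ℂ) φ) {τ : Forms EZ Z ≃ₗ[ℂ] ExoticForms EM EZ EY p q}
    (hτ : IsFourierTransform (dualExtIso hp hA) (fun y => extIso (frame hq hB y)) τ)
    (f : Functions EZ Z) (η : Forms EZ Z) :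
    IsScalarAction (φ f) (τ η) (τ (formSMul hp hA f η)) := fun n y z =>
  (isFraming_funRep (EM := EM) p).hasWeakSum_bilin hp (isFraming_dualExtIso hp hA)
    (e₃ := dualExtIso hp hA) (k₁ := LinearEquiv.refl ℂ ℂ) (k₂ := extIso (frame hq hB y))
    (k₃ := extIso (frame hq hB y)) (β := fun r w => r • w) (y := z.1) (n := n)
    (w₁ := fun m => (φ f).1 m (q y) z)
    (w₂ := fun m => (τ η).1 m y z) (w₃ := (τ (formSMul hp hA f η)).1 n y z)
    (u₃ := (formSMul hp hA f η).1)
    (LinearMap.lsmul ℂ _) f.2 η.2 (fun z => map_smul (dualExtIso hp hA z) _ _)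
    (fun r w => map_smul _ r w) (fun m => hφ.1 f m (q y) z) (fun m => hτ.1 η m y z) (hτ.1 _ n y z)

theorem isExoticPairing_of_transform {φ : Functions EZ Z ≃ₗ[ℂ] ExoticScalars EM EZ p}
    (hφ : IsFourierTransform (q := fun x : M => x) (fun _ => LinearEquiv.refl ℂ ℂ)
      (fun _ => LinearEquiv.refl ℂ ℂ) φ) {μ : Sections EZ Z ≃ₗ[ℂ] ExoticSections EM EZ EY p q}
    (hμ : IsFourierTransform (dualGenIso hp hA) (fun y => genIso (frame hq hB y)) μ)
    (a b : Sections EZ Z) :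
    IsExoticPairing (μ a) (μ b) (φ (sectionPairing hp hA a b)) := fun n y z =>
  (isFraming_dualGenIso hp hA).hasWeakSum_bilin hp (isFraming_dualGenIso hp hA)
    (e₃ := fun _ => LinearEquiv.refl ℂ ℂ)
    (k₁ := genIso (frame hq hB y)) (k₂ := genIso (frame hq hB y))
    (k₃ := LinearEquiv.refl ℂ ℂ) (β := pairing) (y := z.1) (n := n)
    (w₁ := fun m => (μ a).1 m y z)
    (w₂ := fun m => (μ b).1 m y z) (w₃ := (φ (sectionPairing hp hA a b)).1 n (q y) z)
    (u₃ := (sectionPairing hp hA a b).1)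
    pairingHom
    a.2 b.2 (fun z => (pairing_dualGenIso hp hA z _ _).symm)
    (fun _ _ => (pairing_genIso _ _ _).symm) (fun m => hμ.1 a m y z) (fun m => hμ.1 b m y z)
    (hφ.1 _ n (q y) z)

theorem isExoticAction_of_transform {μ : Sections EZ Z ≃ₗ[ℂ] ExoticSections EM EZ EY p q}
    (hμ : IsFourierTransform (dualGenIso hp hA) (fun y => genIso (frame hq hB y)) μ)
    {τ : Forms EZ Z ≃ₗ[ℂ] ExoticForms EM EZ EY p q}
    (hτ : IsFourierTransform (dualExtIso hp hA) (fun y => extIso (frame hq hB y)) τ)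
    (a : Sections EZ Z) (η : Forms EZ Z) :
    IsExoticAction (μ a) (τ η) (τ (sectionCliff hp hA a η)) := fun n y z =>
  (isFraming_dualGenIso hp hA).hasWeakSum_bilin hp (isFraming_dualExtIso hp hA)
    (e₃ := dualExtIso hp hA) (k₁ := genIso (frame hq hB y)) (k₂ := extIso (frame hq hB y))
    (k₃ := extIso (frame hq hB y)) (β := cliff) (y := z.1) (n := n)
    (w₁ := fun m => (μ a).1 m y z)
    (w₂ := fun m => (τ η).1 m y z) (w₃ := (τ (sectionCliff hp hA a η)).1 n y z)
    (u₃ := (sectionCliff hp hA a η).1)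
    cliffHom
    a.2 η.2 (fun z => dualExtIso_cliff hp hA z _ _) (fun _ _ => extIso_cliff _ _ _)
    (fun m => hμ.1 a m y z) (fun m => hτ.1 η m y z) (hτ.1 _ n y z)

end Multiplicativity

/-! ### Transport of actions along linear isomorphisms. -/

section ConjAction

variable {X F X' F' X'' F'' Ω Ω' : Type*} [AddCommGroup X] [Module ℂ X] [AddCommGroup F]
  [Module ℂ F] [AddCommGroup X'] [Module ℂ X'] [AddCommGroup F'] [Module ℂ F'] [AddCommGroup X'']
  [Module ℂ X''] [AddCommGroup F''] [Module ℂ F''] [AddCommGroup Ω] [Module ℂ Ω] [AddCommGroup Ω']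
  [Module ℂ Ω'] {φ : F ≃ₗ[ℂ] X} {φ' : F' ≃ₗ[ℂ] X'} {φ'' : F'' ≃ₗ[ℂ] X''} {τ : Ω ≃ₗ[ℂ] Ω'}
  {m : F →ₗ[ℂ] Ω →ₗ[ℂ] Ω} {m' : F' →ₗ[ℂ] Ω →ₗ[ℂ] Ω} {m'' : F'' →ₗ[ℂ] Ω →ₗ[ℂ] Ω}

variable (φ τ m) in
/-- An action carried along linear isomorphisms. -/
def conjAction : X →ₗ[ℂ] Module.End ℂ Ω' :=
  LinearMap.mk₂ ℂ (fun x η => τ (m (φ.symm x) (τ.symm η))) (fun _ _ _ => by simp)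
    (fun _ _ _ => by simp) (fun _ _ _ => by simp) (fun _ _ _ => by simp)

theorem conjAction_apply (x : X) (η : Ω) : conjAction φ τ m x (τ η) = τ (m (φ.symm x) η) :=
  congrArg (fun η => τ (m (φ.symm x) η)) (τ.symm_apply_apply η)

theorem conjAction_apply_apply (x : F) (η : Ω) : conjAction φ τ m (φ x) (τ η) = τ (m x η) := by
  rw [conjAction_apply, LinearEquiv.symm_apply_apply]

theorem conjAction_eq_one {x : X} (h : ∀ η, m (φ.symm x) η = η) : conjAction φ τ m x = 1 := by
  refine LinearMap.ext fun η => ?_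
  obtain ⟨η, rfl⟩ := τ.surjective η
  rw [conjAction_apply, h, Module.End.one_apply]

theorem conjAction_mul {x : X} {x' : X'} {x'' : X''}
    (h : ∀ η, m'' (φ''.symm x'') η = m (φ.symm x) (m' (φ'.symm x') η)) :
    conjAction φ τ m x * conjAction φ' τ m' x' = conjAction φ'' τ m'' x'' := by
  refine LinearMap.ext fun η => ?_
  obtain ⟨η, rfl⟩ := τ.surjective η
  rw [Module.End.mul_apply, conjAction_apply, conjAction_apply, conjAction_apply, h]

theorem conjAction_comm {x : X} {x' : X'}
    (h : ∀ η, m (φ.symm x) (m' (φ'.symm x') η) = m' (φ'.symm x') (m (φ.symm x) η)) :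
    conjAction φ τ m x * conjAction φ' τ m' x' = conjAction φ' τ m' x' * conjAction φ τ m x := by
  refine LinearMap.ext fun η => ?_
  obtain ⟨η, rfl⟩ := τ.surjective η
  simp only [Module.End.mul_apply, conjAction_apply, h]

end ConjAction

/-! ### Exotic products, the Clifford action and the duality maps. -/

section Consequences

variable {EM EZ EY : Type*} [NormedAddCommGroup EM] [NormedSpace ℝ EM] [FiniteDimensional ℝ EM]
  [NormedAddCommGroup EZ] [NormedSpace ℝ EZ] [FiniteDimensional ℝ EZ]
  [NormedAddCommGroup EY] [NormedSpace ℝ EY] [FiniteDimensional ℝ EY]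
  {M Z Y : Type*} [TopologicalSpace M] [ChartedSpace EM M] [IsManifold 𝓘(ℝ, EM) ∞ M]
  [TopologicalSpace Z] [ChartedSpace EZ Z] [IsManifold 𝓘(ℝ, EZ) ∞ Z] [MulAction Circle Z]
  [TopologicalSpace Y] [ChartedSpace EY Y] [IsManifold 𝓘(ℝ, EY) ∞ Y] [MulAction Circle Y]
  {p : Z → M} {q : Y → M}
  {hp : IsPrincipalCircleBundle EM EZ p} {hq : IsPrincipalCircleBundle EM EY q}
  {A : ∀ z : Z, T EZ z →ₗ[ℝ] ℝ} {hA : IsConnectionForm EZ A}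
  {B : ∀ y : Y, T EY y →ₗ[ℝ] ℝ} {hB : IsConnectionForm EY B}

theorem exists_isScalarOne {φ : Functions EZ Z ≃ₗ[ℂ] ExoticScalars EM EZ p}
    (hφ : IsFourierTransform (q := fun x : M => x) (fun _ => LinearEquiv.refl ℂ ℂ)
      (fun _ => LinearEquiv.refl ℂ ℂ) φ) : ∃ f : ExoticScalars EM EZ p, IsScalarOne f := by
  have h1 : (fun _ : Z => (1 : ℂ)) ∈ Functions EZ Z := fun y₀ l =>
    contDiffOn_const (c := l 1)
  refine ⟨φ ⟨_, h1⟩, fun n x z => ?_⟩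
  refine (hφ.1 ⟨_, h1⟩ n x z LinearMap.id).2.trans ?_
  have h2 := integral_rot_mul_of_hasSum (c := fun m => if m = 0 then 1 else 0) (f := fun _ => 1)
    (summable_of_ne_finset_zero (s := {0}) fun m hm => by simpa using hm) (fun s => by
      have h := hasSum_ite_eq (0 : ℤ) (1 : ℂ)
      convert h using 2 with m
      by_cases hm : m = 0 <;> simp [hm]) n
  exact h2

theorem IsScalarOne.symm_apply {φ : Functions EZ Z ≃ₗ[ℂ] ExoticScalars EM EZ p}
    (hφ : IsFourierTransform (q := fun x : M => x) (fun _ => LinearEquiv.refl ℂ ℂ)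
      (fun _ => LinearEquiv.refl ℂ ℂ) φ) {f : ExoticScalars EM EZ p} (hf : IsScalarOne f) (z : Z) :
    (φ.symm f).1 z = 1 := by
  have h := hφ.2 (φ.symm f) (p z) ⟨z, rfl⟩
  simp only [LinearEquiv.apply_symm_apply] at h
  refine HasWeakSum.unique h fun l => ?_
  refine HasSum.congr_fun (hasSum_ite_eq (0 : ℤ) (l 1)) fun n => ?_
  refine (congrArg l (hf n (p z) ⟨z, rfl⟩)).trans ?_
  split_ifs <;> simp

/-- Weak sums are unique, so the relation determines its result, which must be the transform of the
product on Z. Here and in the analogues below, a relation among exotic objects becomes a pointwise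
identity on Z. -/
theorem IsScalarMul.symm_eq {φ : Functions EZ Z ≃ₗ[ℂ] ExoticScalars EM EZ p}
    (hφ : IsFourierTransform (q := fun x : M => x) (fun _ => LinearEquiv.refl ℂ ℂ)
      (fun _ => LinearEquiv.refl ℂ ℂ) φ) {f g h : ExoticScalars EM EZ p}
    (hh : IsScalarMul f g h) : φ.symm h = functionMul hp (φ.symm f) (φ.symm g) := by
  obtain ⟨f, rfl⟩ := φ.surjective f
  obtain ⟨g, rfl⟩ := φ.surjective g
  rw [LinearEquiv.symm_apply_eq, LinearEquiv.symm_apply_apply, LinearEquiv.symm_apply_apply]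
  exact Subtype.ext (funext fun n => funext fun x => funext fun z =>
    (hh n x z).unique (isScalarMul_of_transform hφ f g n x z))

theorem IsScalarSMul.symm_eq {φ : Functions EZ Z ≃ₗ[ℂ] ExoticScalars EM EZ p}
    (hφ : IsFourierTransform (q := fun x : M => x) (fun _ => LinearEquiv.refl ℂ ℂ)
      (fun _ => LinearEquiv.refl ℂ ℂ) φ)
    {μ : Sections EZ Z ≃ₗ[ℂ] ExoticSections EM EZ EY p q}
    (hμ : IsFourierTransform (dualGenIso hp hA) (fun y => genIso (frame hq hB y)) μ)
    {f : ExoticScalars EM EZ p} {a b : ExoticSections EM EZ EY p q} (h : IsScalarSMul f a b) :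
    μ.symm b = sectionSMul hp hA (φ.symm f) (μ.symm a) := by
  obtain ⟨f, rfl⟩ := φ.surjective f
  obtain ⟨a, rfl⟩ := μ.surjective a
  rw [LinearEquiv.symm_apply_eq, LinearEquiv.symm_apply_apply, LinearEquiv.symm_apply_apply]
  exact Subtype.ext (funext fun n => funext fun y => funext fun z =>
    (h n y z).unique (isScalarSMul_of_transform hq hB hφ hμ f a n y z))

theorem IsExoticPairing.symm_eq {φ : Functions EZ Z ≃ₗ[ℂ] ExoticScalars EM EZ p}
    (hφ : IsFourierTransform (q := fun x : M => x) (fun _ => LinearEquiv.refl ℂ ℂ)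
      (fun _ => LinearEquiv.refl ℂ ℂ) φ)
    {μ : Sections EZ Z ≃ₗ[ℂ] ExoticSections EM EZ EY p q}
    (hμ : IsFourierTransform (dualGenIso hp hA) (fun y => genIso (frame hq hB y)) μ)
    {f : ExoticScalars EM EZ p} {a b : ExoticSections EM EZ EY p q} (h : IsExoticPairing a b f) :
    φ.symm f = sectionPairing hp hA (μ.symm a) (μ.symm b) := by
  obtain ⟨a, rfl⟩ := μ.surjective a
  obtain ⟨b, rfl⟩ := μ.surjective b
  rw [LinearEquiv.symm_apply_eq, LinearEquiv.symm_apply_apply, LinearEquiv.symm_apply_apply]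
  refine Subtype.ext (funext fun n => funext fun x => ?_)
  -- The pairing is prescribed only at points of the form q y; surjectivity shows that these are all
  -- points of M.
  obtain ⟨y, rfl⟩ := hq.surjective x
  exact funext fun z => (h n y z).unique (isExoticPairing_of_transform hq hB hφ hμ a b n y z)

theorem formSMul_functionMul (f g : Functions EZ Z) (η : Forms EZ Z) :
    formSMul hp hA (functionMul hp f g) η = formSMul hp hA f (formSMul hp hA g η) :=
  Subtype.ext (funext fun z => mul_smul (f.1 z) (g.1 z) (η.1 z))

theorem sectionCliff_sectionSMul (f : Functions EZ Z) (a : Sections EZ Z) (η : Forms EZ Z) :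
    sectionCliff hp hA (sectionSMul hp hA f a) η = formSMul hp hA f (sectionCliff hp hA a η) :=
  Subtype.ext (funext fun z => (cliffHom (V := T EZ z)).map_smul₂ (f.1 z) (a.1 z) (η.1 z))

theorem sectionCliff_formSMul (f : Functions EZ Z) (a : Sections EZ Z) (η : Forms EZ Z) :
    sectionCliff hp hA a (formSMul hp hA f η) = formSMul hp hA f (sectionCliff hp hA a η) :=
  Subtype.ext (funext fun z => map_smul (cliffHom (V := T EZ z) (a.1 z)) (f.1 z) (η.1 z))

theorem sectionCliff_sectionCliff (a : Sections EZ Z) (η : Forms EZ Z) :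
    sectionCliff hp hA a (sectionCliff hp hA a η) =
      formSMul hp hA (sectionPairing hp hA a a) η :=
  Subtype.ext (funext fun z => cliff_cliff (a.1 z) (η.1 z))

theorem sectionCliff_apply (a : Sections EZ Z) (η : Forms EZ Z) (z : Z) :
    (sectionCliff hp hA a η).1 z = cliff (a.1 z) (η.1 z) := rfl

/-- Each defining relation of the Clifford algebra, carried back to Z by the transforms, is a
pointwise identity there. In particular the square relation is `cliff_cliff`. -/
theorem exists_exoticAction {φ : Functions EZ Z ≃ₗ[ℂ] ExoticScalars EM EZ p}
    (hφ : IsFourierTransform (q := fun x : M => x) (fun _ => LinearEquiv.refl ℂ ℂ)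
      (fun _ => LinearEquiv.refl ℂ ℂ) φ)
    {μ : Sections EZ Z ≃ₗ[ℂ] ExoticSections EM EZ EY p q}
    (hμ : IsFourierTransform (dualGenIso hp hA) (fun y => genIso (frame hq hB y)) μ)
    (τ : Forms EZ Z ≃ₗ[ℂ] ExoticForms EM EZ EY p q) :
    ∃ ρ : ExoticClifford EM EZ EY p q →ₐ[ℂ] Module.End ℂ (ExoticForms EM EZ EY p q),
      (∀ f, ρ (cliffScalar f) = conjAction φ τ (formSMul hp hA) f) ∧
      ∀ a, ρ (cliffSection a) = conjAction μ τ (sectionCliff hp hA) a :=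
  exists_cliffordLift (EM := EM) (EZ := EZ) (EY := EY) (p := p) (q := q)
    (𝓑 := Module.End ℂ (ExoticForms EM EZ EY p q)) (conjAction φ τ (formSMul hp hA))
    (conjAction μ τ (sectionCliff hp hA))
    (fun _ hf => conjAction_eq_one fun η => Subtype.ext (funext fun z =>
      (congrArg (· • η.1 z) (hf.symm_apply hφ z)).trans (one_smul ℂ _)))
    (fun _ _ _ hh => conjAction_mul fun η =>
      (congrArg (fun k => formSMul hp hA k η) (hh.symm_eq hφ)).trans (formSMul_functionMul _ _ η))
    (fun _ _ _ h => conjAction_mul fun η =>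
      (congrArg (fun k => sectionCliff hp hA k η) (h.symm_eq hφ hμ)).trans
        (sectionCliff_sectionSMul _ _ η))
    (fun _ _ => conjAction_comm fun η => sectionCliff_formSMul _ _ η)
    (fun _ _ h => conjAction_mul fun η =>
      (congrArg (fun k => formSMul hp hA k η) (h.symm_eq hφ hμ)).trans
        (sectionCliff_sectionCliff _ η).symm)

theorem isExoticAction_conjAction {μ : Sections EZ Z ≃ₗ[ℂ] ExoticSections EM EZ EY p q}
    (hμ : IsFourierTransform (dualGenIso hp hA) (fun y => genIso (frame hq hB y)) μ)
    {τ : Forms EZ Z ≃ₗ[ℂ] ExoticForms EM EZ EY p q}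
    (hτ : IsFourierTransform (dualExtIso hp hA) (fun y => extIso (frame hq hB y)) τ)
    (a : ExoticSections EM EZ EY p q) (η : ExoticForms EM EZ EY p q) :
    IsExoticAction a η (conjAction μ τ (sectionCliff hp hA) a η) := by
  obtain ⟨a, rfl⟩ := μ.surjective a
  obtain ⟨η, rfl⟩ := τ.surjective η
  rw [conjAction_apply_apply]
  exact isExoticAction_of_transform hq hB hμ hτ a η

theorem isScalarAction_conjAction {φ : Functions EZ Z ≃ₗ[ℂ] ExoticScalars EM EZ p}
    (hφ : IsFourierTransform (q := fun x : M => x) (fun _ => LinearEquiv.refl ℂ ℂ)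
      (fun _ => LinearEquiv.refl ℂ ℂ) φ) {τ : Forms EZ Z ≃ₗ[ℂ] ExoticForms EM EZ EY p q}
    (hτ : IsFourierTransform (dualExtIso hp hA) (fun y => extIso (frame hq hB y)) τ)
    (f : ExoticScalars EM EZ p) (η : ExoticForms EM EZ EY p q) :
    IsScalarAction f η (conjAction φ τ (formSMul hp hA) f η) := by
  obtain ⟨f, rfl⟩ := φ.surjective f
  obtain ⟨η, rfl⟩ := τ.surjective η
  rw [conjAction_apply_apply]
  exact isScalarAction_of_transform hq hB hφ hτ f η

theorem exists_isScalarMul {φ : Functions EZ Z ≃ₗ[ℂ] ExoticScalars EM EZ p}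
    (hp : IsPrincipalCircleBundle EM EZ p)
    (hφ : IsFourierTransform (q := fun x : M => x) (fun _ => LinearEquiv.refl ℂ ℂ)
      (fun _ => LinearEquiv.refl ℂ ℂ) φ) (f g : ExoticScalars EM EZ p) :
    ∃ h, IsScalarMul f g h := by
  obtain ⟨f, rfl⟩ := φ.surjective f
  obtain ⟨g, rfl⟩ := φ.surjective g
  exact ⟨_, isScalarMul_of_transform (hp := hp) hφ f g⟩

theorem exists_isScalarSMul {φ : Functions EZ Z ≃ₗ[ℂ] ExoticScalars EM EZ p}
    (hφ : IsFourierTransform (q := fun x : M => x) (fun _ => LinearEquiv.refl ℂ ℂ)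
      (fun _ => LinearEquiv.refl ℂ ℂ) φ)
    {μ : Sections EZ Z ≃ₗ[ℂ] ExoticSections EM EZ EY p q}
    (hμ : IsFourierTransform (dualGenIso hp hA) (fun y => genIso (frame hq hB y)) μ)
    (f : ExoticScalars EM EZ p) (a : ExoticSections EM EZ EY p q) : ∃ b, IsScalarSMul f a b := by
  obtain ⟨f, rfl⟩ := φ.surjective f
  obtain ⟨a, rfl⟩ := μ.surjective a
  exact ⟨_, isScalarSMul_of_transform hq hB hφ hμ f a⟩

theorem exists_isExoticPairing {φ : Functions EZ Z ≃ₗ[ℂ] ExoticScalars EM EZ p}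
    (hφ : IsFourierTransform (q := fun x : M => x) (fun _ => LinearEquiv.refl ℂ ℂ)
      (fun _ => LinearEquiv.refl ℂ ℂ) φ)
    {μ : Sections EZ Z ≃ₗ[ℂ] ExoticSections EM EZ EY p q}
    (hμ : IsFourierTransform (dualGenIso hp hA) (fun y => genIso (frame hq hB y)) μ)
    (a b : ExoticSections EM EZ EY p q) : ∃ f, IsExoticPairing a b f := by
  obtain ⟨a, rfl⟩ := μ.surjective a
  obtain ⟨b, rfl⟩ := μ.surjective b
  exact ⟨_, isExoticPairing_of_transform hq hB hφ hμ a b⟩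

/-- Every term of the sum has the shifted parity, and subspaces are closed under weak sums. -/
theorem IsExoticAction.hasParity {a : ExoticSections EM EZ EY p q}
    {η θ : ExoticForms EM EZ EY p q} (h : IsExoticAction a η θ) {k : ZMod 2}
    (hη : ExoticForms.HasParity k η) : ExoticForms.HasParity (k + 1) θ := fun n y z =>
  (h n y z).mem fun m => cliff_mem_parity _ (hη (n - m) y z)

theorem isDualSection_of_transform {μ : Sections EZ Z ≃ₗ[ℂ] ExoticSections EM EZ EY p q}
    (hμ : IsFourierTransform (dualGenIso hp hA) (fun y => genIso (frame hq hB y)) μ)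
    (a : Sections EZ Z) : IsDualSection A B a (μ a) := fun n y z => by
  refine ⟨_, fun t => isDualVector_dualGenIso hp hq hA hB (rot t • z.1) y _, ?_⟩
  simpa using (hμ.1 a n y z).map (genIso (frame hq hB y)).symm.toLinearMap

theorem isExoticHori_of_transform {τ : Forms EZ Z ≃ₗ[ℂ] ExoticForms EM EZ EY p q}
    (hτ : IsFourierTransform (dualExtIso hp hA) (fun y => extIso (frame hq hB y)) τ)
    (η : Forms EZ Z) : IsExoticHori A B η (τ η) := fun n y z => by
  refine ⟨_, fun t => isHoriIntegrand_dualExtIso hp hq hA hB (rot t • z.1) y _, ?_⟩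
  simpa using (hτ.1 η n y z).map (extIso (frame hq hB y)).symm.toLinearMap

/-- Parity passes to the coefficients through the integrals and back to the field through the
Fourier sum. The shift by one comes from `turn`, which is odd. -/
theorem hasParity_iff_of_transform {τ : Forms EZ Z ≃ₗ[ℂ] ExoticForms EM EZ EY p q}
    (hτ : IsFourierTransform (dualExtIso hp hA) (fun y => extIso (frame hq hB y)) τ) (k : ZMod 2)
    (η : Forms EZ Z) : Forms.HasParity k η ↔ ExoticForms.HasParity (k + 1) (τ η) := by
  refine ⟨fun h n y z => ?_, fun h z => ?_⟩
  · rw [← extIso_mem_parity_iff (frame hq hB y)]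
    exact (hτ.1 η n y z).mem fun t => Submodule.smul_mem _ _
      ((dualExtIso_mem_parity_iff hp hA _).2 (h _))
  · obtain ⟨y, hy⟩ := hq.surjective (p z)
    rw [← dualExtIso_mem_parity_iff hp hA]
    exact (hτ.2 η y ⟨z, hy.symm⟩).mem fun n => (extIso_mem_parity_iff _).2 (h n y _)

variable (EM EZ) in
theorem exists_functionTransform (hp : IsPrincipalCircleBundle EM EZ p) :
    ∃ φ : Functions EZ Z ≃ₗ[ℂ] ExoticScalars EM EZ p, IsFourierTransform (q := fun x : M => x)
      (fun _ => LinearEquiv.refl ℂ ℂ) (fun _ => LinearEquiv.refl ℂ ℂ) φ :=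
  (isFraming_funRep (EM := EM) (E := EZ) p).exists_transport hp hasLocalSections_id
    (isFraming_funRep fun x : M => x) (ExoticScalars EM EZ p) mem_exoticScalars_iff

theorem exists_sectionTransform (hp : IsPrincipalCircleBundle EM EZ p)
    (hq : IsPrincipalCircleBundle EM EY q) (hA : IsConnectionForm EZ A)
    (hB : IsConnectionForm EY B) : ∃ μ : Sections EZ Z ≃ₗ[ℂ] ExoticSections EM EZ EY p q,
      IsFourierTransform (dualGenIso hp hA) (fun y => genIso (frame hq hB y)) μ :=
  (isFraming_dualGenIso hp hA).exists_transport hp hq.hasLocalSections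
    (isFraming_genRep hq.contMDiff_proj.continuous (contDiffAt_linFrame hq hB))
    (ExoticSections EM EZ EY p q) (mem_exoticSections_iff hq hB)

theorem exists_formTransform (hp : IsPrincipalCircleBundle EM EZ p)
    (hq : IsPrincipalCircleBundle EM EY q) (hA : IsConnectionForm EZ A)
    (hB : IsConnectionForm EY B) : ∃ τ : Forms EZ Z ≃ₗ[ℂ] ExoticForms EM EZ EY p q,
      IsFourierTransform (dualExtIso hp hA) (fun y => extIso (frame hq hB y)) τ :=
  (isFraming_dualExtIso hp hA).exists_transport hp hq.hasLocalSections
    (isFraming_extRep hq.contMDiff_proj.continuous (contDiffAt_linFrame hq hB))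
    (ExoticForms EM EZ EY p q) (mem_exoticForms_iff hq hB)

end Consequences

end ExoticCourant

end

/-! ### The Clifford action and the module isomorphism. -/

open ExoticCourant in
theorem theorem3p2
    {EM EZ EY : Type*} [NormedAddCommGroup EM] [NormedSpace ℝ EM] [FiniteDimensional ℝ EM]
    [NormedAddCommGroup EZ] [NormedSpace ℝ EZ] [FiniteDimensional ℝ EZ]
    [NormedAddCommGroup EY] [NormedSpace ℝ EY] [FiniteDimensional ℝ EY]
    {M Z Y : Type*} [TopologicalSpace M] [T2Space M] [SigmaCompactSpace M]
    [ChartedSpace EM M] [IsManifold 𝓘(ℝ, EM) ∞ M]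
    [TopologicalSpace Z] [ChartedSpace EZ Z] [IsManifold 𝓘(ℝ, EZ) ∞ Z] [MulAction Circle Z]
    [TopologicalSpace Y] [ChartedSpace EY Y] [IsManifold 𝓘(ℝ, EY) ∞ Y] [MulAction Circle Y]
    (p : Z → M) (q : Y → M)
    (hp : IsPrincipalCircleBundle EM EZ p) (hq : IsPrincipalCircleBundle EM EY q)
    (A : ∀ z : Z, T EZ z →ₗ[ℝ] ℝ) (hA : IsConnectionForm EZ A)
    (B : ∀ y : Y, T EY y →ₗ[ℝ] ℝ) (hB : IsConnectionForm EY B) :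
    (∃ f : ExoticScalars EM EZ p, IsScalarOne f) ∧
    (∀ f g : ExoticScalars EM EZ p, ∃ h, IsScalarMul f g h) ∧
    (∀ (f : ExoticScalars EM EZ p) (a : ExoticSections EM EZ EY p q), ∃ b, IsScalarSMul f a b) ∧
    (∀ a b : ExoticSections EM EZ EY p q, ∃ f, IsExoticPairing a b f) ∧
    ∃ (ρ : ExoticClifford EM EZ EY p q →ₐ[ℂ] Module.End ℂ (ExoticForms EM EZ EY p q))
      (c : Sections EZ Z →ₗ[ℂ] Module.End ℂ (Forms EZ Z))
      (μ : Sections EZ Z ≃ₗ[ℂ] ExoticSections EM EZ EY p q)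
      (τ : Forms EZ Z ≃ₗ[ℂ] ExoticForms EM EZ EY p q),
      (∀ a η, IsExoticAction a η (ρ (cliffSection a) η)) ∧
      (∀ f η, IsScalarAction f η (ρ (cliffScalar f) η)) ∧
      (∀ (k : ZMod 2) a η, ExoticForms.HasParity k η →
        ExoticForms.HasParity (k + 1) (ρ (cliffSection a) η)) ∧
      (∀ a η z, (c a η).1 z = cliff (a.1 z) (η.1 z)) ∧
      (∀ a, IsDualSection A B a (μ a)) ∧
      (∀ η, IsExoticHori A B η (τ η)) ∧
      (∀ (k : ZMod 2) η, Forms.HasParity k η ↔ ExoticForms.HasParity (k + 1) (τ η)) ∧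
      ∀ a η, τ (c a η) = ρ (cliffSection (μ a)) (τ η) := by
  -- All data come from the three Fourier transforms φ, μ, τ. As ρ on exotic sections is the
  -- pointwise Clifford action conjugated by μ and τ, the intertwining relation holds by
  -- construction.
  refine (exists_functionTransform EM EZ hp).elim fun φ hφ => ?_
  refine (exists_sectionTransform hp hq hA hB).elim fun μ hμ => ?_
  refine (exists_formTransform hp hq hA hB).elim fun τ hτ => ?_
  refine (exists_exoticAction hφ hμ τ).elim fun ρ hρ => ?_
  have hact : ∀ a η, IsExoticAction a η (ρ (cliffSection a) η) := fun a η =>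
    hρ.2 a ▸ isExoticAction_conjAction hμ hτ a η
  exact ⟨exists_isScalarOne hφ, exists_isScalarMul hp hφ, exists_isScalarSMul hφ hμ,
    exists_isExoticPairing hφ hμ, ρ, sectionCliff hp hA, μ, τ, hact,
    fun f η => hρ.1 f ▸ isScalarAction_conjAction hφ hτ f η, fun k a η h => (hact a η).hasParity h,
    sectionCliff_apply, isDualSection_of_transform hμ, isExoticHori_of_transform hτ,
    hasParity_iff_of_transform hτ,
    fun a η => ((LinearMap.congr_fun (hρ.2 (μ a)) (τ η)).trans (conjAction_apply_apply a η)).symm⟩
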